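/- **Setting.** Let $L\ge 1$, $c>0$, $\rho_{0,1}=\rho\in[0,1]$, $\rho_{\ell-1,\ell}\in[0,1]$ for $2\le\ell\le L$, and $\rho_{L,L+1}=0$. Let $f_0,f_1$ be probability densities with respect to a $\sigma$-finite measure $\nu$ on a measurable space $\mathcal X$ (for instance Lebesgue measure on $\mathbb R$). The change-points $\Gamma_1,\dots,\Gamma_L\in\{0,1,2,\dots\}\cup\{\infty\}$ of $L$ sensors form a Markov chain with $P(\Gamma_1=m)=\rho(1-\rho)^m$ and $P(\Gamma_\ell=m_1+m_2\mid\Gamma_{\ell-1}=m_2)=\rho_{\ell-1,\ell}(1-\rho_{\ell-1,\ell})^{m_1}$ for finite $m,m_1,m_2\ge0$; a geometric delay with parameter $0$ is infinite, and $\Gamma_{\ell-1}=\infty$ forces $\Gamma_\ell=\infty$. Given the change-points, the observations $Z_{k,\ell}$ ($k\ge1$, $1\le \ell\le L$) are independent, with density $f_0$ if $k<\Gamma_\ell$ and $f_1$ if $k\ge\Gamma_\ell$. Put $\mathbf Z_k=(Z_{k,1},\dots,Z_{k,L})$, $I_k=\sigma(\mathbf Z_1,\dots,\mathbf Z_k)$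 (with $I_0$ trivial), $T_{k,j}=\{\Gamma_i\le k \text{ for } i<j,\ \Gamma_i>k\text{ for } i\ge j\}$ and $p_{k,j}=P(T_{k,j}\mid I_k)$, $1\le j\le L+1$; $\mathbf p_k=(p_{k,1},\dots,p_{k,L+1})$. For an $(I_k)$-stopping time $\tau$ with values in $\{0,1,\dots\}\cup\{\infty\}$ the Bayes risk is $R(\tau)=P(\tau<\Gamma_1)+c\,E[(\tau-\Gamma_1)^+]$ (with $\infty-\infty=0$). Let $\mathcal P=\{\mathbf p\in\mathbb R^{L+1}: p_j\ge0,\ \sum_j p_j=1\}$. For $\mathbf p\in\mathcal P$ and $\mathbf z\in\mathcal X^L$ put $$w_{j,m}=(1-\rho_{j-1,j})\prod_{i=m}^{j-1}\rho_{i-1,i}\ \ (m\le j),\qquad w_{j,m}=0\ \ (m>j),$$ $$\Phi_j(\mathbf z)=\prod_{i<j}f_1(z_i)\prod_{i\ge j}f_0(z_i),\qquad \mathcal N_j(\mathbf p,\mathbf z)=\Big(\sum_{m=1}^{j}w_{j,m}p_m\Big)\Phi_j(\mathbf z),\qquad f(\mathbf z\mid\mathbf p)=\sum_{j=1}^{L+1}\mathcal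 N_j(\mathbf p,\mathbf z),$$ and $\mathbf p'(\mathbf p,\mathbf z)=\big(\mathcal N_j(\mathbf p,\mathbf z)/f(\mathbf z\mid\mathbf p)\big)_j$. Define the finite-horizon costs-to-go by $J_T^T(\mathbf p)=p_1$ and, for $0\le k<T$, $$J_k^T(\mathbf p)=\min\{p_1,\ c(1-p_1)+A_k^T(\mathbf p)\},\qquad A_k^T(\mathbf p)=\int J_{k+1}^T(\mathbf p'(\mathbf p,\mathbf z))\,f(\mathbf z\mid\mathbf p)\,d\nu^{\otimes L}(\mathbf z),$$ and put $J(\mathbf p)=\inf_T J_0^T(\mathbf p)$ and $A_J(\mathbf p)=\int J(\mathbf p'(\mathbf p,\mathbf z))\,f(\mathbf z\mid\mathbf p)\,d\nu^{\otimes L}(\mathbf z)$. **Theorem.** (a) *Structure.* For all $\mathbf p\in\mathcal P$ and all $k\ge0$: the integral defining $A_J(\mathbf p)$ converges absolutely, $\lim_{T\to\infty}J_k^T(\mathbf p)=J(\mathbf p)$, $\lim_{T\to\infty}A_k^T(\mathbf p)=A_J(\mathbf p)$, and $$J(\mathbf p)=\min\{p_1,\ c(1-p_1)+A_J(\mathbf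 p)\}.$$ The function $A_J$ is concave on $\mathcal P$, satisfies $0\le A_J\le1$ on $\mathcal P$, and vanishes at every $\mathbf p\in\mathcal P$ with $p_1=0$. (b) *POMDP and sufficient statistic.* For every $k$: almost surely exactly one of the events $T_{k,1},\dots,T_{k,L+1}$ occurs, and, given $\mathbf Z_1,\dots,\mathbf Z_k$ and all the indicators of $\{\Gamma_i\le n\}$, $n\le k$, the conditional probability of $T_{k+1,j}\cap\{\mathbf Z_{k+1}\in B\}$ is $w_{j,m}\int_B\Phi_j\,d\nu^{\otimes L}$ on $T_{k,m}$. For every stopping time $\tau$, $$R(\tau)=E\Big[\sum_{k<\tau}c(1-p_{k,1})+p_{\tau,1}\mathbf 1_{\{\tau<\infty\}}\Big].$$ Almost surely $\mathbf p_k\in\mathcal P$, $p_{0,j}=w_{j,1}$, $f(\mathbf Z_{k+1}\mid\mathbf p_k)>0$ and $\mathbf p_{k+1}=\mathbf p'(\mathbf p_k,\mathbf Z_{k+1})$; the conditional density of $\mathbf Z_{k+1}$ given $I_k$ is $f(\cdot\mid\mathbf p_k)$. The dynamic program on the information, $\widetilde J_T^T=P(\Gamma_1>T\mid I_T)$, $\widetilde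 J_k^T=\min\{P(\Gamma_1>k\mid I_k),\ cP(\Gamma_1\le k\mid I_k)+E[\widetilde J_{k+1}^T\mid I_k]\}$ for $k<T$, satisfies $\widetilde J_k^T=J_k^T(\mathbf p_k)$ almost surely for all $k\le T$. (c) *Optimal stopping rule.* If $\rho>0$, then $$\tau_{\rm opt}=\inf\{k\ge0:\ p_{k,1}(1+c)-c<A_J(\mathbf p_k)\}$$ is an almost surely finite stopping time that minimizes the Bayes risk over all stopping times, and $R(\tau_{\rm opt})=J(\mathbf p_0)$. -/

import Mathlib

open MeasureTheory ProbabilityTheory Filter Topology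
open scoped ENNReal

noncomputable section

namespace ChangeDetection

/-- `f` is a probability density with respect to the reference measure `ν`. -/
structure IsProbDensity {X : Type*} [MeasurableSpace X] (ν : Measure X) (f : X → ℝ) : Prop where
  measurable : Measurable f
  nonneg : ∀ x, 0 ≤ f x
  lintegral_eq_one : ∫⁻ x, ENNReal.ofReal (f x) ∂ν = 1

/-! ### The belief recursion

There are `L` sensors, indexed by `Fin L` (sensor `ℓ` of the usual numbering `1, …, L` has index
`ℓ - 1`), and `r i` is the geometric parameter of the propagation of the change to the sensor with
index `i` (from the disruption when `i = 0`, from its predecessor otherwise). A belief is a vector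
indexed by `Fin (L + 1)`: the coordinate `j` is the probability that exactly the first `j` sensors
have seen the change. Thus coordinate `0` is the probability of "no change yet". -/

variable {L : ℕ} {X : Type*} [MeasurableSpace X]

/-- The propagation parameters, extended by `0` at the (fictitious) sensor after the last one. -/
def rhoExt (r : Fin L → ℝ) (i : ℕ) : ℝ := if h : i < L then r ⟨i, h⟩ else 0

/-- One-step probability that the change spreads from the first `m` sensors to exactly the first
`j` sensors. -/
def transW (r : Fin L → ℝ) (j m : Fin (L + 1)) : ℝ :=
  if m ≤ j then (1 - rhoExt r j) * ∏ i ∈ Finset.Ico (m : ℕ) j, rhoExt r i else 0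

/-- Density of an observation vector when exactly the first `j` sensors have seen the change. -/
def obsDensity (f₀ f₁ : X → ℝ) (j : Fin (L + 1)) (z : Fin L → X) : ℝ :=
  ∏ i : Fin L, if (i : ℕ) < j then f₁ (z i) else f₀ (z i)

/-- The unnormalized posterior of state `j` after observing `z`, from the belief `p`. -/
def bayesNum (r : Fin L → ℝ) (f₀ f₁ : X → ℝ) (p : Fin (L + 1) → ℝ) (z : Fin L → X)
    (j : Fin (L + 1)) : ℝ :=
  (∑ m, transW r j m * p m) * obsDensity f₀ f₁ j z

/-- The density of the next observation vector, given the belief `p`. -/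
def predDensity (r : Fin L → ℝ) (f₀ f₁ : X → ℝ) (p : Fin (L + 1) → ℝ) (z : Fin L → X) : ℝ :=
  ∑ j, bayesNum r f₀ f₁ p z j

/-- The belief after observing `z`, from the belief `p`. -/
def beliefUpdate (r : Fin L → ℝ) (f₀ f₁ : X → ℝ) (p : Fin (L + 1) → ℝ) (z : Fin L → X) :
    Fin (L + 1) → ℝ :=
  fun j => bayesNum r f₀ f₁ p z j / predDensity r f₀ f₁ p z

/-- The belief at time `0`, before any observation. -/
def initBelief (r : Fin L → ℝ) : Fin (L + 1) → ℝ := fun j => transW r j 0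

/-! ### The dynamic program on beliefs -/

/-- Expected cost-to-go after the next observation, from the belief `p`, when the cost-to-go at the
next time is `J`. -/
def expNext (ν : Measure X) (r : Fin L → ℝ) (f₀ f₁ : X → ℝ) (J : (Fin (L + 1) → ℝ) → ℝ)
    (p : Fin (L + 1) → ℝ) : ℝ :=
  ∫ z, J (beliefUpdate r f₀ f₁ p z) * predDensity r f₀ f₁ p z ∂(Measure.pi fun _ : Fin L => ν)

/-- Backward induction with `n` stages left before stopping is forced. -/
def stageCost (ν : Measure X) (r : Fin L → ℝ) (f₀ f₁ : X → ℝ) (c : ℝ) :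
    ℕ → (Fin (L + 1) → ℝ) → ℝ
  | 0, p => p 0
  | n + 1, p => min (p 0) (c * (1 - p 0) + expNext ν r f₀ f₁ (stageCost ν r f₀ f₁ c n) p)

/-- The cost-to-go at time `k` of the problem with horizon `T` (used for `k ≤ T`). -/
def finCostToGo (ν : Measure X) (r : Fin L → ℝ) (f₀ f₁ : X → ℝ) (c : ℝ) (T k : ℕ) :
    (Fin (L + 1) → ℝ) → ℝ :=
  stageCost ν r f₀ f₁ c (T - k)

/-- The infinite-horizon cost-to-go: the infimum over the horizon `T` of the cost-to-go at time
`0`. -/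
def costToGo (ν : Measure X) (r : Fin L → ℝ) (f₀ f₁ : X → ℝ) (c : ℝ)
    (p : Fin (L + 1) → ℝ) : ℝ :=
  ⨅ T : ℕ, finCostToGo ν r f₀ f₁ c T 0 p

/-- The function `A_J`: the expected infinite-horizon cost-to-go after the next observation. -/
def contCost (ν : Measure X) (r : Fin L → ℝ) (f₀ f₁ : X → ℝ) (c : ℝ)
    (p : Fin (L + 1) → ℝ) : ℝ :=
  expNext ν r f₀ f₁ (costToGo ν r f₀ f₁ c) p

/-! ### The change process and the observations -/

/-- Probability mass function on `ℕ∞` of a geometric delay with parameter `r` (starting from `0`);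
the delay is infinite when `r = 0`. -/
def geomDelay (r : ℝ) (d : ℕ∞) : ℝ :=
  if d = ⊤ then (if r = 0 then 1 else 0) else r * (1 - r) ^ d.toNat

/-- Probability that the next sensor sees the change at `b` when the present one sees it at `a`. -/
def changeStep (r : ℝ) (a b : ℕ∞) : ℝ :=
  if a = ⊤ then (if b = ⊤ then 1 else 0) else if a ≤ b then geomDelay r (b - a) else 0

/-- The time at which the predecessor of sensor `i` sees the change, for change-points `m`;
the predecessor of the first sensor is the disruption clock, started at `0`. -/
def prevTime (m : Fin L → ℕ∞) (i : Fin L) : ℕ∞ :=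
  if h : (i : ℕ) = 0 then 0 else m ⟨i - 1, by omega⟩

/-- The joint-geometric Markov change process `Γ` with conditionally independent observations.
`Γ i` is the change-point at sensor `i`, and `Z k i` the observation of sensor `i` at time `k`;
observations are taken at the times `k ≥ 1` only, and nothing is assumed about `Z 0`. -/
structure IsChangeModel {Ω : Type*} [MeasurableSpace Ω] (μ : Measure Ω) (ν : Measure X)
    (r : Fin L → ℝ) (f₀ f₁ : X → ℝ) (Γ : Fin L → Ω → ℕ∞) (Z : ℕ → Ω → Fin L → X) : Prop where
  measurable_Γ : ∀ i, Measurable (Γ i)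
  /-- The change-points form a Markov chain along the array, with geometric delays. -/
  law_Γ : ∀ m : Fin L → ℕ∞,
    μ {ω | ∀ i, Γ i ω = m i} = ∏ i, ENNReal.ofReal (changeStep (r i) (prevTime m i) (m i))
  /-- Given the change-points, the observations are independent, with density `f₀` before the
  change-point of the sensor and `f₁` from it on. -/
  law_Z : ∀ (m : Fin L → ℕ∞) (n : ℕ) (B : ℕ → Fin L → Set X), (∀ k i, MeasurableSet (B k i)) →
    μ {ω | (∀ i, Γ i ω = m i) ∧ ∀ k ∈ Finset.Icc 1 n, ∀ i, Z k ω i ∈ B k i} =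
      μ {ω | ∀ i, Γ i ω = m i} * ∏ k ∈ Finset.Icc 1 n, ∏ i,
        ∫⁻ x in B k i, ENNReal.ofReal (if (k : ℕ∞) < m i then f₀ x else f₁ x) ∂ν

variable {Ω : Type*} [mΩ : MeasurableSpace Ω]

/-- The information at time `k`: the σ-algebra generated by the observations at times
`1, …, k`. -/
def obsFiltration (Z : ℕ → Ω → Fin L → X) (hZ : ∀ k, Measurable (Z k)) : Filtration ℕ mΩ where
  seq k := ⨆ n ∈ Finset.Icc 1 k, MeasurableSpace.comap (Z n) inferInstance
  mono' _ _ hkl := biSup_mono fun n hn => by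
    rw [Finset.mem_Icc] at hn ⊢
    exact ⟨hn.1, hn.2.trans hkl⟩
  le' _ := iSup₂_le fun n _ => (hZ n).comap_le

/-- The full history at time `k`: the σ-algebra generated by the sensor states
(`change seen / not seen`) at the times `0, …, k` and the observations at times `1, …, k`. -/
abbrev fullHistory (Γ : Fin L → Ω → ℕ∞) (Z : ℕ → Ω → Fin L → X) (k : ℕ) : MeasurableSpace Ω :=
  (⨆ n ∈ Finset.range (k + 1),
      MeasurableSpace.comap (fun ω (i : Fin L) => Γ i ω ≤ (n : ℕ∞)) inferInstance) ⊔
    ⨆ n ∈ Finset.Icc 1 k, MeasurableSpace.comap (Z n) inferInstance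

/-- The event that at time `k` exactly the first `j` sensors have seen the change. -/
def stateEvent (Γ : Fin L → Ω → ℕ∞) (k : ℕ) (j : Fin (L + 1)) : Set Ω :=
  {ω | ∀ i : Fin L, ((i : ℕ) < j → Γ i ω ≤ k) ∧ ((j : ℕ) ≤ i → (k : ℕ∞) < Γ i ω)}

/-- The vector of posterior probabilities of the states at time `k`. -/
def belief (μ : Measure Ω) (ℱ : Filtration ℕ mΩ) (Γ : Fin L → Ω → ℕ∞) (k : ℕ) (ω : Ω) :
    Fin (L + 1) → ℝ :=
  fun j => (μ⟦stateEvent Γ k j | ℱ k⟧) ω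

/-- The dynamic program on the information: the cost-to-go at time `k` with `n` stages left, that
is, with horizon `k + n`. `Γ₁` is the change-point of the first sensor. -/
def infoCostToGo (μ : Measure Ω) (ℱ : Filtration ℕ mΩ) (Γ₁ : Ω → ℕ∞) (c : ℝ) :
    ℕ → ℕ → Ω → ℝ
  | 0, k => μ⟦{ω | (k : ℕ∞) < Γ₁ ω} | ℱ k⟧
  | n + 1, k => fun ω => min ((μ⟦{ω | (k : ℕ∞) < Γ₁ ω} | ℱ k⟧) ω)
      (c * (μ⟦{ω | Γ₁ ω ≤ (k : ℕ∞)} | ℱ k⟧) ω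
        + (μ[infoCostToGo μ ℱ Γ₁ c n (k + 1) | ℱ k]) ω)

/-- The probability of false alarm `P(τ < Γ₁)`. -/
def probFalseAlarm (μ : Measure Ω) (Γ₁ τ : Ω → ℕ∞) : ℝ≥0∞ := μ {ω | τ ω < Γ₁ ω}

/-- The expected detection delay `E[(τ - Γ₁)⁺]`; subtraction in `ℕ∞` is truncated. -/
def expDelay (μ : Measure Ω) (Γ₁ τ : Ω → ℕ∞) : ℝ≥0∞ :=
  ∫⁻ ω, ((τ ω - Γ₁ ω : ℕ∞) : ℝ≥0∞) ∂μ

/-- The Bayes risk. -/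
def detectionRisk (μ : Measure Ω) (c : ℝ) (Γ₁ τ : Ω → ℕ∞) : ℝ≥0∞ :=
  probFalseAlarm μ Γ₁ τ + ENNReal.ofReal c * expDelay μ Γ₁ τ

/-- The additive cost of stopping at `τ`, in terms of the belief process `π`: running cost
`c (1 - π_{k,0})` at each time `k < τ`, and terminal cost `π_{τ,0}`. -/
def additiveCost (c : ℝ) (π : ℕ → Ω → Fin (L + 1) → ℝ) (τ : Ω → ℕ∞) (ω : Ω) : ℝ≥0∞ :=
  (∑' k : ℕ, if (k : ℕ∞) < τ ω then ENNReal.ofReal (c * (1 - π k ω 0)) else 0) +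
    ∑' k : ℕ, if τ ω = (k : ℕ∞) then ENNReal.ofReal (π k ω 0) else 0

/-- The first time `k` at which the affine function `p ↦ (1 + c) p₀ - c` is below `A` at the
belief `π_k` (infinite if there is none). -/
def crossingTime (c : ℝ) (A : (Fin (L + 1) → ℝ) → ℝ) (π : ℕ → Ω → Fin (L + 1) → ℝ) (ω : Ω) : ℕ∞ :=
  ⨅ (k : ℕ) (_ : π k ω 0 * (1 + c) - c < A (π k ω)), (k : ℕ∞)

end ChangeDetection

end

open ChangeDetection

namespace ChangeDetection

/-! ### Transition weights of the number of affected sensors -/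

section Transition

variable {L : ℕ} {r : Fin L → ℝ}

/-! Structure of the value functions. Every finite-horizon cost lies between `0` and the cost `p 0`
of stopping at once. Hence `J(p') f` is dominated by the unnormalized posterior of "no change"
(`expNext_integrand_le`), an integrable function that does not depend on `J` and has integral `(1 -
ρ) p 0`. This single bound gives integrability, the bounds on `A_J` and dominated convergence. The
costs decrease as the horizon grows, so they converge to their infimum and the recursion passes to
the limit (`costToGo_eq`). For concavity, `J(p') f` is the perspective of `J` evaluated at the
vector of unnormalized posteriors, which is linear in `p`; perspectives of concave functions are
superadditive (`perspective_superadditive`).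

Filtering. Memorylessness of the geometric delays makes the number of affected sensors a Markov
chain (`measure_state_transition`). The full history is carried by the observations and the
change-points capped at `k + 1`; summing over the countably many values of the latter gives the
transition law jointly with the next observation (`measure_fullHistory_inter_next`). Projecting on
the observed history shows that, on each state, the history and the next observation have the
unnormalized posterior as joint density (`setLIntegral_state_next`). Bayes' rule (`belief_succ`),
the predictive density and the sufficiency of the belief follow.

Optimality. By the fixed-point equation, accumulated running cost plus `J` at the current belief is
a submartingale, and it is conserved in mean as long as the crossing rule continues. Telescoping up
to time `n` bounds `J` at the initial belief by the partial cost of any rule plus a remainder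
(`costToGo_le_partial_cost`), with equality for the crossing rule (`costToGo_eq_partial_cost`). The
remainder is at most the probability that the change has not occurred by time `n`, which vanishes
when `ρ > 0`. -/

theorem rhoExt_mem (hr : ∀ i, r i ∈ Set.Icc (0 : ℝ) 1) (i : ℕ) :
    rhoExt r i ∈ Set.Icc (0 : ℝ) 1 := by
  unfold rhoExt
  split_ifs with h
  · exact hr _
  · simp

theorem rhoExt_self : rhoExt r L = 0 := by simp [rhoExt]

theorem transW_nonneg (hr : ∀ i, r i ∈ Set.Icc (0 : ℝ) 1) (j m : Fin (L + 1)) :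
    0 ≤ transW r j m := by
  unfold transW
  split_ifs
  · exact mul_nonneg (by linarith [(rhoExt_mem hr j).2])
      (Finset.prod_nonneg fun i _ => (rhoExt_mem hr i).1)
  · exact le_rfl

theorem predicted_nonneg (hr : ∀ i, r i ∈ Set.Icc (0 : ℝ) 1) {p : Fin (L + 1) → ℝ}
    (hp : ∀ m, 0 ≤ p m) (j : Fin (L + 1)) : 0 ≤ ∑ m, transW r j m * p m :=
  Finset.sum_nonneg fun m _ => mul_nonneg (transW_nonneg hr j m) (hp m)

end Transition

/-! ### Product densities of observation vectors -/

section Density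

variable {L : ℕ} {X : Type*} [MeasurableSpace X] {ν : Measure X}

theorem IsProbDensity.integrable {f : X → ℝ} (hf : IsProbDensity ν f) : Integrable f ν := by
  refine ⟨hf.measurable.aestronglyMeasurable, ?_⟩
  rw [hasFiniteIntegral_iff_ofReal (ae_of_all _ hf.nonneg), hf.lintegral_eq_one]
  exact ENNReal.one_lt_top

theorem IsProbDensity.integral_eq_one {f : X → ℝ} (hf : IsProbDensity ν f) :
    ∫ x, f x ∂ν = 1 := by
  rw [integral_eq_lintegral_of_nonneg_ae (ae_of_all _ hf.nonneg)
    hf.measurable.aestronglyMeasurable, hf.lintegral_eq_one]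
  simp

variable [SigmaFinite ν]

/-- Fubini for a product of functions of separate coordinates, applied to Bochner integrals.
Integrability and nonnegativity of the densities make the passage to and from lower integrals exact.
-/
theorem setLIntegral_prod_density {g : Fin L → X → ℝ} (hg : ∀ i, IsProbDensity ν (g i))
    (B : Fin L → Set X) :
    ∫⁻ z in Set.univ.pi B, ENNReal.ofReal (∏ i, g i (z i)) ∂(Measure.pi fun _ : Fin L => ν)
      = ∏ i, ∫⁻ x in B i, ENNReal.ofReal (g i x) ∂ν := by
  rw [Measure.restrict_pi_pi (fun _ : Fin L => ν) B]
  have hint : ∀ i, Integrable (g i) (ν.restrict (B i)) := fun i => (hg i).integrable.restrict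
  rw [← ofReal_integral_eq_lintegral_ofReal (Integrable.fintype_prod hint)
    (ae_of_all _ fun z => Finset.prod_nonneg fun i _ => (hg i).nonneg _),
    integral_fintype_prod_eq_prod (𝕜 := ℝ) (fun i => g i),
    ENNReal.ofReal_prod_of_nonneg fun i _ => integral_nonneg (hg i).nonneg]
  exact Finset.prod_congr rfl fun i _ =>
    ofReal_integral_eq_lintegral_ofReal (hint i) (ae_of_all _ (hg i).nonneg)

theorem isProbDensity_prod {g : Fin L → X → ℝ} (hg : ∀ i, IsProbDensity ν (g i)) :
    IsProbDensity (Measure.pi fun _ : Fin L => ν) (fun z => ∏ i, g i (z i)) where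
  measurable := Finset.measurable_prod _ fun i _ =>
    (hg i).measurable.comp (measurable_pi_apply i)
  nonneg _ := Finset.prod_nonneg fun i _ => (hg i).nonneg _
  lintegral_eq_one := by
    have := setLIntegral_prod_density hg fun _ => Set.univ
    simpa [(hg _).lintegral_eq_one] using this

variable {f₀ f₁ : X → ℝ}

theorem isProbDensity_obsDensity (hf₀ : IsProbDensity ν f₀) (hf₁ : IsProbDensity ν f₁)
    (j : Fin (L + 1)) :
    IsProbDensity (Measure.pi fun _ : Fin L => ν) (obsDensity f₀ f₁ j) := by
  have := isProbDensity_prod (L := L) (g := fun i => if (i : ℕ) < j then f₁ else f₀)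
    (ν := ν) (fun i => by split_ifs <;> assumption)
  convert this using 2 with z
  unfold obsDensity
  refine Finset.prod_congr rfl fun i _ => ?_
  split_ifs <;> rfl

end Density

/-! ### One step of the dynamic program: integrability, monotonicity, limits and concavity -/

section Belief

variable {L : ℕ} {X : Type*} [MeasurableSpace X] {ν : Measure X} [SigmaFinite ν]
  {f₀ f₁ : X → ℝ} {r : Fin L → ℝ} {c : ℝ}

theorem bayesNum_nonneg (hf₀ : IsProbDensity ν f₀) (hf₁ : IsProbDensity ν f₁)
    (hr : ∀ i, r i ∈ Set.Icc (0 : ℝ) 1) {p : Fin (L + 1) → ℝ} (hp : ∀ m, 0 ≤ p m)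
    (z : Fin L → X) (j : Fin (L + 1)) : 0 ≤ bayesNum r f₀ f₁ p z j :=
  mul_nonneg (predicted_nonneg hr hp j) ((isProbDensity_obsDensity hf₀ hf₁ j).nonneg z)

theorem predDensity_nonneg (hf₀ : IsProbDensity ν f₀) (hf₁ : IsProbDensity ν f₁)
    (hr : ∀ i, r i ∈ Set.Icc (0 : ℝ) 1) {p : Fin (L + 1) → ℝ} (hp : ∀ m, 0 ≤ p m)
    (z : Fin L → X) : 0 ≤ predDensity r f₀ f₁ p z :=
  Finset.sum_nonneg fun j _ => bayesNum_nonneg hf₀ hf₁ hr hp z j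

theorem measurable_bayesNum (hf₀ : IsProbDensity ν f₀) (hf₁ : IsProbDensity ν f₁)
    (j : Fin (L + 1)) :
    Measurable fun q : (Fin (L + 1) → ℝ) × (Fin L → X) => bayesNum r f₀ f₁ q.1 q.2 j := by
  have := (isProbDensity_obsDensity hf₀ hf₁ j).measurable
  unfold bayesNum
  fun_prop

theorem measurable_predDensity (hf₀ : IsProbDensity ν f₀) (hf₁ : IsProbDensity ν f₁) :
    Measurable fun q : (Fin (L + 1) → ℝ) × (Fin L → X) => predDensity r f₀ f₁ q.1 q.2 :=
  Finset.measurable_sum _ fun j _ => measurable_bayesNum hf₀ hf₁ j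

theorem measurable_beliefUpdate (hf₀ : IsProbDensity ν f₀) (hf₁ : IsProbDensity ν f₁) :
    Measurable fun q : (Fin (L + 1) → ℝ) × (Fin L → X) => beliefUpdate r f₀ f₁ q.1 q.2 :=
  measurable_pi_lambda _ fun j =>
    (measurable_bayesNum hf₀ hf₁ j).div (measurable_predDensity hf₀ hf₁)

theorem integrable_bayesNum (hf₀ : IsProbDensity ν f₀) (hf₁ : IsProbDensity ν f₁)
    (p : Fin (L + 1) → ℝ) (j : Fin (L + 1)) :
    Integrable (fun z => bayesNum r f₀ f₁ p z j) (Measure.pi fun _ : Fin L => ν) :=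
  (isProbDensity_obsDensity hf₀ hf₁ j).integrable.const_mul _

theorem integrable_predDensity (hf₀ : IsProbDensity ν f₀) (hf₁ : IsProbDensity ν f₁)
    (p : Fin (L + 1) → ℝ) :
    Integrable (predDensity r f₀ f₁ p) (Measure.pi fun _ : Fin L => ν) :=
  integrable_finsetSum _ fun j _ => integrable_bayesNum hf₀ hf₁ p j

theorem beliefUpdate_mem (hf₀ : IsProbDensity ν f₀) (hf₁ : IsProbDensity ν f₁)
    (hr : ∀ i, r i ∈ Set.Icc (0 : ℝ) 1) {p : Fin (L + 1) → ℝ} (hp : ∀ m, 0 ≤ p m)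
    {z : Fin L → X} (hz : predDensity r f₀ f₁ p z ≠ 0) :
    beliefUpdate r f₀ f₁ p z ∈ stdSimplex ℝ (Fin (L + 1)) := by
  refine ⟨fun j => div_nonneg (bayesNum_nonneg hf₀ hf₁ hr hp z j)
    (predDensity_nonneg hf₀ hf₁ hr hp z), ?_⟩
  unfold beliefUpdate
  rw [← Finset.sum_div]
  exact div_self hz

theorem measurable_expNext (hf₀ : IsProbDensity ν f₀) (hf₁ : IsProbDensity ν f₁)
    {J : (Fin (L + 1) → ℝ) → ℝ} (hJ : Measurable J) :
    Measurable (expNext ν r f₀ f₁ J) := by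
  have : Measurable fun q : (Fin (L + 1) → ℝ) × (Fin L → X) =>
      J (beliefUpdate r f₀ f₁ q.1 q.2) * predDensity r f₀ f₁ q.1 q.2 :=
    (hJ.comp (measurable_beliefUpdate hf₀ hf₁)).mul (measurable_predDensity hf₀ hf₁)
  exact (StronglyMeasurable.integral_prod_right' (ν := Measure.pi fun _ : Fin L => ν)
    this.stronglyMeasurable).measurable

theorem measurable_stageCost (hf₀ : IsProbDensity ν f₀) (hf₁ : IsProbDensity ν f₁) (n : ℕ) :
    Measurable (stageCost ν r f₀ f₁ c n) := by
  induction n with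
  | zero => exact measurable_pi_apply 0
  | succ n ih =>
    have := measurable_expNext (r := r) hf₀ hf₁ ih
    exact (measurable_pi_apply 0).min
      (((measurable_const.sub (measurable_pi_apply 0)).const_mul c).add this)

theorem measurable_costToGo (hf₀ : IsProbDensity ν f₀) (hf₁ : IsProbDensity ν f₁) :
    Measurable (costToGo ν r f₀ f₁ c) :=
  Measurable.iInf fun _ => measurable_stageCost hf₀ hf₁ _

theorem measurable_contCost (hf₀ : IsProbDensity ν f₀) (hf₁ : IsProbDensity ν f₁) :
    Measurable (contCost ν r f₀ f₁ c) :=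
  measurable_expNext hf₀ hf₁ (measurable_costToGo hf₀ hf₁)

/-- A cost function on beliefs lying between `0` and the cost of stopping at once. -/
structure IsBelowStopping (J : (Fin (L + 1) → ℝ) → ℝ) : Prop where
  measurable : Measurable J
  nonneg : ∀ p ∈ stdSimplex ℝ (Fin (L + 1)), 0 ≤ J p
  le_apply_zero : ∀ p ∈ stdSimplex ℝ (Fin (L + 1)), J p ≤ p 0

theorem IsBelowStopping.le_one {J : (Fin (L + 1) → ℝ) → ℝ} (hJ : IsBelowStopping J)
    {p : Fin (L + 1) → ℝ} (hp : p ∈ stdSimplex ℝ (Fin (L + 1))) : J p ≤ 1 :=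
  (hJ.le_apply_zero p hp).trans ((mem_Icc_of_mem_stdSimplex hp 0).2)

section ExpNext

variable (hf₀ : IsProbDensity ν f₀) (hf₁ : IsProbDensity ν f₁)
  (hr : ∀ i, r i ∈ Set.Icc (0 : ℝ) 1) {J : (Fin (L + 1) → ℝ) → ℝ} (hJ : IsBelowStopping J)
  {p : Fin (L + 1) → ℝ} (hp : p ∈ stdSimplex ℝ (Fin (L + 1)))

include hf₀ hf₁ hr hp hJ

theorem expNext_integrand_nonneg (z : Fin L → X) :
    0 ≤ J (beliefUpdate r f₀ f₁ p z) * predDensity r f₀ f₁ p z := by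
  by_cases hz : predDensity r f₀ f₁ p z = 0
  · simp [hz]
  · exact mul_nonneg (hJ.nonneg _ (beliefUpdate_mem hf₀ hf₁ hr hp.1 hz))
      (predDensity_nonneg hf₀ hf₁ hr hp.1 z)

/-- The stopping cost of the updated belief times the normalizer is the numerator itself, so the
bound no longer involves `J`. Where the predictive density vanishes the updated belief is
meaningless, but the integrand is `0`. -/
theorem expNext_integrand_le (z : Fin L → X) :
    J (beliefUpdate r f₀ f₁ p z) * predDensity r f₀ f₁ p z ≤ bayesNum r f₀ f₁ p z 0 := by
  by_cases hz : predDensity r f₀ f₁ p z = 0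
  · simpa [hz] using bayesNum_nonneg hf₀ hf₁ hr hp.1 z 0
  · calc _ ≤ beliefUpdate r f₀ f₁ p z 0 * predDensity r f₀ f₁ p z :=
          mul_le_mul_of_nonneg_right (hJ.le_apply_zero _ (beliefUpdate_mem hf₀ hf₁ hr hp.1 hz))
            (predDensity_nonneg hf₀ hf₁ hr hp.1 z)
      _ = _ := div_mul_cancel₀ _ hz

theorem expNext_integrable :
    Integrable (fun z => J (beliefUpdate r f₀ f₁ p z) * predDensity r f₀ f₁ p z)
      (Measure.pi fun _ : Fin L => ν) := by
  refine (integrable_bayesNum (r := r) hf₀ hf₁ p 0).mono' ?_ (ae_of_all _ fun z => ?_)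
  · have h1 := (measurable_beliefUpdate (r := r) hf₀ hf₁).comp (measurable_prodMk_left (x := p))
    have h2 := (measurable_predDensity (r := r) hf₀ hf₁).comp (measurable_prodMk_left (x := p))
    exact ((hJ.measurable.comp h1).mul h2).aestronglyMeasurable
  · rw [Real.norm_of_nonneg (expNext_integrand_nonneg hf₀ hf₁ hr hJ hp z)]
    exact expNext_integrand_le hf₀ hf₁ hr hJ hp z

theorem expNext_nonneg : 0 ≤ expNext ν r f₀ f₁ J p :=
  integral_nonneg (expNext_integrand_nonneg hf₀ hf₁ hr hJ hp)

theorem expNext_le : expNext ν r f₀ f₁ J p ≤ (1 - rhoExt r 0) * p 0 := by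
  have h := integral_mono (expNext_integrable hf₀ hf₁ hr hJ hp)
    (integrable_bayesNum (r := r) hf₀ hf₁ p 0) (expNext_integrand_le hf₀ hf₁ hr hJ hp)
  refine h.trans_eq ?_
  unfold bayesNum
  -- Only state `0` leads to state `0`, since changes are never undone; a single weight survives in
  -- the prediction.
  rw [integral_const_mul, (isProbDensity_obsDensity hf₀ hf₁ 0).integral_eq_one, mul_one,
    Finset.sum_eq_single 0]
  · simp [transW]
  · intro m _ hm
    simp [transW, hm]
  · simp

theorem expNext_le_self : expNext ν r f₀ f₁ J p ≤ p 0 := by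
  have h1 := expNext_le hf₀ hf₁ hr hJ hp
  nlinarith [(rhoExt_mem hr 0).1, hp.1 0]

theorem ofReal_expNext :
    ENNReal.ofReal (expNext ν r f₀ f₁ J p) =
      ∫⁻ z, ENNReal.ofReal (J (beliefUpdate r f₀ f₁ p z)) *
        ENNReal.ofReal (predDensity r f₀ f₁ p z) ∂(Measure.pi fun _ : Fin L => ν) := by
  unfold expNext
  rw [ofReal_integral_eq_lintegral_ofReal (expNext_integrable hf₀ hf₁ hr hJ hp)
    (ae_of_all _ (expNext_integrand_nonneg hf₀ hf₁ hr hJ hp))]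
  refine lintegral_congr fun z => ?_
  rw [ENNReal.ofReal_mul' (predDensity_nonneg hf₀ hf₁ hr hp.1 z)]

end ExpNext

theorem expNext_mono (hf₀ : IsProbDensity ν f₀) (hf₁ : IsProbDensity ν f₁)
    (hr : ∀ i, r i ∈ Set.Icc (0 : ℝ) 1) {J K : (Fin (L + 1) → ℝ) → ℝ}
    (hJ : IsBelowStopping J) (hK : IsBelowStopping K)
    (hJK : ∀ p ∈ stdSimplex ℝ (Fin (L + 1)), J p ≤ K p)
    {p : Fin (L + 1) → ℝ} (hp : p ∈ stdSimplex ℝ (Fin (L + 1))) :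
    expNext ν r f₀ f₁ J p ≤ expNext ν r f₀ f₁ K p := by
  refine integral_mono (expNext_integrable hf₀ hf₁ hr hJ hp)
    (expNext_integrable hf₀ hf₁ hr hK hp) fun z => ?_
  by_cases hz : predDensity r f₀ f₁ p z = 0
  · simp [hz]
  · exact mul_le_mul_of_nonneg_right (hJK _ (beliefUpdate_mem hf₀ hf₁ hr hp.1 hz))
      (predDensity_nonneg hf₀ hf₁ hr hp.1 z)

/-- Dominated convergence, with the unnormalized posterior of state `0` as a bound common to all
`n`. -/
theorem tendsto_expNext (hf₀ : IsProbDensity ν f₀) (hf₁ : IsProbDensity ν f₁)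
    (hr : ∀ i, r i ∈ Set.Icc (0 : ℝ) 1) {J : ℕ → (Fin (L + 1) → ℝ) → ℝ}
    {K : (Fin (L + 1) → ℝ) → ℝ} (hJ : ∀ n, IsBelowStopping (J n))
    (hJK : ∀ p ∈ stdSimplex ℝ (Fin (L + 1)), Tendsto (fun n => J n p) atTop (𝓝 (K p)))
    {p : Fin (L + 1) → ℝ} (hp : p ∈ stdSimplex ℝ (Fin (L + 1))) :
    Tendsto (fun n => expNext ν r f₀ f₁ (J n) p) atTop (𝓝 (expNext ν r f₀ f₁ K p)) := by
  refine tendsto_integral_of_dominated_convergence (fun z => bayesNum r f₀ f₁ p z 0)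
    (fun n => (expNext_integrable hf₀ hf₁ hr (hJ n) hp).aestronglyMeasurable)
    (integrable_bayesNum hf₀ hf₁ p 0) (fun n => ae_of_all _ fun z => ?_) (ae_of_all _ fun z => ?_)
  · rw [Real.norm_of_nonneg (expNext_integrand_nonneg hf₀ hf₁ hr (hJ n) hp z)]
    exact expNext_integrand_le hf₀ hf₁ hr (hJ n) hp z
  · by_cases hz : predDensity r f₀ f₁ p z = 0
    · simp [hz]
    · exact (hJK _ (beliefUpdate_mem hf₀ hf₁ hr hp.1 hz)).mul_const _

/-- The perspective of a concave function on the simplex is superadditive on the orthant. -/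
theorem perspective_superadditive {ι : Type*} [Fintype ι] {J : (ι → ℝ) → ℝ}
    (hJ : ConcaveOn ℝ (stdSimplex ℝ ι) J) {u v : ι → ℝ} (hu : ∀ i, 0 ≤ u i) (hv : ∀ i, 0 ≤ v i) :
    J (fun i => u i / ∑ j, u j) * ∑ j, u j + J (fun i => v i / ∑ j, v j) * ∑ j, v j ≤
      J (fun i => (u i + v i) / ∑ j, (u j + v j)) * ∑ j, (u j + v j) := by
  rcases (Finset.sum_nonneg fun i (_ : i ∈ Finset.univ) => hu i).eq_or_lt with h | hu'
  · have h0 : ∀ i, u i = 0 := fun i =>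
      (Finset.sum_eq_zero_iff_of_nonneg fun i _ => hu i).mp h.symm i (Finset.mem_univ _)
    simp [h0]
  rcases (Finset.sum_nonneg fun i (_ : i ∈ Finset.univ) => hv i).eq_or_lt with h | hv'
  · have h0 : ∀ i, v i = 0 := fun i =>
      (Finset.sum_eq_zero_iff_of_nonneg fun i _ => hv i).mp h.symm i (Finset.mem_univ _)
    simp [h0]
  rw [Finset.sum_add_distrib]
  set s := ∑ j, u j
  set t := ∑ j, v j
  have hmem : ∀ {w : ι → ℝ}, (∀ i, 0 ≤ w i) → 0 < ∑ j, w j →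
      (fun i => w i / ∑ j, w j) ∈ stdSimplex ℝ ι := fun hw hw' =>
    ⟨fun i => div_nonneg (hw i) hw'.le, by rw [← Finset.sum_div]; exact div_self hw'.ne'⟩
  have key := hJ.2 (hmem hu hu') (hmem hv hv')
    (show 0 ≤ s / (s + t) by positivity) (show 0 ≤ t / (s + t) by positivity)
    (by rw [← add_div]; exact div_self (by positivity))
  have heq : (s / (s + t)) • (fun i => u i / s) + (t / (s + t)) • (fun i => v i / t) =
      fun i => (u i + v i) / (s + t) := by
    ext i
    simp only [Pi.add_apply, Pi.smul_apply, smul_eq_mul]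
    field_simp
  rw [heq] at key
  calc _ = ((s / (s + t)) • J (fun i => u i / s) + (t / (s + t)) • J (fun i => v i / t))
        * (s + t) := by
        simp only [smul_eq_mul]
        field_simp
    _ ≤ _ := mul_le_mul_of_nonneg_right key (by positivity)

/-- For fixed `z` the unnormalized posterior is linear in `p`, and the integrand is the perspective
of `J` along it. Superadditivity and positive homogeneity give concavity of the integrand, hence of
the integral. -/
theorem concaveOn_expNext (hf₀ : IsProbDensity ν f₀) (hf₁ : IsProbDensity ν f₁)
    (hr : ∀ i, r i ∈ Set.Icc (0 : ℝ) 1) {J : (Fin (L + 1) → ℝ) → ℝ}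
    (hJ : IsBelowStopping J) (hJc : ConcaveOn ℝ (stdSimplex ℝ (Fin (L + 1))) J) :
    ConcaveOn ℝ (stdSimplex ℝ (Fin (L + 1))) (expNext ν r f₀ f₁ J) := by
  refine ⟨convex_stdSimplex ℝ _, fun p hp q hq a b ha hb hab => ?_⟩
  have hpq := convex_stdSimplex ℝ _ hp hq ha hb hab
  -- Homogeneity of the perspective. The case `a = 0` is separate because the quotient then
  -- degenerates, though both sides vanish.
  have hscale : ∀ {a : ℝ}, 0 ≤ a → ∀ (p : Fin (L + 1) → ℝ) z,
      J (fun i => a * bayesNum r f₀ f₁ p z i / ∑ j, a * bayesNum r f₀ f₁ p z j) *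
        ∑ j, a * bayesNum r f₀ f₁ p z j =
      a * (J (beliefUpdate r f₀ f₁ p z) * predDensity r f₀ f₁ p z) := by
    intro a ha p z
    rw [← Finset.mul_sum]
    rcases ha.eq_or_lt with rfl | ha
    · simp
    · simp_rw [mul_div_mul_left _ _ ha.ne']
      unfold beliefUpdate predDensity
      ring
  unfold expNext
  simp only [smul_eq_mul]
  rw [← integral_const_mul, ← integral_const_mul, ← integral_add
    ((expNext_integrable hf₀ hf₁ hr hJ hp).const_mul a)
    ((expNext_integrable hf₀ hf₁ hr hJ hq).const_mul b)]
  refine integral_mono (((expNext_integrable hf₀ hf₁ hr hJ hp).const_mul a).add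
    ((expNext_integrable hf₀ hf₁ hr hJ hq).const_mul b))
    (expNext_integrable hf₀ hf₁ hr hJ hpq) fun z => ?_
  have hlin : ∀ j, bayesNum r f₀ f₁ (a • p + b • q) z j =
      a * bayesNum r f₀ f₁ p z j + b * bayesNum r f₀ f₁ q z j := by
    intro j
    simp only [bayesNum, Pi.add_apply, Pi.smul_apply, smul_eq_mul, mul_add,
      Finset.sum_add_distrib, add_mul, ← mul_assoc, Finset.mul_sum]
    congr 3 <;> exact funext fun m => by ring
  have key := perspective_superadditive hJc
    (u := fun j => a * bayesNum r f₀ f₁ p z j) (v := fun j => b * bayesNum r f₀ f₁ q z j)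
    (fun j => mul_nonneg ha (bayesNum_nonneg hf₀ hf₁ hr hp.1 z j))
    (fun j => mul_nonneg hb (bayesNum_nonneg hf₀ hf₁ hr hq.1 z j))
  rw [hscale ha, hscale hb] at key
  dsimp only
  refine key.trans_eq ?_
  unfold beliefUpdate predDensity
  simp only [hlin]

end Belief

/-! ### Finite-horizon costs, their limit and the fixed-point equation -/

section Value

variable {L : ℕ} {X : Type*} [MeasurableSpace X] {ν : Measure X} [SigmaFinite ν]
  {f₀ f₁ : X → ℝ} {r : Fin L → ℝ} {c : ℝ}
  (hf₀ : IsProbDensity ν f₀) (hf₁ : IsProbDensity ν f₁)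
  (hr : ∀ i, r i ∈ Set.Icc (0 : ℝ) 1) (hc : 0 < c)

include hf₀ hf₁ hr hc

theorem isBelowStopping_stageCost (n : ℕ) : IsBelowStopping (stageCost ν r f₀ f₁ c n) := by
  induction n with
  | zero => exact ⟨measurable_stageCost hf₀ hf₁ 0, fun p hp => hp.1 0, fun p _ => le_rfl⟩
  | succ n ih =>
    refine ⟨measurable_stageCost hf₀ hf₁ _, fun p hp => le_min (hp.1 0) ?_,
      fun p _ => min_le_left _ _⟩
    have h1 := expNext_nonneg hf₀ hf₁ hr ih hp
    have h2 := (mem_Icc_of_mem_stdSimplex hp 0).2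
    nlinarith

/-- One more stage leaves the option of stopping at once, which settles `n = 0`; monotonicity of the
one-step operator propagates the inequality. -/
theorem stageCost_succ_le (n : ℕ) {p : Fin (L + 1) → ℝ}
    (hp : p ∈ stdSimplex ℝ (Fin (L + 1))) :
    stageCost ν r f₀ f₁ c (n + 1) p ≤ stageCost ν r f₀ f₁ c n p := by
  induction n generalizing p with
  | zero => exact min_le_left _ _
  | succ n ih =>
    refine min_le_min le_rfl (add_le_add_right ?_ _)
    exact expNext_mono hf₀ hf₁ hr (isBelowStopping_stageCost hf₀ hf₁ hr hc _)
      (isBelowStopping_stageCost hf₀ hf₁ hr hc _) (fun q hq => ih hq) hp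

theorem tendsto_stageCost {p : Fin (L + 1) → ℝ} (hp : p ∈ stdSimplex ℝ (Fin (L + 1))) :
    Tendsto (fun n => stageCost ν r f₀ f₁ c n p) atTop (𝓝 (costToGo ν r f₀ f₁ c p)) := by
  refine tendsto_atTop_ciInf (antitone_nat_of_succ_le fun n => ?_) ⟨0, ?_⟩
  · exact stageCost_succ_le hf₀ hf₁ hr hc n hp
  · rintro _ ⟨n, rfl⟩
    exact (isBelowStopping_stageCost hf₀ hf₁ hr hc n).nonneg p hp

theorem isBelowStopping_costToGo : IsBelowStopping (costToGo ν r f₀ f₁ c) :=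
  ⟨measurable_costToGo hf₀ hf₁,
    fun p hp => ge_of_tendsto' (tendsto_stageCost hf₀ hf₁ hr hc hp) fun n =>
      (isBelowStopping_stageCost hf₀ hf₁ hr hc n).nonneg p hp,
    fun p hp => le_of_tendsto' (tendsto_stageCost hf₀ hf₁ hr hc hp) fun n =>
      (isBelowStopping_stageCost hf₀ hf₁ hr hc n).le_apply_zero p hp⟩

theorem tendsto_expNext_stageCost {p : Fin (L + 1) → ℝ}
    (hp : p ∈ stdSimplex ℝ (Fin (L + 1))) :
    Tendsto (fun n => expNext ν r f₀ f₁ (stageCost ν r f₀ f₁ c n) p) atTop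
      (𝓝 (contCost ν r f₀ f₁ c p)) :=
  tendsto_expNext hf₀ hf₁ hr (fun n => isBelowStopping_stageCost hf₀ hf₁ hr hc n)
    (fun _ hq => tendsto_stageCost hf₀ hf₁ hr hc hq) hp

/-- Both sides are limits of the same sequence, the right-hand one through the recursion for `n + 1`
stages. -/
theorem costToGo_eq {p : Fin (L + 1) → ℝ} (hp : p ∈ stdSimplex ℝ (Fin (L + 1))) :
    costToGo ν r f₀ f₁ c p = min (p 0) (c * (1 - p 0) + contCost ν r f₀ f₁ c p) :=
  tendsto_nhds_unique
    ((tendsto_add_atTop_iff_nat 1).mpr (tendsto_stageCost hf₀ hf₁ hr hc hp))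
    (tendsto_const_nhds.min (tendsto_const_nhds.add
      (tendsto_expNext_stageCost hf₀ hf₁ hr hc hp)))

theorem concaveOn_stageCost (n : ℕ) :
    ConcaveOn ℝ (stdSimplex ℝ (Fin (L + 1))) (stageCost ν r f₀ f₁ c n) := by
  have hlin : ∀ a b : ℝ, ConcaveOn ℝ (stdSimplex ℝ (Fin (L + 1)))
      (fun p : Fin (L + 1) → ℝ => a * p 0 + b) := by
    refine fun a b => ⟨convex_stdSimplex ℝ _, fun p _ q _ s t _ _ hst => ?_⟩
    simp only [Pi.add_apply, Pi.smul_apply, smul_eq_mul]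
    linear_combination b * hst
  induction n with
  | zero => simpa [stageCost] using hlin 1 0
  | succ n ih =>
    have h := (by simpa using hlin 1 0 : ConcaveOn ℝ (stdSimplex ℝ (Fin (L + 1)))
      (fun p : Fin (L + 1) → ℝ => p 0)).inf ((hlin (-c) c).add (concaveOn_expNext hf₀ hf₁ hr
        (isBelowStopping_stageCost hf₀ hf₁ hr hc n) ih))
    refine h.congr fun p _ => ?_
    change min (p 0) (-c * p 0 + c + expNext ν r f₀ f₁ (stageCost ν r f₀ f₁ c n) p) =
      min (p 0) (c * (1 - p 0) + expNext ν r f₀ f₁ (stageCost ν r f₀ f₁ c n) p)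
    ring_nf

/-- Concavity inequalities pass to pointwise limits, so concavity of the finite-horizon continuation
costs suffices. -/
theorem concaveOn_contCost :
    ConcaveOn ℝ (stdSimplex ℝ (Fin (L + 1))) (contCost ν r f₀ f₁ c) := by
  refine ⟨convex_stdSimplex ℝ _, fun p hp q hq a b ha hb hab => ?_⟩
  exact le_of_tendsto_of_tendsto'
    (((tendsto_expNext_stageCost hf₀ hf₁ hr hc hp).const_smul a).add
      ((tendsto_expNext_stageCost hf₀ hf₁ hr hc hq).const_smul b))
    (tendsto_expNext_stageCost hf₀ hf₁ hr hc (convex_stdSimplex ℝ _ hp hq ha hb hab))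
    fun n => (concaveOn_expNext hf₀ hf₁ hr (isBelowStopping_stageCost hf₀ hf₁ hr hc n)
      (concaveOn_stageCost hf₀ hf₁ hr hc n)).2 hp hq ha hb hab

theorem costToGo_structure :
    (∀ p ∈ stdSimplex ℝ (Fin (L + 1)),
        (∀ k : ℕ, Tendsto (fun T => finCostToGo ν r f₀ f₁ c T k p) atTop
          (𝓝 (costToGo ν r f₀ f₁ c p))) ∧
        (∀ k : ℕ, Tendsto (fun T => expNext ν r f₀ f₁
            (finCostToGo ν r f₀ f₁ c T (k + 1)) p) atTop
          (𝓝 (contCost ν r f₀ f₁ c p))) ∧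
        Integrable (fun z => costToGo ν r f₀ f₁ c
            (beliefUpdate r f₀ f₁ p z) * predDensity r f₀ f₁ p z)
          (Measure.pi fun _ : Fin L => ν) ∧
        costToGo ν r f₀ f₁ c p =
          min (p 0) (c * (1 - p 0) + contCost ν r f₀ f₁ c p) ∧
        0 ≤ contCost ν r f₀ f₁ c p ∧
        contCost ν r f₀ f₁ c p ≤ 1 ∧
        (p 0 = 0 → contCost ν r f₀ f₁ c p = 0)) ∧
      ConcaveOn ℝ (stdSimplex ℝ (Fin (L + 1))) (contCost ν r f₀ f₁ c) := by
  refine ⟨fun p hp => ?_, concaveOn_contCost hf₀ hf₁ hr hc⟩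
  have hJ := isBelowStopping_costToGo hf₀ hf₁ hr hc
  have h0 := expNext_nonneg hf₀ hf₁ hr hJ hp
  have h1 := expNext_le_self hf₀ hf₁ hr hJ hp
  refine ⟨fun k => ?_, fun k => ?_, expNext_integrable hf₀ hf₁ hr hJ hp,
    costToGo_eq hf₀ hf₁ hr hc hp, h0, h1.trans (mem_Icc_of_mem_stdSimplex hp 0).2,
    fun hp0 => le_antisymm (h1.trans_eq hp0) h0⟩
  · exact (tendsto_stageCost hf₀ hf₁ hr hc hp).comp (tendsto_sub_atTop_nat k)
  · exact (tendsto_expNext_stageCost hf₀ hf₁ hr hc hp).comp (tendsto_sub_atTop_nat (k + 1))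

end Value

/-! ### Geometric transition kernel on extended natural numbers -/

theorem tsum_changeStep {r : ℝ} (hr : r ∈ Set.Icc (0 : ℝ) 1) (a : ℕ∞) :
    ∑' b, ENNReal.ofReal (changeStep r a b) = 1 := by
  induction a using ENat.recTopCoe with
  | top =>
    rw [tsum_eq_single ⊤]
    · simp [changeStep]
    · intro b hb
      simp [changeStep, hb]
  | coe x =>
    rcases hr.1.eq_or_lt with rfl | h0
    · rw [tsum_eq_single ⊤]
      · simp [changeStep, geomDelay]
      · intro b hb
        lift b to ℕ using hb
        have : ((b : ℕ∞) - (x : ℕ∞)) ≠ ⊤ := by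
          rw [← ENat.natCast_sub]; exact ENat.natCast_ne_top _
        simp [changeStep, geomDelay, this]
    -- For positive `r` the point `⊤` has mass zero and the support lies in the finite values `x +
    -- d`; the sum is the geometric series with ratio `1 - r`.
    · have hinj : Function.Injective fun d : ℕ => ((x + d : ℕ) : ℕ∞) := fun d e h => by
        simpa using h
      rw [← hinj.tsum_eq]
      · have : ∀ d : ℕ, ENNReal.ofReal (changeStep r (x : ℕ∞) ((x + d : ℕ) : ℕ∞)) =
            ENNReal.ofReal r * ENNReal.ofReal (1 - r) ^ d := by
          intro d
          have h1 : (((x + d : ℕ) : ℕ∞) - (x : ℕ∞)) = (d : ℕ∞) := by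
            rw [← ENat.natCast_sub]; simp
          have h2 : (x : ℕ∞) ≤ ((x + d : ℕ) : ℕ∞) := by exact_mod_cast Nat.le_add_right x d
          rw [changeStep, if_neg (ENat.natCast_ne_top x), if_pos h2, h1, geomDelay,
            if_neg (ENat.natCast_ne_top d), ENat.toNat_natCast, ENNReal.ofReal_mul h0.le,
            ENNReal.ofReal_pow (by linarith [hr.2])]
        simp_rw [this]
        rw [ENNReal.tsum_mul_left, ENNReal.tsum_geometric, ← ENNReal.ofReal_one,
          ← ENNReal.ofReal_sub _ (by linarith [hr.2]), sub_sub_cancel,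
          ENNReal.mul_inv_cancel (by simpa using h0) ENNReal.ofReal_ne_top, ENNReal.ofReal_one]
      · intro b hb
        rw [Function.mem_support] at hb
        have hbt : b ≠ ⊤ := by
          rintro rfl
          simp [changeStep, geomDelay, h0.ne'] at hb
        lift b to ℕ using hbt
        have hxb : x ≤ b := by
          by_contra hlt
          have : ¬ (x : ℕ∞) ≤ (b : ℕ∞) := by exact_mod_cast hlt
          simp [changeStep, this] at hb
        exact ⟨b - x, by simp [Nat.add_sub_cancel' hxb]⟩

theorem changeStep_coe {r : ℝ} {x K : ℕ} (h : x ≤ K) :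
    changeStep r (x : ℕ∞) (K : ℕ∞) = r * (1 - r) ^ (K - x) := by
  rw [changeStep, if_neg (ENat.natCast_ne_top x), if_pos (by exact_mod_cast h), ← ENat.natCast_sub,
    geomDelay, if_neg (ENat.natCast_ne_top _), ENat.toNat_natCast]

theorem changeStep_eq_zero {r : ℝ} {a b : ℕ∞} (h : b < a) : changeStep r a b = 0 := by
  unfold changeStep
  split_ifs with h1 h2 h3
  · exact absurd h (by simp [h2])
  · rfl
  · exact absurd h (not_lt.mpr h3)
  · rfl

/-- Countable additivity is applied to `μ.restrict S` on the fibres of `f`, so `S` itself need not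
be measurable. -/
theorem measure_eq_tsum_inter_preimage {Ω β : Type*} [MeasurableSpace Ω] [MeasurableSpace β]
    [Countable β] [MeasurableSingletonClass β] (μ : Measure Ω) {f : Ω → β} (hf : Measurable f)
    (S : Set Ω) : μ S = ∑' b, μ (S ∩ f ⁻¹' {b}) := by
  have hm : ∀ b, MeasurableSet (f ⁻¹' {b}) := fun b => hf (measurableSet_singleton b)
  have h : ∑' b, μ.restrict S (f ⁻¹' {b}) = μ.restrict S (⋃ b, f ⁻¹' {b}) :=
    (measure_iUnion (fun b c hbc => Set.disjoint_left.mpr fun ω h1 h2 =>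
      hbc (h1.symm.trans h2)) hm).symm
  have hU : (⋃ b, f ⁻¹' {b}) = Set.univ := by ext ω; simp
  rw [hU, Measure.restrict_apply_univ] at h
  rw [← h]
  exact tsum_congr fun b => by rw [Measure.restrict_apply (hm b), Set.inter_comm]

/-! ### Markov chain of change-points and the law of the hidden state -/

section Chain

variable {L : ℕ} {r : Fin L → ℝ} {Ω : Type*} [MeasurableSpace Ω] {μ : Measure Ω}
  {Γ : Fin L → Ω → ℕ∞}

theorem prevTime_congr {m m' : Fin L → ℕ∞} {i : Fin L} (h : ∀ j : Fin L, j < i → m j = m' j) :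
    prevTime m i = prevTime m' i := by
  unfold prevTime
  split_ifs with h0
  · rfl
  · exact h _ (by rw [Fin.lt_def]; simp; omega)

omit [MeasurableSpace Ω] in
-- The σ-algebra is left arbitrary so that the statement serves both the ambient one and the full
-- history.
theorem measurableSet_stateEvent {m : MeasurableSpace Ω} {k : ℕ}
    (h : ∀ i, MeasurableSet[m] {ω | Γ i ω ≤ k}) (j : Fin (L + 1)) :
    MeasurableSet[m] (stateEvent Γ k j) := by
  have : stateEvent Γ k j = ⋂ i : Fin L, if (i : ℕ) < j then {ω | Γ i ω ≤ k}
      else {ω | Γ i ω ≤ k}ᶜ := by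
    ext ω
    simp only [stateEvent, Set.mem_ofPred_eq, Set.mem_iInter]
    refine forall_congr' fun i => ?_
    by_cases hi : (i : ℕ) < j
    · simp [hi, not_le.mpr hi]
    · simp [hi, not_lt.mp hi]
  rw [this]
  refine MeasurableSet.iInter fun i => ?_
  split_ifs
  · exact h i
  · exact (h i).compl

omit [MeasurableSpace Ω] in
theorem stateEvent_disjoint {k : ℕ} {j j' : Fin (L + 1)} (h : j ≠ j') :
    Disjoint (stateEvent Γ k j) (stateEvent Γ k j') := by
  have key : ∀ {j j' : Fin (L + 1)}, j < j' → ∀ ω, ω ∈ stateEvent Γ k j →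
      ω ∉ stateEvent Γ k j' := by
    intro j j' hlt ω h1 h2
    have hlt' : (j : ℕ) < j' := hlt
    have hjL : (j : ℕ) < L := by omega
    exact absurd ((h2 ⟨j, hjL⟩).1 hlt') (not_le.mpr ((h1 ⟨j, hjL⟩).2 le_rfl))
  refine Set.disjoint_left.mpr fun ω h1 h2 => ?_
  rcases lt_or_gt_of_ne h with h | h
  · exact key h ω h1 h2
  · exact key h ω h2 h1

variable (hr : ∀ i, r i ∈ Set.Icc (0 : ℝ) 1) (hΓ : ∀ i, Measurable (Γ i))
  (hlaw : ∀ m : Fin L → ℕ∞,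
    μ {ω | ∀ i, Γ i ω = m i} = ∏ i, ENNReal.ofReal (changeStep (r i) (prevTime m i) (m i)))

include hlaw in
-- The exceptional set is a countable union of atoms, and the mass of each contains a vanishing
-- factor.
theorem ae_prevTime_le : ∀ᵐ ω ∂μ, ∀ i, prevTime (fun j => Γ j ω) i ≤ Γ i ω := by
  rw [ae_iff]
  have : {ω | ¬ ∀ i, prevTime (fun j => Γ j ω) i ≤ Γ i ω} ⊆
      ⋃ m : {m : Fin L → ℕ∞ // ∃ i, m i < prevTime m i}, {ω | ∀ i, Γ i ω = m.1 i} := by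
    intro ω hω
    simp only [Set.mem_ofPred_eq, not_forall, not_le] at hω
    exact Set.mem_iUnion.mpr ⟨⟨fun j => Γ j ω, hω⟩, fun i => rfl⟩
  refine measure_mono_null this (measure_iUnion_null fun m => ?_)
  obtain ⟨m, i, hi⟩ := m
  rw [hlaw]
  exact Finset.prod_eq_zero (Finset.mem_univ i) (by rw [changeStep_eq_zero hi]; simp)

include hlaw in
theorem ae_monotone_changePoints : ∀ᵐ ω ∂μ, Monotone fun i => Γ i ω := by
  filter_upwards [ae_prevTime_le hlaw] with ω hω
  have key : ∀ d : ℕ, ∀ i j : Fin L, (j : ℕ) = i + d → Γ i ω ≤ Γ j ω := by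
    intro d
    induction d with
    | zero =>
      intro i j h
      rw [show j = i from Fin.ext h]
    | succ d ih =>
      intro i j h
      have h1 := hω j
      rw [prevTime, dif_neg (by omega)] at h1
      exact (ih i ⟨j - 1, by omega⟩ (by simp; omega)).trans h1
  intro i j hij
  exact key (j - i) i j (by have := Fin.le_def.mp hij; omega)

omit [MeasurableSpace Ω] in
theorem setOf_initial_inter (m : Fin L → ℕ∞) {n : ℕ} (hn : n < L) (b : ℕ∞) :
    {ω | ∀ i : Fin L, (i : ℕ) < n → Γ i ω = m i} ∩ Γ ⟨n, hn⟩ ⁻¹' {b} =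
      {ω | ∀ i : Fin L, (i : ℕ) < n + 1 → Γ i ω = Function.update m ⟨n, hn⟩ b i} := by
  ext ω
  constructor
  · rintro ⟨h1, h2⟩ i hi
    by_cases h : i = ⟨n, hn⟩
    · subst h; simpa using h2
    · rw [Function.update_of_ne h]
      exact h1 i (by have : (i : ℕ) ≠ n := fun e => h (Fin.ext e); omega)
  · intro h
    refine ⟨fun i hi => ?_, by simpa using h ⟨n, hn⟩ (by simp)⟩
    rw [h i (by omega), Function.update_of_ne (fun e => by simp [e] at hi)]

/-- Changing coordinate `n` affects neither the factors before it nor the predecessor time of sensor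
`n`, so exactly one new factor appears. -/
theorem prod_initial_succ (m : Fin L → ℕ∞) {n : ℕ} (hn : n < L) (b : ℕ∞) :
    (∏ i : Fin L, if (i : ℕ) < n + 1 then ENNReal.ofReal (changeStep (r i)
        (prevTime (Function.update m ⟨n, hn⟩ b) i) (Function.update m ⟨n, hn⟩ b i)) else 1) =
      (∏ i : Fin L, if (i : ℕ) < n then
        ENNReal.ofReal (changeStep (r i) (prevTime m i) (m i)) else 1) *
      ENNReal.ofReal (changeStep (r ⟨n, hn⟩) (prevTime m ⟨n, hn⟩) b) := by
  have hprev : ∀ i : Fin L, (i : ℕ) ≤ n →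
      prevTime (Function.update m ⟨n, hn⟩ b) i = prevTime m i := fun i hi =>
    prevTime_congr fun j hj => Function.update_of_ne
      (fun e => by rw [e, Fin.lt_def] at hj; simp at hj; omega) _ _
  have hfac : ∀ i : Fin L, (if (i : ℕ) < n + 1 then ENNReal.ofReal (changeStep (r i)
      (prevTime (Function.update m ⟨n, hn⟩ b) i) (Function.update m ⟨n, hn⟩ b i)) else 1) =
      (if (i : ℕ) < n then
        ENNReal.ofReal (changeStep (r i) (prevTime m i) (m i)) else 1) *
      (if i = ⟨n, hn⟩ then
        ENNReal.ofReal (changeStep (r ⟨n, hn⟩) (prevTime m ⟨n, hn⟩) b) else 1) := by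
    intro i
    rcases lt_trichotomy (i : ℕ) n with h | h | h
    · have hne : i ≠ ⟨n, hn⟩ := fun e => by simp [e] at h
      rw [if_pos (by omega), if_pos h, if_neg hne, hprev i h.le,
        Function.update_of_ne hne, mul_one]
    · obtain rfl : i = ⟨n, hn⟩ := Fin.ext h
      rw [if_pos (by simp), if_neg (by simp), if_pos rfl, hprev _ le_rfl]
      simp
    · have hne : i ≠ ⟨n, hn⟩ := fun e => by simp [e] at h
      rw [if_neg (by omega), if_neg (by omega), if_neg hne, mul_one]
  rw [Finset.prod_congr rfl fun i _ => hfac i, Finset.prod_mul_distrib]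
  simp

include hr hΓ hlaw

/-- Sensors are summed out from the last one backwards; each sum is over a probability kernel and
equals one. -/
theorem measure_initial_eq (m : Fin L → ℕ∞) (n : ℕ) (hn : n ≤ L) :
    μ {ω | ∀ i : Fin L, (i : ℕ) < n → Γ i ω = m i} =
      ∏ i : Fin L, if (i : ℕ) < n then
        ENNReal.ofReal (changeStep (r i) (prevTime m i) (m i)) else 1 := by
  induction hn using Nat.decreasingInduction generalizing m with
  | self => simpa using hlaw m
  | of_succ n hn ih =>
    rw [measure_eq_tsum_inter_preimage μ (hΓ ⟨n, hn⟩)]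
    simp_rw [setOf_initial_inter m hn, ih, prod_initial_succ m hn]
    rw [ENNReal.tsum_mul_left, tsum_changeStep (hr _), mul_one]

theorem measure_initial_inter (m : Fin L → ℕ∞) {n : ℕ} (hn : n < L) (b : ℕ∞) :
    μ ({ω | ∀ i : Fin L, (i : ℕ) < n → Γ i ω = m i} ∩ Γ ⟨n, hn⟩ ⁻¹' {b}) =
      μ {ω | ∀ i : Fin L, (i : ℕ) < n → Γ i ω = m i} *
        ENNReal.ofReal (changeStep (r ⟨n, hn⟩) (prevTime m ⟨n, hn⟩) b) := by
  rw [setOf_initial_inter m hn, measure_initial_eq hr hΓ hlaw _ _ hn,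
    measure_initial_eq hr hΓ hlaw _ _ hn.le, prod_initial_succ m hn]

variable [IsProbabilityMeasure μ]

/-- This is the geometric survival function. It is obtained by peeling the atom at `K` off the tail,
so that an infinite delay, possible when the parameter is `0`, needs no separate treatment. -/
theorem measure_initial_tail (m : Fin L → ℕ∞) {n : ℕ} (hn : n < L) {x K : ℕ}
    (hx : prevTime m ⟨n, hn⟩ = x) (hxK : x ≤ K) :
    μ ({ω | ∀ i : Fin L, (i : ℕ) < n → Γ i ω = m i} ∩ {ω | (K : ℕ∞) ≤ Γ ⟨n, hn⟩ ω}) =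
      μ {ω | ∀ i : Fin L, (i : ℕ) < n → Γ i ω = m i} *
        ENNReal.ofReal ((1 - r ⟨n, hn⟩) ^ (K - x)) := by
  set E := {ω | ∀ i : Fin L, (i : ℕ) < n → Γ i ω = m i}
  have hstep := measure_initial_inter hr hΓ hlaw m hn
  have hmeas : ∀ S : Set ℕ∞, MeasurableSet (Γ ⟨n, hn⟩ ⁻¹' S) := fun S =>
    hΓ _ (MeasurableSet.of_discrete)
  induction K, hxK using Nat.le_induction with
  | base =>
    rw [Nat.sub_self, pow_zero, ENNReal.ofReal_one, mul_one]
    refine le_antisymm (measure_mono Set.inter_subset_left) ?_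
    have h0 : μ (E ∩ {ω | Γ ⟨n, hn⟩ ω < x}) = 0 := by
      have : E ∩ {ω | Γ ⟨n, hn⟩ ω < x} ⊆ ⋃ b : Set.Iio (x : ℕ∞), E ∩ Γ ⟨n, hn⟩ ⁻¹' {b.1} :=
        fun ω hω => Set.mem_iUnion.mpr ⟨⟨_, hω.2⟩, hω.1, rfl⟩
      refine measure_mono_null this (measure_iUnion_null fun b => ?_)
      rw [hstep, hx, changeStep_eq_zero b.2]
      simp
    have hcov : E ⊆ (E ∩ {ω | (x : ℕ∞) ≤ Γ ⟨n, hn⟩ ω}) ∪ (E ∩ {ω | Γ ⟨n, hn⟩ ω < x}) :=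
      fun ω hω => (le_or_gt (x : ℕ∞) (Γ ⟨n, hn⟩ ω)).imp (fun h => ⟨hω, h⟩) fun h => ⟨hω, h⟩
    calc μ E ≤ _ := measure_mono hcov
      _ ≤ _ := measure_union_le _ _
      _ = _ := by rw [h0, add_zero]
  | succ K hK ih =>
    have hsplit : E ∩ {ω | (K : ℕ∞) ≤ Γ ⟨n, hn⟩ ω} =
        (E ∩ {ω | ((K + 1 : ℕ) : ℕ∞) ≤ Γ ⟨n, hn⟩ ω}) ∪ (E ∩ Γ ⟨n, hn⟩ ⁻¹' {(K : ℕ∞)}) := by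
      rw [← Set.inter_union_distrib_left]
      congr 1
      ext ω
      simp only [Set.mem_ofPred_eq, Set.mem_union, Set.mem_preimage, Set.mem_singleton_iff]
      rw [Nat.cast_add, Nat.cast_one, ENat.add_one_le_iff (ENat.natCast_ne_top K), le_iff_lt_or_eq,
        eq_comm (a := (K : ℕ∞))]
    have hdisj : Disjoint (E ∩ {ω | ((K + 1 : ℕ) : ℕ∞) ≤ Γ ⟨n, hn⟩ ω})
        (E ∩ Γ ⟨n, hn⟩ ⁻¹' {(K : ℕ∞)}) := by
      refine Set.disjoint_left.mpr fun ω h1 h2 => ?_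
      have h3 : Γ ⟨n, hn⟩ ω = K := h2.2
      have h4 : ((K + 1 : ℕ) : ℕ∞) ≤ Γ ⟨n, hn⟩ ω := h1.2
      rw [h3] at h4
      exact absurd (Nat.cast_le.mp h4) (by omega)
    have hEm : MeasurableSet E := by
      have : E = ⋂ i : Fin L, ⋂ _ : (i : ℕ) < n, Γ i ⁻¹' {m i} := by ext ω; simp [E]
      rw [this]
      exact MeasurableSet.iInter fun i => MeasurableSet.iInter fun _ =>
        hΓ i (measurableSet_singleton _)
    rw [hsplit, measure_union hdisj (hEm.inter (hmeas {(K : ℕ∞)})), hstep, hx,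
      changeStep_coe hK] at ih
    have hr' := hr ⟨n, hn⟩
    have h1 : 0 ≤ 1 - r ⟨n, hn⟩ := by linarith [hr'.2]
    have hsum : ENNReal.ofReal ((1 - r ⟨n, hn⟩) ^ (K - x)) =
        ENNReal.ofReal ((1 - r ⟨n, hn⟩) ^ (K + 1 - x)) +
          ENNReal.ofReal (r ⟨n, hn⟩ * (1 - r ⟨n, hn⟩) ^ (K - x)) := by
      rw [← ENNReal.ofReal_add (by positivity) (mul_nonneg hr'.1 (by positivity)),
        Nat.sub_add_comm hK, pow_succ]
      ring_nf
    -- Cancelling the common term is legitimate in `ℝ≥0∞` because it is finite.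
    rw [hsum, mul_add] at ih
    exact (ENNReal.add_left_inj (ENNReal.mul_ne_top (measure_ne_top _ _)
      ENNReal.ofReal_ne_top)).mp ih

/-- The first `a` sensors saw the change at the times prescribed by `g`, and none of the others
before time `K`. -/
theorem measure_initial_then_after {g : Fin L → ℕ∞} {K a : ℕ} (ha : a ≤ L)
    (hg : ∀ i : Fin L, (i : ℕ) < a → g i ≤ K) :
    ∃ x ≤ K, (∀ h : a < L, prevTime g ⟨a, h⟩ = (x : ℕ∞)) ∧ ∀ K', x ≤ K' →
      μ {ω | ∀ i : Fin L, ((i : ℕ) < a → Γ i ω = g i) ∧ (a ≤ i → (K' : ℕ∞) ≤ Γ i ω)} =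
      μ {ω | ∀ i : Fin L, (i : ℕ) < a → Γ i ω = g i} *
        ENNReal.ofReal ((1 - rhoExt r a) ^ (K' - x)) := by
  -- When all `L` sensors are prescribed there is no next one; the fictitious parameter `0` makes
  -- the survival factor equal to one, and `x = 0` is a dummy.
  rcases ha.eq_or_lt with rfl | haL
  · refine ⟨0, zero_le, fun h => absurd h (lt_irrefl _), fun K' _ => ?_⟩
    rw [rhoExt_self]
    simp only [sub_zero, one_pow, ENNReal.ofReal_one, mul_one]
    congr 1
    ext ω
    exact forall_congr' fun i => ⟨fun h => h.1, fun h => ⟨h, fun h' => absurd i.2 (by omega)⟩⟩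
  · have hle : prevTime g ⟨a, haL⟩ ≤ K := by
      unfold prevTime
      split_ifs with h0
      · exact zero_le
      · exact hg _ (by simp only at h0 ⊢; omega)
    obtain ⟨x, hx⟩ := ENat.ne_top_iff_exists.mp (ne_top_of_le_ne_top (ENat.natCast_ne_top K) hle)
    refine ⟨x, by rw [← hx] at hle; exact_mod_cast hle, fun _ => hx.symm, fun K' hK' => ?_⟩
    rw [rhoExt, dif_pos haL, ← measure_initial_tail hr hΓ hlaw g haL hx.symm hK']
    -- Change-points are almost surely ordered, so a lower bound for sensor `a` bounds all later
    -- ones.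
    refine measure_congr ?_
    filter_upwards [ae_monotone_changePoints hlaw] with ω hω
    refine propext ⟨fun h => ⟨fun i => (h i).1, (h ⟨a, haL⟩).2 le_rfl⟩, fun h i => ⟨h.1 i,
      fun hi => le_trans h.2 (hω (Fin.le_def.mpr hi))⟩⟩

/-- Memorylessness: surviving one more time unit costs the same factor whatever the start `x` of the
delay. -/
theorem measure_after_succ {g : Fin L → ℕ∞} {K a : ℕ} (ha : a ≤ L)
    (hg : ∀ i : Fin L, (i : ℕ) < a → g i ≤ K) :
    μ {ω | ∀ i : Fin L, ((i : ℕ) < a → Γ i ω = g i) ∧ (a ≤ i → ((K + 1 : ℕ) : ℕ∞) ≤ Γ i ω)} =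
      ENNReal.ofReal (1 - rhoExt r a) *
      μ {ω | ∀ i : Fin L, ((i : ℕ) < a → Γ i ω = g i) ∧ (a ≤ i → (K : ℕ∞) ≤ Γ i ω)} := by
  obtain ⟨x, hxK, -, h⟩ := measure_initial_then_after hr hΓ hlaw ha hg
  have h1 : 0 ≤ 1 - rhoExt r a := by linarith [(rhoExt_mem hr a).2]
  rw [h _ hxK, h (K + 1) (hxK.trans (Nat.le_succ K)), Nat.sub_add_comm hxK, pow_succ,
    ENNReal.ofReal_mul (by positivity)]
  ring

/-- The mass `ρ (1 - ρ) ^ (K - x)` of a change exactly at `K` is `ρ` times the survival probability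
up to `K`. -/
theorem measure_next_at {g : Fin L → ℕ∞} {K a : ℕ} (ha : a < L)
    (hg : ∀ i : Fin L, (i : ℕ) < a → g i ≤ K) (hga : g ⟨a, ha⟩ = K) :
    μ {ω | ∀ i : Fin L, ((i : ℕ) < a + 1 → Γ i ω = g i) ∧ (a + 1 ≤ i → (K : ℕ∞) ≤ Γ i ω)} =
      ENNReal.ofReal (rhoExt r a) *
      μ {ω | ∀ i : Fin L, ((i : ℕ) < a → Γ i ω = g i) ∧ (a ≤ i → (K : ℕ∞) ≤ Γ i ω)} := by
  obtain ⟨x, hxK, hx, h⟩ := measure_initial_then_after hr hΓ hlaw ha.le hg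
  have hg' : ∀ i : Fin L, (i : ℕ) < a + 1 → g i ≤ K := by
    intro i hi
    rcases Nat.lt_succ_iff_lt_or_eq.mp hi with h | h
    · exact hg i h
    · rw [show i = ⟨a, ha⟩ from Fin.ext h, hga]
  obtain ⟨y, hyK, hy, h'⟩ := measure_initial_then_after hr hΓ hlaw ha hg'
  have hM : μ {ω | ∀ i : Fin L, (i : ℕ) < a + 1 → Γ i ω = g i} =
      μ {ω | ∀ i : Fin L, (i : ℕ) < a → Γ i ω = g i} *
        ENNReal.ofReal (rhoExt r a * (1 - rhoExt r a) ^ (K - x)) := by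
    have := measure_initial_inter hr hΓ hlaw g ha (K : ℕ∞)
    rw [setOf_initial_inter, ← hga, Function.update_eq_self, hga, hx ha, changeStep_coe hxK] at this
    rw [this, rhoExt, dif_pos ha]
  -- Sensor `a + 1` starts its delay at `K` itself, so requiring its change not to come before `K`
  -- costs nothing.
  have hpow : (1 - rhoExt r (a + 1)) ^ (K - y) = 1 := by
    by_cases h1 : a + 1 < L
    · have := hy h1
      rw [prevTime, dif_neg (by simp)] at this
      change g ⟨a, ha⟩ = y at this
      rw [hga] at this
      rw [Nat.cast_inj.mp this, Nat.sub_self, pow_zero]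
    · rw [show a + 1 = L by omega, rhoExt_self, sub_zero, one_pow]
  rw [h' K hyK, hM, h K hxK, hpow, ENNReal.ofReal_mul (rhoExt_mem hr a).1]
  simp only [ENNReal.ofReal_one, mul_one]
  ring

/-- The Markov property of the number of sensors that have seen the change. -/
theorem measure_state_transition {g : Fin L → ℕ∞} {K : ℕ} {a : Fin (L + 1)}
    (hg : ∀ i : Fin L, (i : ℕ) < a → g i < K) (j : Fin (L + 1)) :
    μ ({ω | ∀ i : Fin L, ((i : ℕ) < a → Γ i ω = g i) ∧ ((a : ℕ) ≤ i → (K : ℕ∞) ≤ Γ i ω)} ∩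
        stateEvent Γ K j) =
      ENNReal.ofReal (transW r j a) *
      μ {ω | ∀ i : Fin L, ((i : ℕ) < a → Γ i ω = g i) ∧ ((a : ℕ) ≤ i → (K : ℕ∞) ≤ Γ i ω)} := by
  by_cases haj : a ≤ j
  -- Sensors `a, …, j - 1` must all change exactly at `K`. They are added one at a time, each
  -- contributing its parameter; the survival of sensor `j` beyond `K` then gives the last factor.
  · set g' : Fin L → ℕ∞ := fun i => if (i : ℕ) < a then g i else K
    have hg' : ∀ i, g' i ≤ K := by
      intro i
      simp only [g']
      split_ifs with h
      · exact (hg i h).le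
      · exact le_rfl
    have hchain : ∀ n : ℕ, (a : ℕ) ≤ n → n ≤ L →
        μ {ω | ∀ i : Fin L, ((i : ℕ) < n → Γ i ω = g' i) ∧ (n ≤ i → (K : ℕ∞) ≤ Γ i ω)} =
        ENNReal.ofReal (∏ i ∈ Finset.Ico (a : ℕ) n, rhoExt r i) *
        μ {ω | ∀ i : Fin L, ((i : ℕ) < a → Γ i ω = g i) ∧
          ((a : ℕ) ≤ i → (K : ℕ∞) ≤ Γ i ω)} := by
      intro n hn
      induction n, hn using Nat.le_induction with
      | base =>
        intro _
        simp only [Finset.Ico_self, Finset.prod_empty, ENNReal.ofReal_one, one_mul]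
        congr 1
        ext ω
        refine forall_congr' fun i => and_congr_left fun _ => forall_congr' fun hi => ?_
        simp only [g', if_pos hi]
      | succ n hn ih =>
        intro hnL
        rw [measure_next_at hr hΓ hlaw hnL (fun i _ => hg' i) (by simp [g', not_lt.mpr hn]),
          ih (by omega), Finset.prod_Ico_succ_top hn, ← mul_assoc,
          ← ENNReal.ofReal_mul (rhoExt_mem hr n).1, mul_comm (rhoExt r n)]
    rw [transW, if_pos haj, ENNReal.ofReal_mul (by linarith [(rhoExt_mem hr j).2]), mul_assoc,
      ← hchain j haj (Nat.lt_succ_iff.mp j.2),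
      ← measure_after_succ hr hΓ hlaw (Nat.lt_succ_iff.mp j.2) fun i _ => hg' i]
    congr 1
    ext ω
    simp only [stateEvent, Set.mem_inter_iff, Set.mem_ofPred_eq, ← forall_and]
    refine forall_congr' fun i => ?_
    have haj' : (a : ℕ) ≤ j := haj
    simp only [g', Nat.cast_add, Nat.cast_one, ENat.add_one_le_iff (ENat.natCast_ne_top K)]
    by_cases h1 : (i : ℕ) < a
    · have h2 : (i : ℕ) < j := by omega
      simp only [h1, h2, not_le.mpr h1, not_le.mpr h2, if_true, true_imp_iff, false_imp_iff,
        and_true]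
      exact ⟨fun h => h.1, fun h => ⟨h, h.trans_le (hg i h1).le⟩⟩
    · by_cases h2 : (i : ℕ) < j
      · simp only [h1, h2, not_lt.mp h1, not_le.mpr h2, if_false, true_imp_iff, false_imp_iff,
          and_true, true_and]
        exact ⟨fun h => le_antisymm h.2 h.1, fun h => ⟨h.ge, h.le⟩⟩
      · simp only [h1, h2, not_lt.mp h1, not_lt.mp h2, true_imp_iff, false_imp_iff, true_and]
        exact ⟨fun h => h.2, fun h => ⟨h.le, h⟩⟩
  -- For `j < a`, sensor `j` changed before `K` and cannot still be waiting at `K`.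
  · rw [transW, if_neg haj, ENNReal.ofReal_zero, zero_mul]
    convert measure_empty (μ := μ)
    have haj' : (j : ℕ) < a := not_le.mp haj
    refine Set.eq_empty_of_forall_notMem fun ω hω => ?_
    have hjL : (j : ℕ) < L := by omega
    have h1 := (hω.1 ⟨j, hjL⟩).1 haj'
    have h2 := (hω.2 ⟨j, hjL⟩).2 le_rfl
    rw [h1] at h2
    exact absurd (hg ⟨j, hjL⟩ haj') (not_lt.mpr h2.le)

/-- The transition formula with no sensor affected and `K = 0`, where the conditioning event is the
whole space. -/
theorem measure_stateEvent_zero (j : Fin (L + 1)) :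
    μ (stateEvent Γ 0 j) = ENNReal.ofReal (transW r j 0) := by
  have := measure_state_transition hr hΓ hlaw (g := fun _ => 0) (K := 0) (a := 0)
    (fun i hi => by simp at hi) j
  simpa using this

omit [IsProbabilityMeasure μ] hr hΓ in
theorem ae_existsUnique_state (k : ℕ) : ∀ᵐ ω ∂μ, ∃! j, ω ∈ stateEvent Γ k j := by
  filter_upwards [ae_monotone_changePoints hlaw] with ω hω
  -- The affected sensors form an initial segment; its length is the least `j` such that every
  -- sensor from `j` on is still waiting.
  have hex : ∃ j : ℕ, ∀ i : Fin L, (k : ℕ∞) < Γ i ω ∨ (i : ℕ) < j :=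
    ⟨L, fun i => Or.inr i.2⟩
  classical
  have hle : Nat.find hex ≤ L := Nat.find_min' hex fun i => Or.inr i.2
  refine ⟨⟨Nat.find hex, Nat.lt_succ_of_le hle⟩, fun i => ⟨fun hi => ?_, fun hi => ?_⟩,
    fun j hj => ?_⟩
  · by_contra hlt
    refine Nat.find_min hex hi fun i' => ?_
    by_cases h : (i' : ℕ) < i
    · exact Or.inr h
    · exact Or.inl ((not_le.mp hlt).trans_le (hω (Fin.le_def.mpr (not_lt.mp h))))
  · exact (Nat.find_spec hex i).resolve_right (not_lt.mpr hi)
  · refine Fin.ext (le_antisymm ?_ ?_)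
    · by_contra hlt
      simp only [not_le] at hlt
      have hL : Nat.find hex < L := by omega
      have h1 := (hj ⟨_, hL⟩).1 hlt
      exact absurd ((Nat.find_spec hex ⟨_, hL⟩).resolve_right (lt_irrefl _)) (not_lt.mpr h1)
    · exact Nat.find_min' hex fun i => (le_or_gt (j : ℕ) i).imp (hj i).2 id

omit [IsProbabilityMeasure μ] hr in
theorem measure_eq_sum_inter_state (k : ℕ) (S : Set Ω) :
    μ S = ∑ m, μ (S ∩ stateEvent Γ k m) := by
  have hm : ∀ m, MeasurableSet (stateEvent Γ k m) := fun m =>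
    measurableSet_stateEvent (fun i => hΓ i (MeasurableSet.of_discrete (s := Set.Iic (k : ℕ∞)))) m
  have hae : S =ᵐ[μ] (S ∩ ⋃ m, stateEvent Γ k m : Set Ω) := by
    filter_upwards [ae_existsUnique_state hlaw k] with ω hω
    exact propext ⟨fun h => ⟨h, Set.mem_iUnion.mpr hω.exists⟩, fun h => h.1⟩
  rw [measure_congr hae, Set.inter_comm, ← Measure.restrict_apply (MeasurableSet.iUnion hm),
    measure_iUnion (fun i j h => stateEvent_disjoint h) hm, tsum_fintype]
  exact Finset.sum_congr rfl fun m _ => by rw [Measure.restrict_apply (hm m), Set.inter_comm]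

/-- The state transition, given the change-points truncated at the next time. -/
theorem measure_truncated_transition (k : ℕ) (g : Fin L → ℕ∞) (j : Fin (L + 1)) :
    μ ({ω | (fun i => min (Γ i ω) ((k + 1 : ℕ) : ℕ∞)) = g} ∩ stateEvent Γ (k + 1) j) =
      ∑ m, ENNReal.ofReal (transW r j m) *
        μ ({ω | (fun i => min (Γ i ω) ((k + 1 : ℕ) : ℕ∞)) = g} ∩ stateEvent Γ k m) := by
  rw [measure_eq_sum_inter_state hΓ hlaw k]
  refine Finset.sum_congr rfl fun m _ => ?_
  rw [Set.inter_right_comm]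
  -- If `g` is incompatible with state `m`, both sides vanish. Otherwise a witness shows that `g` is
  -- below the cap exactly on the first `m` sensors, and the event takes the form required by
  -- `measure_state_transition`.
  rcases Set.eq_empty_or_nonempty
    ({ω | (fun i => min (Γ i ω) ((k + 1 : ℕ) : ℕ∞)) = g} ∩ stateEvent Γ k m) with h | ⟨ω₀, h0, h1⟩
  · rw [h]; simp
  · have hlt : ∀ {x : ℕ∞}, x ≤ k ↔ x < ((k + 1 : ℕ) : ℕ∞) := by
      intro x
      rw [Nat.cast_add, Nat.cast_one, ENat.lt_add_one_iff (ENat.natCast_ne_top k)]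
    have hge : ∀ {x : ℕ∞}, (k : ℕ∞) < x ↔ ((k + 1 : ℕ) : ℕ∞) ≤ x := by
      intro x
      rw [← not_le, hlt, not_lt]
    have hg1 : ∀ i : Fin L, (i : ℕ) < m → g i < ((k + 1 : ℕ) : ℕ∞) := by
      intro i hi
      rw [← h0]
      exact (min_le_left _ _).trans_lt (hlt.mp ((h1 i).1 hi))
    have hg2 : ∀ i : Fin L, (m : ℕ) ≤ i → g i = ((k + 1 : ℕ) : ℕ∞) := by
      intro i hi
      rw [← h0]
      exact min_eq_right (hge.mp ((h1 i).2 hi))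
    have hset : {ω | (fun i => min (Γ i ω) ((k + 1 : ℕ) : ℕ∞)) = g} ∩ stateEvent Γ k m =
        {ω | ∀ i : Fin L, ((i : ℕ) < m → Γ i ω = g i) ∧
          ((m : ℕ) ≤ i → ((k + 1 : ℕ) : ℕ∞) ≤ Γ i ω)} := by
      ext ω
      simp only [stateEvent, Set.mem_inter_iff, Set.mem_ofPred_eq, funext_iff, ← forall_and]
      refine forall_congr' fun i => ?_
      rcases lt_or_ge (i : ℕ) m with hi | hi
      · simp only [hi, not_le.mpr hi, true_imp_iff, false_imp_iff, and_true]
        constructor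
        · rintro ⟨h2, h3⟩
          rwa [min_eq_left (hlt.mp h3).le] at h2
        · intro h2
          rw [h2]
          exact ⟨min_eq_left (hg1 i hi).le, hlt.mpr (hg1 i hi)⟩
      · simp only [hi, not_lt.mpr hi, true_imp_iff, false_imp_iff, true_and, hg2 i hi, hge]
        exact ⟨fun h => h.2, fun h => ⟨min_eq_right h, h⟩⟩
    rw [hset, measure_state_transition hr hΓ hlaw hg1]

end Chain

/-! ### Equality of measures tested on rectangles -/

section Rectangles

variable {ι κ X : Type*} [Fintype ι] [Fintype κ] [MeasurableSpace X]

theorem measure_pi_ext {μ₁ μ₂ : Measure (ι → X)} [IsFiniteMeasure μ₁]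
    (h : ∀ B : ι → Set X, (∀ i, MeasurableSet (B i)) → μ₁ (Set.univ.pi B) = μ₂ (Set.univ.pi B)) :
    μ₁ = μ₂ := by
  refine ext_of_generate_finite _ generateFrom_pi.symm isPiSystem_pi ?_ ?_
  · rintro _ ⟨B, hB, rfl⟩
    exact h B fun i => hB i (Set.mem_univ i)
  · simpa using h (fun _ => Set.univ) fun _ => MeasurableSet.univ

theorem measure_pi_pi_ext {μ₁ μ₂ : Measure (κ → ι → X)} [IsFiniteMeasure μ₁]
    (h : ∀ B : κ → ι → Set X, (∀ k i, MeasurableSet (B k i)) →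
      μ₁ (Set.univ.pi fun k => Set.univ.pi (B k)) = μ₂ (Set.univ.pi fun k => Set.univ.pi (B k))) :
    μ₁ = μ₂ := by
  set C : Set (Set (ι → X)) := Set.univ.pi '' Set.univ.pi fun _ => {s : Set X | MeasurableSet s}
  have hCuniv : Set.univ ∈ C :=
    ⟨fun _ => Set.univ, fun _ _ => MeasurableSet.univ, Set.pi_univ _⟩
  have hC : IsCountablySpanning C := ⟨fun _ => Set.univ, fun _ => hCuniv, Set.iUnion_const _⟩
  refine ext_of_generate_finite _
    (generateFrom_eq_pi (C := fun _ : κ => C) (fun _ => generateFrom_pi) fun _ => hC).symm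
    (IsPiSystem.pi fun _ => isPiSystem_pi) ?_ ?_
  · rintro _ ⟨S, hS, rfl⟩
    choose B hB hBS using fun k => hS k (Set.mem_univ k)
    have := h B fun k i => hB k i (Set.mem_univ i)
    simpa only [hBS] using this
  · have := h (fun _ _ => Set.univ) fun _ _ => MeasurableSet.univ
    simpa using this

end Rectangles

/-! ### Conditional law of the observations given the change-points -/

section ObservationLaw

variable {L : ℕ} {X : Type*} [MeasurableSpace X]

/-- Density of the observation vector at time `n`, given the change-points `m`. -/
noncomputable def condDensity (f₀ f₁ : X → ℝ) (m : Fin L → ℕ∞) (n : ℕ) (z : Fin L → X) : ℝ :=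
  ∏ i, if (n : ℕ∞) < m i then f₀ (z i) else f₁ (z i)

/-- Law of the observation vector at time `n`, given the change-points `m`. -/
noncomputable def condLaw (ν : Measure X) (f₀ f₁ : X → ℝ) (m : Fin L → ℕ∞) (n : ℕ) :
    Measure (Fin L → X) :=
  (Measure.pi fun _ : Fin L => ν).withDensity fun z => ENNReal.ofReal (condDensity f₀ f₁ m n z)

/-- Law of the observation vector when exactly the first `j` sensors have seen the change. -/
noncomputable def stateLaw (ν : Measure X) (f₀ f₁ : X → ℝ) (j : Fin (L + 1)) :
    Measure (Fin L → X) :=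
  (Measure.pi fun _ : Fin L => ν).withDensity fun z => ENNReal.ofReal (obsDensity f₀ f₁ j z)

/-- The observations at the times `1, …, k`. -/
def obsHistory {Ω : Type*} (Z : ℕ → Ω → Fin L → X) (k : ℕ) (ω : Ω) : Fin k → Fin L → X :=
  fun n => Z (n + 1) ω

variable {ν : Measure X} {f₀ f₁ : X → ℝ}

theorem condLaw_congr {m m' : Fin L → ℕ∞} {n n' : ℕ}
    (h : ∀ i, (n : ℕ∞) < m i ↔ (n' : ℕ∞) < m' i) :
    condLaw ν f₀ f₁ m n = condLaw ν f₀ f₁ m' n' := by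
  simp only [condLaw, condDensity, h]

theorem condLaw_eq_stateLaw {m : Fin L → ℕ∞} {n : ℕ} {j : Fin (L + 1)}
    (h : ∀ i : Fin L, ((i : ℕ) < j → m i ≤ n) ∧ ((j : ℕ) ≤ i → (n : ℕ∞) < m i)) :
    condLaw ν f₀ f₁ m n = stateLaw ν f₀ f₁ j := by
  have : ∀ i : Fin L, ((n : ℕ∞) < m i) = ¬ (i : ℕ) < j := fun i =>
    propext ⟨fun h1 h2 => absurd ((h i).1 h2) (not_le.mpr h1), fun h1 => (h i).2 (not_lt.mp h1)⟩
  simp only [condLaw, stateLaw, condDensity, obsDensity, this, ite_not]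

variable [SigmaFinite ν]

theorem condLaw_pi (hf₀ : IsProbDensity ν f₀) (hf₁ : IsProbDensity ν f₁) (m : Fin L → ℕ∞)
    (n : ℕ) {B : Fin L → Set X} (hB : ∀ i, MeasurableSet (B i)) :
    condLaw ν f₀ f₁ m n (Set.univ.pi B) =
      ∏ i, ∫⁻ x in B i, ENNReal.ofReal (if (n : ℕ∞) < m i then f₀ x else f₁ x) ∂ν := by
  rw [condLaw, withDensity_apply _ (MeasurableSet.univ_pi hB),
    ← setLIntegral_prod_density (g := fun i x => if (n : ℕ∞) < m i then f₀ x else f₁ x)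
      (fun i => by split_ifs <;> assumption) B]
  rfl

theorem isProbabilityMeasure_condLaw (hf₀ : IsProbDensity ν f₀) (hf₁ : IsProbDensity ν f₁)
    (m : Fin L → ℕ∞) (n : ℕ) : IsProbabilityMeasure (condLaw ν f₀ f₁ m n) := by
  refine ⟨?_⟩
  have := condLaw_pi hf₀ hf₁ m n (B := fun _ => Set.univ) fun _ => MeasurableSet.univ
  rw [Set.pi_univ] at this
  rw [this]
  refine Finset.prod_eq_one fun i _ => ?_
  split_ifs
  · simpa using hf₀.lintegral_eq_one
  · simpa using hf₁.lintegral_eq_one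

variable {r : Fin L → ℝ} {Ω : Type*} [MeasurableSpace Ω] {μ : Measure Ω}
  {Γ : Fin L → Ω → ℕ∞} {Z : ℕ → Ω → Fin L → X}

theorem measurable_obsHistory (hZ : ∀ k, Measurable (Z k)) (k : ℕ) :
    Measurable (obsHistory Z k) :=
  measurable_pi_lambda _ fun _ => hZ _

omit [SigmaFinite ν] in
theorem IsChangeModel.measurable_changePoints (hM : IsChangeModel μ ν r f₀ f₁ Γ Z) :
    Measurable fun ω i => Γ i ω := measurable_pi_lambda _ hM.measurable_Γ

variable [IsProbabilityMeasure μ] (hf₀ : IsProbDensity ν f₀) (hf₁ : IsProbDensity ν f₁)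
  (hZ : ∀ k, Measurable (Z k)) (hM : IsChangeModel μ ν r f₀ f₁ Γ Z)

include hf₀ hf₁ hZ hM

/-- The joint law of the observations at the times `1, …, k + 1`, on the event that the vector of
change-points is `m`. -/
theorem measure_history_inter_next (m : Fin L → ℕ∞) (k : ℕ) {S : Set (Fin k → Fin L → X)}
    (hS : MeasurableSet S) {B : Set (Fin L → X)} (hB : MeasurableSet B) :
    μ ((fun ω i => Γ i ω) ⁻¹' {m} ∩ obsHistory Z k ⁻¹' S ∩ Z (k + 1) ⁻¹' B) =
      μ ((fun ω i => Γ i ω) ⁻¹' {m}) *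
        Measure.pi (fun n : Fin k => condLaw ν f₀ f₁ m (n + 1)) S *
        condLaw ν f₀ f₁ m (k + 1) B := by
  have := fun n => isProbabilityMeasure_condLaw hf₀ hf₁ m n
  set E := (fun ω i => Γ i ω) ⁻¹' {m}
  have hE : MeasurableSet E := hM.measurable_changePoints (measurableSet_singleton m)
  have hEeq : E = {ω | ∀ i, Γ i ω = m i} := by ext ω; simp [E, funext_iff]
  have hY := measurable_obsHistory hZ k
  have hrect : ∀ (A : Fin k → Fin L → Set X), (∀ n i, MeasurableSet (A n i)) →
      ∀ B : Fin L → Set X, (∀ i, MeasurableSet (B i)) →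
      μ (E ∩ obsHistory Z k ⁻¹' (Set.univ.pi fun n => Set.univ.pi (A n)) ∩
        Z (k + 1) ⁻¹' Set.univ.pi B) = μ E *
        Measure.pi (fun n : Fin k => condLaw ν f₀ f₁ m (n + 1))
          (Set.univ.pi fun n => Set.univ.pi (A n)) * condLaw ν f₀ f₁ m (k + 1) (Set.univ.pi B) := by
    intro A hA B hB
    -- All the tests are encoded in one family indexed by time: `A` at the times `1, …, k` and `B`
    -- at `k + 1`. The value at time `0` is irrelevant.
    set D : ℕ → Fin L → Set X := fun n => if h : n - 1 < k then A ⟨n - 1, h⟩ else B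
    have hD : ∀ n i, MeasurableSet (D n i) := by
      intro n i
      simp only [D]
      split_ifs
      · exact hA _ _
      · exact hB _
    have hDlt : ∀ n : Fin k, D (n + 1) = A n := fun n => by simp [D]
    have hDk : D (k + 1) = B := by simp [D]
    have hset : E ∩ obsHistory Z k ⁻¹' (Set.univ.pi fun n => Set.univ.pi (A n)) ∩
        Z (k + 1) ⁻¹' Set.univ.pi B =
        {ω | (∀ i, Γ i ω = m i) ∧ ∀ n ∈ Finset.Icc 1 (k + 1), ∀ i, Z n ω i ∈ D n i} := by
      ext ω
      rw [hEeq, Set.inter_assoc]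
      refine and_congr_right fun _ => ⟨fun h n hn i => ?_, fun h => ⟨fun n _ i _ => ?_,
        fun i _ => ?_⟩⟩
      · rw [Finset.mem_Icc] at hn
        rcases hn.2.lt_or_eq with hlt | rfl
        · have h1 := h.1 ⟨n - 1, by omega⟩ (Set.mem_univ _) i (Set.mem_univ _)
          rw [← hDlt] at h1
          simpa only [obsHistory, Nat.sub_add_cancel hn.1] using h1
        · rw [hDk]
          exact h.2 i (Set.mem_univ _)
      · rw [← hDlt]
        exact h (n + 1) (Finset.mem_Icc.mpr ⟨by omega, by omega⟩) i
      · have h1 := h (k + 1) (Finset.mem_Icc.mpr ⟨by omega, le_rfl⟩) i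
        rwa [hDk] at h1
    have hprod : ∀ F : ℕ → ℝ≥0∞, ∏ n ∈ Finset.Icc 1 (k + 1), F n =
        (∏ n : Fin k, F (n + 1)) * F (k + 1) := by
      intro F
      rw [Finset.prod_Icc_succ_top (by omega), ← Finset.prod_range (fun n => F (n + 1)),
        show Finset.Icc 1 k = Finset.Ico 1 (k + 1) by rfl,
        Finset.prod_Ico_eq_prod_range]
      simp [add_comm]
    rw [hset, hM.law_Z m (k + 1) D hD, hprod, Measure.pi_pi, ← hEeq, mul_assoc, hDk,
      condLaw_pi hf₀ hf₁ m _ hB]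
    congr 2
    exact Finset.prod_congr rfl fun n _ => by rw [hDlt, condLaw_pi hf₀ hf₁ m _ (hA n)]
  -- The extension from rectangles takes two passes: first over histories with a rectangular `B`,
  -- then over the next observation with an arbitrary `S`.
  have hstep : ∀ B : Fin L → Set X, (∀ i, MeasurableSet (B i)) →
      (μ.restrict (E ∩ Z (k + 1) ⁻¹' Set.univ.pi B)).map (obsHistory Z k) =
      (μ E * condLaw ν f₀ f₁ m (k + 1) (Set.univ.pi B)) •
        Measure.pi (fun n : Fin k => condLaw ν f₀ f₁ m (n + 1)) := by
    intro B hB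
    refine measure_pi_pi_ext fun A hA => ?_
    have hAm := MeasurableSet.univ_pi fun n => MeasurableSet.univ_pi (hA n)
    rw [Measure.map_apply hY hAm, Measure.restrict_apply (hY hAm), Measure.smul_apply, smul_eq_mul,
      Set.inter_comm, Set.inter_right_comm, hrect A hA B hB]
    ring
  have hfinal : (μ.restrict (E ∩ obsHistory Z k ⁻¹' S)).map (Z (k + 1)) =
      (μ E * Measure.pi (fun n : Fin k => condLaw ν f₀ f₁ m (n + 1)) S) •
        condLaw ν f₀ f₁ m (k + 1) := by
    refine measure_pi_ext fun B hB => ?_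
    have hBm := MeasurableSet.univ_pi hB
    have h1 := congrArg (fun ρ => ρ S) (hstep B hB)
    simp only [Measure.map_apply hY hS, Measure.restrict_apply (hY hS), Measure.smul_apply,
      smul_eq_mul] at h1
    rw [Measure.map_apply (hZ _) hBm, Measure.restrict_apply (hZ _ hBm), Measure.smul_apply,
      smul_eq_mul, Set.inter_comm, Set.inter_right_comm, Set.inter_comm, h1]
    ring
  have h1 := congrArg (fun ρ => ρ B) hfinal
  simp only [Measure.map_apply (hZ _) hB, Measure.restrict_apply (hZ _ hB), Measure.smul_apply,
    smul_eq_mul] at h1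
  rw [Set.inter_comm, h1]

/-- Conditional independence of the observations, when all the change-points in `A` prescribe the
same laws for the observations at the times `1, …, k` and the same probability of `B` at time
`k + 1`. -/
theorem measure_changePoints_history_next {A : Set (Fin L → ℕ∞)} (g : Fin L → ℕ∞) (k : ℕ)
    (hA : ∀ m ∈ A, ∀ n ≤ k, ∀ i, (n : ℕ∞) < m i ↔ (n : ℕ∞) < g i)
    {S : Set (Fin k → Fin L → X)} (hS : MeasurableSet S) {B : Set (Fin L → X)}
    (hB : MeasurableSet B) {b : ℝ≥0∞} (hb : ∀ m ∈ A, condLaw ν f₀ f₁ m (k + 1) B = b) :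
    μ ((fun ω i => Γ i ω) ⁻¹' A ∩ obsHistory Z k ⁻¹' S ∩ Z (k + 1) ⁻¹' B) =
      μ ((fun ω i => Γ i ω) ⁻¹' A) *
        Measure.pi (fun n : Fin k => condLaw ν f₀ f₁ g (n + 1)) S * b := by
  have hΓ := hM.measurable_changePoints
  rw [measure_eq_tsum_inter_preimage μ hΓ, measure_eq_tsum_inter_preimage μ hΓ (_ ⁻¹' A),
    ← ENNReal.tsum_mul_right, ← ENNReal.tsum_mul_right]
  refine tsum_congr fun m => ?_
  rw [Set.inter_right_comm, Set.inter_right_comm _ _ (_ ⁻¹' {m}), ← Set.preimage_inter]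
  by_cases hm : m ∈ A
  · rw [Set.inter_eq_right.mpr (Set.singleton_subset_iff.mpr hm),
      measure_history_inter_next hf₀ hf₁ hZ hM m k hS hB, hb m hm]
    congr 4
    ext1 n
    exact condLaw_congr (hA m hm (n + 1) n.2)
  · rw [Set.inter_singleton_eq_empty.mpr hm]
    simp

end ObservationLaw

/-! ### Transition law given the full history -/

section Markov

variable {L : ℕ} {X : Type*} [MeasurableSpace X] {ν : Measure X} [SigmaFinite ν]
  {f₀ f₁ : X → ℝ} {r : Fin L → ℝ} {Ω : Type*} {mΩ : MeasurableSpace Ω} {μ : Measure Ω}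
  {Γ : Fin L → Ω → ℕ∞} {Z : ℕ → Ω → Fin L → X}

/-- The part of the hidden change process that is determined at time `k`. -/
noncomputable def truncChange (Γ : Fin L → Ω → ℕ∞) (k : ℕ) (ω : Ω) : Fin L → ℕ∞ :=
  fun i => min (Γ i ω) ((k + 1 : ℕ) : ℕ∞)

theorem truncChange_measurable (hΓ : ∀ i, Measurable (Γ i)) (k : ℕ) :
    Measurable (truncChange Γ k) :=
  measurable_pi_lambda _ fun i =>
    (Measurable.of_discrete (f := fun x : ℕ∞ => min x ((k + 1 : ℕ) : ℕ∞))).comp (hΓ i)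

/-- The cap `k + 1` lies above every time up to `k`, so no comparison at those times is lost. -/
theorem lt_truncChange_iff {k n : ℕ} (hn : n ≤ k) (ω : Ω) (i : Fin L) :
    (n : ℕ∞) < truncChange Γ k ω i ↔ (n : ℕ∞) < Γ i ω := by
  rw [truncChange, lt_min_iff]
  exact and_iff_left (Nat.cast_lt.mpr (Nat.lt_succ_of_le hn))

theorem comap_obs_le_comap_history {k n : ℕ} (hn : n ∈ Finset.Icc 1 k) :
    MeasurableSpace.comap (Z n) inferInstance ≤
      MeasurableSpace.comap (obsHistory Z k) inferInstance := by
  rw [Finset.mem_Icc] at hn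
  have : Z n = (fun y : Fin k → Fin L → X => y ⟨n - 1, by omega⟩) ∘ obsHistory Z k := by
    funext ω
    simp only [Function.comp, obsHistory, Nat.sub_add_cancel hn.1]
  rw [this, ← MeasurableSpace.comap_comp]
  exact MeasurableSpace.comap_mono (measurable_pi_apply _).comap_le

theorem obsFiltration_le_comap (hZ : ∀ k, Measurable (Z k)) (k : ℕ) :
    obsFiltration Z hZ k ≤ MeasurableSpace.comap (obsHistory Z k) inferInstance :=
  iSup₂_le fun _ hn => comap_obs_le_comap_history hn

/-- An event of the full history becomes a set of pairs whose first coordinate takes countably many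
values. It can thus be sliced along the capped change-points. -/
theorem fullHistory_le_comap (k : ℕ) :
    fullHistory Γ Z k ≤
      MeasurableSpace.comap (fun ω => (truncChange Γ k ω, obsHistory Z k ω)) inferInstance := by
  refine sup_le (iSup₂_le fun n hn => ?_) (iSup₂_le fun n hn => ?_)
  · have : (fun ω (i : Fin L) => Γ i ω ≤ (n : ℕ∞)) =
        (fun (q : (Fin L → ℕ∞) × (Fin k → Fin L → X)) i => q.1 i ≤ (n : ℕ∞)) ∘
          fun ω => (truncChange Γ k ω, obsHistory Z k ω) := by
      funext ω i
      simp only [Function.comp, ← not_lt,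
        lt_truncChange_iff (Nat.lt_succ_iff.mp (Finset.mem_range.mp hn))]
    rw [this, ← MeasurableSpace.comap_comp]
    refine MeasurableSpace.comap_mono (Measurable.comap_le (measurable_pi_lambda _ fun i => ?_))
    exact (Measurable.of_discrete (f := fun x : ℕ∞ => x ≤ (n : ℕ∞))).comp
      ((measurable_pi_apply i).comp measurable_fst)
  · refine (comap_obs_le_comap_history hn).trans ?_
    have : obsHistory Z k = Prod.snd ∘ fun ω => (truncChange Γ k ω, obsHistory Z k ω) := rfl
    conv_lhs => rw [this, ← MeasurableSpace.comap_comp]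
    exact MeasurableSpace.comap_mono measurable_snd.comap_le

theorem fullHistory_le (hΓ : ∀ i, Measurable (Γ i)) (hZ : ∀ k, Measurable (Z k)) (k : ℕ) :
    fullHistory Γ Z k ≤ mΩ :=
  (fullHistory_le_comap k).trans
    ((truncChange_measurable hΓ k).prodMk (measurable_obsHistory hZ k)).comap_le

theorem obsFiltration_le_fullHistory (hZ : ∀ k, Measurable (Z k)) (k : ℕ) :
    obsFiltration Z hZ k ≤ fullHistory Γ Z k :=
  le_sup_right

theorem measurableSet_fullHistory_stateEvent (k : ℕ) (j : Fin (L + 1)) :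
    MeasurableSet[fullHistory Γ Z k] (stateEvent Γ k j) := by
  refine measurableSet_stateEvent (fun i => ?_) j
  have h1 : MeasurableSet[MeasurableSpace.comap (fun ω (i : Fin L) => Γ i ω ≤ (k : ℕ∞))
      inferInstance] {ω | Γ i ω ≤ k} :=
    ⟨(fun q : Fin L → Prop => q i) ⁻¹' {q | q},
      measurable_pi_apply (X := fun _ => Prop) i MeasurableSet.of_discrete, rfl⟩
  have h2 : MeasurableSpace.comap (fun ω (i : Fin L) => Γ i ω ≤ (k : ℕ∞)) inferInstance ≤
      fullHistory Γ Z k :=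
    le_sup_of_le_left (le_iSup₂_of_le (f := fun n (_ : n ∈ Finset.range (k + 1)) =>
      MeasurableSpace.comap (fun ω (i : Fin L) => Γ i ω ≤ (n : ℕ∞)) inferInstance)
      k (Finset.self_mem_range_succ k) le_rfl)
  exact h2 _ h1

variable [IsProbabilityMeasure μ] (hf₀ : IsProbDensity ν f₀) (hf₁ : IsProbDensity ν f₁)
  (hr : ∀ i, r i ∈ Set.Icc (0 : ℝ) 1)
  (hZ : ∀ k, Measurable (Z k)) (hM : IsChangeModel μ ν r f₀ f₁ Γ Z)

include hf₀ hf₁ hr hZ hM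

/-- The Markov property of the hidden state jointly with the next observation. -/
theorem measure_fullHistory_inter_next (k : ℕ) (j : Fin (L + 1)) {S : Set Ω}
    (hS : MeasurableSet[fullHistory Γ Z k] S) {B : Set (Fin L → X)} (hB : MeasurableSet B) :
    μ (S ∩ (stateEvent Γ (k + 1) j ∩ Z (k + 1) ⁻¹' B)) =
      (∑ m, ENNReal.ofReal (transW r j m) * μ (S ∩ stateEvent Γ k m)) *
        stateLaw ν f₀ f₁ j B := by
  obtain ⟨S, hSm, rfl⟩ := fullHistory_le_comap k _ hS
  have htr := truncChange_measurable hM.measurable_Γ k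
  rw [measure_eq_tsum_inter_preimage μ htr (_ ∩ (_ ∩ _)), Finset.sum_congr rfl fun m _ => by
    rw [measure_eq_tsum_inter_preimage μ htr (_ ∩ stateEvent Γ k m), ← ENNReal.tsum_mul_left],
    ← Summable.tsum_finsetSum fun m _ => ENNReal.summable, ← ENNReal.tsum_mul_right]
  refine tsum_congr fun g => ?_
  -- On the atom where the capped change-points equal `g`, the event `S` reduces to its slice, a
  -- condition on the observations alone.
  have hSg : MeasurableSet (Prod.mk g ⁻¹' S) := measurable_prodMk_left hSm
  set E := {m : Fin L → ℕ∞ | (fun i => min (m i) ((k + 1 : ℕ) : ℕ∞)) = g}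
  set T : ℕ → Fin (L + 1) → Set (Fin L → ℕ∞) := fun k j =>
    {m | ∀ i : Fin L, ((i : ℕ) < j → m i ≤ k) ∧ ((j : ℕ) ≤ i → (k : ℕ∞) < m i)}
  have hE : ∀ m ∈ E, ∀ n ≤ k, ∀ i, (n : ℕ∞) < m i ↔ (n : ℕ∞) < g i := by
    intro m hm n hn i
    rw [← (show (fun i => min (m i) ((k + 1 : ℕ) : ℕ∞)) = g from hm)]
    exact (lt_truncChange_iff (Γ := fun i (_ : Unit) => m i) hn () i).symm
  have hmem : ∀ ω, truncChange Γ k ω = g → ((truncChange Γ k ω, obsHistory Z k ω) ∈ S ↔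
      obsHistory Z k ω ∈ Prod.mk g ⁻¹' S) := fun ω hg => by rw [hg, Set.mem_preimage]
  have h1 : (fun ω => (truncChange Γ k ω, obsHistory Z k ω)) ⁻¹' S ∩
      (stateEvent Γ (k + 1) j ∩ Z (k + 1) ⁻¹' B) ∩ truncChange Γ k ⁻¹' {g} =
      (fun ω i => Γ i ω) ⁻¹' (E ∩ T (k + 1) j) ∩ obsHistory Z k ⁻¹' (Prod.mk g ⁻¹' S) ∩
        Z (k + 1) ⁻¹' B := by
    ext ω
    constructor
    · rintro ⟨⟨hS, hT, hB⟩, hg⟩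
      exact ⟨⟨⟨hg, hT⟩, (hmem ω hg).mp hS⟩, hB⟩
    · rintro ⟨⟨⟨hg, hT⟩, hS⟩, hB⟩
      exact ⟨⟨(hmem ω hg).mpr hS, hT, hB⟩, hg⟩
  -- Time `k` is written in the same form with a trivial test on the next observation, so one
  -- factorization applies to both sides.
  have h2 : ∀ m, (fun ω => (truncChange Γ k ω, obsHistory Z k ω)) ⁻¹' S ∩
      stateEvent Γ k m ∩ truncChange Γ k ⁻¹' {g} =
      (fun ω i => Γ i ω) ⁻¹' (E ∩ T k m) ∩ obsHistory Z k ⁻¹' (Prod.mk g ⁻¹' S) ∩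
        Z (k + 1) ⁻¹' Set.univ := by
    intro m
    ext ω
    constructor
    · rintro ⟨⟨hS, hT⟩, hg⟩
      exact ⟨⟨⟨hg, hT⟩, (hmem ω hg).mp hS⟩, Set.mem_univ _⟩
    · rintro ⟨⟨⟨hg, hT⟩, hS⟩, -⟩
      exact ⟨⟨(hmem ω hg).mpr hS, hT⟩, hg⟩
  have hone : ∀ m : Fin L → ℕ∞, condLaw ν f₀ f₁ m (k + 1) Set.univ = 1 := fun m =>
    (isProbabilityMeasure_condLaw hf₀ hf₁ m (k + 1)).measure_univ
  have h4 : ∀ m, μ ((fun ω i => Γ i ω) ⁻¹' (E ∩ T k m) ∩ obsHistory Z k ⁻¹' (Prod.mk g ⁻¹' S) ∩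
        Z (k + 1) ⁻¹' Set.univ) = μ ((fun ω i => Γ i ω) ⁻¹' (E ∩ T k m)) *
        Measure.pi (fun n : Fin k => condLaw ν f₀ f₁ g (n + 1)) (Prod.mk g ⁻¹' S) * 1 := fun m =>
    measure_changePoints_history_next hf₀ hf₁ hZ hM g k
      (fun m hm => hE m hm.1) hSg MeasurableSet.univ fun m _ => hone m
  simp_rw [h2, h4]
  rw [h1, measure_changePoints_history_next hf₀ hf₁ hZ hM g k (fun m hm => hE m hm.1) hSg hB
    fun m hm => by rw [condLaw_eq_stateLaw hm.2]]
  have h3 := measure_truncated_transition hr hM.measurable_Γ hM.law_Γ k g j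
  change μ ((fun ω i => Γ i ω) ⁻¹' (E ∩ T (k + 1) j)) = ∑ m, ENNReal.ofReal (transW r j m) *
    μ ((fun ω i => Γ i ω) ⁻¹' (E ∩ T k m)) at h3
  rw [h3, Finset.sum_mul]
  congr 1
  exact Finset.sum_congr rfl fun m _ => by rw [mul_one, mul_assoc]

omit [IsProbabilityMeasure μ] hZ hM hr in
theorem stateLaw_toReal (j : Fin (L + 1)) {B : Set (Fin L → X)} (hB : MeasurableSet B) :
    (stateLaw ν f₀ f₁ j B).toReal =
      ∫ z in B, obsDensity f₀ f₁ j z ∂(Measure.pi fun _ : Fin L => ν) := by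
  have h := isProbDensity_obsDensity hf₀ hf₁ j
  rw [stateLaw, withDensity_apply _ hB,
    integral_eq_lintegral_of_nonneg_ae (ae_of_all _ h.nonneg) h.measurable.aestronglyMeasurable]

theorem condExp_next_fullHistory (k : ℕ) (j : Fin (L + 1)) {B : Set (Fin L → X)}
    (hB : MeasurableSet B) :
    μ⟦stateEvent Γ (k + 1) j ∩ Z (k + 1) ⁻¹' B | fullHistory Γ Z k⟧ =ᵐ[μ]
      fun ω => (∑ m, (stateEvent Γ k m).indicator (fun _ => transW r j m) ω) *
        ∫ z in B, obsDensity f₀ f₁ j z ∂(Measure.pi fun _ : Fin L => ν) := by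
  have hle := fullHistory_le hM.measurable_Γ hZ k
  have hT : ∀ k j, MeasurableSet (stateEvent Γ k j) := fun k j =>
    fullHistory_le hM.measurable_Γ hZ k _ (measurableSet_fullHistory_stateEvent k j)
  have hind : ∀ m, Integrable ((stateEvent Γ k m).indicator fun _ => transW r j m) μ := fun m =>
    (integrable_const _).indicator (hT k m)
  have hint : Integrable (fun ω => (∑ m, (stateEvent Γ k m).indicator
      (fun _ => transW r j m) ω) *
        ∫ z in B, obsDensity f₀ f₁ j z ∂(Measure.pi fun _ : Fin L => ν)) μ :=
    (integrable_finsetSum _ fun m _ => hind m).mul_const _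
  have hTB := (hT (k + 1) j).inter (hZ (k + 1) hB)
  refine (ae_eq_condExp_of_forall_setIntegral_eq hle ((integrable_const _).indicator hTB)
    (fun _ _ _ => hint.integrableOn) (fun S hS _ => ?_) ?_).symm
  · rw [integral_mul_const, integral_finsetSum _ fun m _ => (hind m).integrableOn,
      setIntegral_indicator hTB, setIntegral_const, smul_eq_mul, mul_one, measureReal_def,
      measure_fullHistory_inter_next hf₀ hf₁ hr hZ hM k j hS hB, ENNReal.toReal_mul,
      stateLaw_toReal hf₀ hf₁ j hB, ENNReal.toReal_sum fun m _ =>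
        ENNReal.mul_ne_top ENNReal.ofReal_ne_top (measure_ne_top _ _)]
    congr 1
    refine Finset.sum_congr rfl fun m _ => ?_
    rw [setIntegral_indicator (hT k m), setIntegral_const, smul_eq_mul, ENNReal.toReal_mul,
      ENNReal.toReal_ofReal (transW_nonneg hr j m), measureReal_def, mul_comm]
  · refine (Measurable.mul_const (Finset.measurable_sum _ fun m _ => ?_) _).aestronglyMeasurable
    exact measurable_const.indicator (measurableSet_fullHistory_stateEvent k m)

end Markov

/-! ### Conditional expectations identified by lower integrals -/

section CondExp

variable {Ω : Type*} {m mΩ : MeasurableSpace Ω} {μ : Measure Ω} [IsFiniteMeasure μ]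

/-- Testing nonnegative functions with lower integrals yields the integrability of `g` from the case
of the whole space. -/
theorem ae_eq_condExp_of_setLIntegral_eq (hm : m ≤ mΩ) {f g : Ω → ℝ} (hf : Integrable f μ)
    (hf0 : 0 ≤ᵐ[μ] f) (hgm : Measurable[m] g) (hg0 : 0 ≤ᵐ[μ] g)
    (h : ∀ S, MeasurableSet[m] S →
      ∫⁻ ω in S, ENNReal.ofReal (g ω) ∂μ = ∫⁻ ω in S, ENNReal.ofReal (f ω) ∂μ) :
    g =ᵐ[μ] μ[f | m] := by
  have hgm' : AEStronglyMeasurable g μ := (hgm.mono hm le_rfl).aestronglyMeasurable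
  have hg : Integrable g μ := by
    refine ⟨hgm', ?_⟩
    have h1 := h Set.univ MeasurableSet.univ
    simp only [Measure.restrict_univ] at h1
    rw [hasFiniteIntegral_iff_ofReal hg0, h1]
    exact (hasFiniteIntegral_iff_ofReal hf0).mp hf.2
  refine ae_eq_condExp_of_forall_setIntegral_eq hm hf (fun _ _ _ => hg.integrableOn)
    (fun S hS _ => ?_) hgm.aestronglyMeasurable
  rw [integral_eq_lintegral_of_nonneg_ae (ae_restrict_of_ae hg0) hgm'.restrict,
    integral_eq_lintegral_of_nonneg_ae (ae_restrict_of_ae hf0) hf.aestronglyMeasurable.restrict,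
    h S hS]

omit [IsFiniteMeasure μ] in
theorem setLIntegral_ofReal_indicator_one {T : Set Ω} (hT : MeasurableSet T) (S : Set Ω) :
    ∫⁻ ω in S, ENNReal.ofReal (T.indicator (fun _ => (1 : ℝ)) ω) ∂μ = μ (S ∩ T) := by
  have : ∀ ω, ENNReal.ofReal (T.indicator (fun _ => (1 : ℝ)) ω) =
      T.indicator (fun _ => (1 : ℝ≥0∞)) ω := by
    intro ω
    by_cases h : ω ∈ T <;> simp [h]
  simp_rw [this]
  rw [lintegral_indicator hT, Measure.restrict_restrict hT, setLIntegral_one, Set.inter_comm]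

theorem ae_eq_condProb_of_setLIntegral_eq (hm : m ≤ mΩ) {g : Ω → ℝ} {T : Set Ω}
    (hT : MeasurableSet T) (hgm : Measurable[m] g) (hg0 : 0 ≤ᵐ[μ] g)
    (h : ∀ S, MeasurableSet[m] S → ∫⁻ ω in S, ENNReal.ofReal (g ω) ∂μ = μ (S ∩ T)) :
    g =ᵐ[μ] μ⟦T | m⟧ :=
  ae_eq_condExp_of_setLIntegral_eq hm ((integrable_const _).indicator hT)
    (ae_of_all _ fun _ => Set.indicator_nonneg (fun _ _ => zero_le_one) _) hgm hg0
    fun S hS => by rw [h S hS, setLIntegral_ofReal_indicator_one hT]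

omit [IsFiniteMeasure μ] in
theorem condProb_nonneg (T : Set Ω) : 0 ≤ᵐ[μ] μ⟦T | m⟧ :=
  condExp_nonneg (ae_of_all _ fun _ => Set.indicator_nonneg (fun _ _ => zero_le_one) _)

theorem setLIntegral_condProb (hm : m ≤ mΩ) {T S : Set Ω} (hT : MeasurableSet T)
    (hS : MeasurableSet[m] S) : ∫⁻ ω in S, ENNReal.ofReal ((μ⟦T | m⟧) ω) ∂μ = μ (S ∩ T) := by
  have hi : Integrable (T.indicator fun _ => (1 : ℝ)) μ := (integrable_const _).indicator hT
  rw [← ofReal_integral_eq_lintegral_ofReal integrable_condExp.integrableOn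
    (ae_restrict_of_ae (condProb_nonneg T)), setIntegral_condExp hm hi hS,
    ofReal_integral_eq_lintegral_ofReal hi.integrableOn
      (ae_of_all _ fun _ => Set.indicator_nonneg (fun _ _ => zero_le_one) _),
    setLIntegral_ofReal_indicator_one hT]

end CondExp

/-! ### Beliefs as functions of the observed history and their joint laws -/

section Filter

variable {L : ℕ} {X : Type*} [MeasurableSpace X] {ν : Measure X} [SigmaFinite ν]
  {f₀ f₁ : X → ℝ} {r : Fin L → ℝ} {Ω : Type*} {mΩ : MeasurableSpace Ω} {μ : Measure Ω}
  {Γ : Fin L → Ω → ℕ∞} {Z : ℕ → Ω → Fin L → X}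

theorem measurable_belief (ℱ : Filtration ℕ mΩ) (k : ℕ) : Measurable[ℱ k] (belief μ ℱ Γ k) :=
  @measurable_pi_lambda _ _ _ (ℱ k) _ _ fun _ => stronglyMeasurable_condExp.measurable

theorem measurable_obs_next (hZ : ∀ k, Measurable (Z k)) (k : ℕ) :
    Measurable[obsFiltration Z hZ (k + 1)] (Z (k + 1)) := by
  refine measurable_iff_comap_le.mpr ?_
  exact le_iSup₂_of_le (f := fun n (_ : n ∈ Finset.Icc 1 (k + 1)) =>
    MeasurableSpace.comap (Z n) inferInstance) (k + 1)
    (Finset.mem_Icc.mpr ⟨by omega, le_rfl⟩) le_rfl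

theorem obsFiltration_eq_comap (hZ : ∀ k, Measurable (Z k)) (k : ℕ) :
    obsFiltration Z hZ k = MeasurableSpace.comap (obsHistory Z k) inferInstance := by
  refine le_antisymm (obsFiltration_le_comap hZ k) (measurable_iff_comap_le.mp ?_)
  refine @measurable_pi_lambda _ _ _ (obsFiltration Z hZ k) _ _ fun n => ?_
  exact (measurable_obs_next hZ n).mono ((obsFiltration Z hZ).mono n.2) le_rfl

theorem obsFiltration_succ_le (hZ : ∀ k, Measurable (Z k)) (k : ℕ) :
    obsFiltration Z hZ (k + 1) ≤
      MeasurableSpace.comap (fun ω => (obsHistory Z k ω, Z (k + 1) ω)) inferInstance := by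
  refine iSup₂_le fun n hn => ?_
  rw [Finset.mem_Icc] at hn
  rcases hn.2.lt_or_eq with h | rfl
  · refine (comap_obs_le_comap_history (Finset.mem_Icc.mpr ⟨hn.1, Nat.lt_succ_iff.mp h⟩)).trans ?_
    have : obsHistory Z k = Prod.fst ∘ fun ω => (obsHistory Z k ω, Z (k + 1) ω) := rfl
    conv_lhs => rw [this, ← MeasurableSpace.comap_comp]
    exact MeasurableSpace.comap_mono measurable_fst.comap_le
  · have : Z (k + 1) = Prod.snd ∘ fun ω => (obsHistory Z k ω, Z (k + 1) ω) := rfl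
    conv_lhs => rw [this, ← MeasurableSpace.comap_comp]
    exact MeasurableSpace.comap_mono measurable_snd.comap_le

/-- Doob–Dynkin factorization. It lets the posterior density be written on the product of the
history space and the observation space. -/
theorem exists_belief_eq_comp (hZ : ∀ k, Measurable (Z k)) (k : ℕ) :
    ∃ h : (Fin k → Fin L → X) → Fin (L + 1) → ℝ, Measurable h ∧
      belief μ (obsFiltration Z hZ) Γ k = h ∘ obsHistory Z k :=
  ((measurable_belief (obsFiltration Z hZ) k).mono
    (obsFiltration_le_comap hZ k) le_rfl).exists_eq_measurable_comp

variable [IsProbabilityMeasure μ] (hf₀ : IsProbDensity ν f₀) (hf₁ : IsProbDensity ν f₁)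
  (hr : ∀ i, r i ∈ Set.Icc (0 : ℝ) 1)
  (hZ : ∀ k, Measurable (Z k)) (hM : IsChangeModel μ ν r f₀ f₁ Γ Z)

omit [SigmaFinite ν] [IsProbabilityMeasure μ] in
include hM in
theorem IsChangeModel.measurableSet_stateEvent (k : ℕ) (j : Fin (L + 1)) :
    MeasurableSet (stateEvent Γ k j) :=
  ChangeDetection.measurableSet_stateEvent
    (fun i => hM.measurable_Γ i (MeasurableSet.of_discrete (s := Set.Iic (k : ℕ∞)))) j

omit [SigmaFinite ν] in
include hM in
theorem belief_mem (ℱ : Filtration ℕ mΩ) (k : ℕ) :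
    ∀ᵐ ω ∂μ, belief μ ℱ Γ k ω ∈ stdSimplex ℝ (Fin (L + 1)) := by
  have hint : ∀ j, Integrable ((stateEvent Γ k j).indicator fun _ => (1 : ℝ)) μ := fun j =>
    (integrable_const _).indicator (hM.measurableSet_stateEvent k j)
  have hsum : ∑ j, μ⟦stateEvent Γ k j | ℱ k⟧ =ᵐ[μ] fun _ => (1 : ℝ) := by
    refine (condExp_finsetSum (fun j _ => hint j) (ℱ k)).symm.trans ?_
    have h1 : ∑ j, (stateEvent Γ k j).indicator (fun _ => (1 : ℝ)) =ᵐ[μ] fun _ => (1 : ℝ) := by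
      filter_upwards [ae_existsUnique_state hM.law_Γ k] with ω ⟨j, hj, huniq⟩
      rw [Finset.sum_apply, Finset.sum_eq_single j]
      · simp [hj]
      · intro j' _ hne
        exact Set.indicator_of_notMem (fun h => hne (huniq j' h)) _
      · simp
    refine (condExp_congr_ae h1).trans ?_
    rw [condExp_const (ℱ.le k)]
  filter_upwards [hsum, ae_all_iff.mpr fun j => condProb_nonneg (μ := μ) (m := ℱ k)
    (stateEvent Γ k j)] with ω h1 h2
  exact ⟨h2, by rw [← h1, Finset.sum_apply]; rfl⟩

omit [SigmaFinite ν] in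
include hM in
theorem setLIntegral_belief (ℱ : Filtration ℕ mΩ) (k : ℕ) (j : Fin (L + 1)) {S : Set Ω}
    (hS : MeasurableSet[ℱ k] S) :
    ∫⁻ ω in S, ENNReal.ofReal (belief μ ℱ Γ k ω j) ∂μ = μ (S ∩ stateEvent Γ k j) :=
  setLIntegral_condProb (ℱ.le k) (hM.measurableSet_stateEvent k j) hS

include hr hM in
omit [SigmaFinite ν] in
theorem belief_zero : ∀ᵐ ω ∂μ, belief μ (obsFiltration Z hZ) Γ 0 ω = initBelief r := by
  have hbot : obsFiltration Z hZ 0 = ⊥ := by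
    change ⨆ n ∈ Finset.Icc 1 0, MeasurableSpace.comap (Z n) inferInstance = ⊥
    simp
  refine ae_of_all _ fun ω => funext fun j => ?_
  rw [belief, hbot, condExp_bot, integral_indicator (hM.measurableSet_stateEvent 0 j),
    setIntegral_const, smul_eq_mul, mul_one, measureReal_def,
    measure_stateEvent_zero hr hM.measurable_Γ hM.law_Γ,
    ENNReal.toReal_ofReal (transW_nonneg hr j 0)]
  rfl

include hf₀ hf₁ hr hM

/-- On an observed event, the masses of the hidden states are integrals of the belief. Substituting
them in the full-history transition assembles the unnormalized posterior. -/
theorem measure_inter_next (k : ℕ) (j : Fin (L + 1)) {S : Set Ω}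
    (hS : MeasurableSet[obsFiltration Z hZ k] S) {B : Set (Fin L → X)} (hB : MeasurableSet B) :
    μ (S ∩ (stateEvent Γ (k + 1) j ∩ Z (k + 1) ⁻¹' B)) =
      ∫⁻ ω in S, ∫⁻ z in B, ENNReal.ofReal
        (bayesNum r f₀ f₁ (belief μ (obsFiltration Z hZ) Γ k ω) z j)
        ∂(Measure.pi fun _ : Fin L => ν) ∂μ := by
  have hbm : ∀ m, Measurable fun ω => belief μ (obsFiltration Z hZ) Γ k ω m := fun m =>
    (measurable_pi_apply m).comp
      ((measurable_belief (obsFiltration Z hZ) k).mono ((obsFiltration Z hZ).le k) le_rfl)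
  have hD := isProbDensity_obsDensity hf₀ hf₁ j
  rw [measure_fullHistory_inter_next hf₀ hf₁ hr hZ hM k j
    (obsFiltration_le_fullHistory hZ k _ hS) hB]
  have hpt : ∀ᵐ ω ∂μ, ∫⁻ z in B, ENNReal.ofReal
        (bayesNum r f₀ f₁ (belief μ (obsFiltration Z hZ) Γ k ω) z j)
        ∂(Measure.pi fun _ : Fin L => ν) =
      (∑ m, ENNReal.ofReal (transW r j m) *
        ENNReal.ofReal (belief μ (obsFiltration Z hZ) Γ k ω m)) * stateLaw ν f₀ f₁ j B := by
    filter_upwards [belief_mem hM (obsFiltration Z hZ) k] with ω hω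
    unfold bayesNum
    simp_rw [ENNReal.ofReal_mul (predicted_nonneg hr hω.1 j)]
    rw [lintegral_const_mul _ hD.measurable.ennreal_ofReal, stateLaw, withDensity_apply _ hB,
      ENNReal.ofReal_sum_of_nonneg fun m _ => mul_nonneg (transW_nonneg hr j m) (hω.1 m)]
    congr 1
    exact Finset.sum_congr rfl fun m _ => ENNReal.ofReal_mul (transW_nonneg hr j m)
  rw [lintegral_congr_ae (ae_restrict_of_ae hpt),
    lintegral_mul_const _ (Finset.measurable_sum _ fun m _ =>
      (hbm m).ennreal_ofReal.const_mul _),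
    lintegral_finsetSum _ fun m _ => (hbm m).ennreal_ofReal.const_mul _]
  congr 1
  refine Finset.sum_congr rfl fun m _ => ?_
  rw [lintegral_const_mul _ (hbm m).ennreal_ofReal, setLIntegral_belief hM _ k m hS]

/-- The joint law of the state and the observation at time `k + 1` and of the past observations. -/
theorem setLIntegral_state_next (k : ℕ) (j : Fin (L + 1))
    {F : (Fin k → Fin L → X) × (Fin L → X) → ℝ≥0∞} (hF : Measurable F) :
    ∫⁻ ω in stateEvent Γ (k + 1) j, F (obsHistory Z k ω, Z (k + 1) ω) ∂μ =
      ∫⁻ ω, ∫⁻ z, ENNReal.ofReal (bayesNum r f₀ f₁ (belief μ (obsFiltration Z hZ) Γ k ω) z j) *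
        F (obsHistory Z k ω, z) ∂(Measure.pi fun _ : Fin L => ν) ∂μ := by
  obtain ⟨h, hh, hbh⟩ := exists_belief_eq_comp (μ := μ) (Γ := Γ) hZ k
  have hY := measurable_obsHistory hZ k
  have hYZ := hY.prodMk (hZ (k + 1))
  set d : (Fin k → Fin L → X) × (Fin L → X) → ℝ≥0∞ := fun q =>
    ENNReal.ofReal (bayesNum r f₀ f₁ (h q.1) q.2 j)
  have hd : Measurable d := ((measurable_bayesNum hf₀ hf₁ j).comp
    ((hh.comp measurable_fst).prodMk measurable_snd)).ennreal_ofReal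
  -- On state `j`, the joint law is absolutely continuous with respect to the product of the law of
  -- the history and the reference measure. Rectangles identify the density; test functions then
  -- follow by change of variables.
  have hlaw : (μ.restrict (stateEvent Γ (k + 1) j)).map
      (fun ω => (obsHistory Z k ω, Z (k + 1) ω)) =
      ((μ.map (obsHistory Z k)).prod (Measure.pi fun _ : Fin L => ν)).withDensity d := by
    refine Measure.ext_prod fun {A B} hA hB => ?_
    rw [Measure.map_apply hYZ (hA.prod hB), Measure.restrict_apply (hYZ (hA.prod hB)),
      withDensity_apply _ (hA.prod hB), setLIntegral_prod _ hd.aemeasurable,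
      setLIntegral_map hA
        (hd.lintegral_prod_right' (ν := (Measure.pi fun _ : Fin L => ν).restrict B)) hY]
    have hset : (fun ω => (obsHistory Z k ω, Z (k + 1) ω)) ⁻¹' A ×ˢ B ∩
        stateEvent Γ (k + 1) j =
        obsHistory Z k ⁻¹' A ∩ (stateEvent Γ (k + 1) j ∩ Z (k + 1) ⁻¹' B) := by
      ext ω
      exact ⟨fun h => ⟨h.1.1, h.2, h.1.2⟩, fun h => ⟨⟨h.1, h.2.2⟩, h.2.1⟩⟩
    rw [hset, measure_inter_next hf₀ hf₁ hr hZ hM k j _ hB, hbh]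
    · rfl
    · rw [obsFiltration_eq_comap]
      exact ⟨A, hA, rfl⟩
  have h1 := lintegral_map (μ := μ.restrict (stateEvent Γ (k + 1) j)) hF hYZ
  rw [← h1, hlaw, lintegral_withDensity_eq_lintegral_mul _ hd hF,
    lintegral_prod _ (hd.mul hF).aemeasurable,
    lintegral_map (hd.mul hF).lintegral_prod_right' hY, hbh]
  rfl

end Filter

/-! ### Bayes' rule, predictive density and sufficiency of the belief -/

section Sufficiency

variable {L : ℕ} {X : Type*} [MeasurableSpace X] {ν : Measure X} [SigmaFinite ν]
  {f₀ f₁ : X → ℝ} {r : Fin L → ℝ} {Ω : Type*} {mΩ : MeasurableSpace Ω} {μ : Measure Ω}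
  {Γ : Fin L → Ω → ℕ∞} {Z : ℕ → Ω → Fin L → X}
  [IsProbabilityMeasure μ] (hf₀ : IsProbDensity ν f₀) (hf₁ : IsProbDensity ν f₁)
  (hr : ∀ i, r i ∈ Set.Icc (0 : ℝ) 1)
  (hZ : ∀ k, Measurable (Z k)) (hM : IsChangeModel μ ν r f₀ f₁ Γ Z)

include hf₀ hf₁ hr hM

omit mΩ [IsProbabilityMeasure μ] hM in
theorem ofReal_predDensity {p : Fin (L + 1) → ℝ} (hp : ∀ m, 0 ≤ p m) (z : Fin L → X) :
    ENNReal.ofReal (predDensity r f₀ f₁ p z) =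
      ∑ j, ENNReal.ofReal (bayesNum r f₀ f₁ p z j) :=
  ENNReal.ofReal_sum_of_nonneg fun j _ => bayesNum_nonneg hf₀ hf₁ hr hp z j

omit hf₀ hf₁ hr [SigmaFinite ν] [IsProbabilityMeasure μ] in
theorem lintegral_eq_sum_state (k : ℕ) (F : Ω → ℝ≥0∞) :
    ∫⁻ ω, F ω ∂μ = ∑ j, ∫⁻ ω in stateEvent Γ k j, F ω ∂μ := by
  have hμ : Measure.sum (fun j => μ.restrict (stateEvent Γ k j)) = μ := by
    ext S hS
    rw [Measure.sum_apply _ hS, tsum_fintype,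
      measure_eq_sum_inter_state hM.measurable_Γ hM.law_Γ k S]
    exact Finset.sum_congr rfl fun j _ => by rw [Measure.restrict_apply hS]
  conv_lhs => rw [← hμ]
  rw [lintegral_sum_measure, tsum_fintype]

/-- The joint law of the observation at time `k + 1` and of the past observations. -/
theorem lintegral_next (k : ℕ) {F : (Fin k → Fin L → X) × (Fin L → X) → ℝ≥0∞}
    (hF : Measurable F) :
    ∫⁻ ω, F (obsHistory Z k ω, Z (k + 1) ω) ∂μ =
      ∫⁻ ω, ∫⁻ z, ENNReal.ofReal
        (predDensity r f₀ f₁ (belief μ (obsFiltration Z hZ) Γ k ω) z) *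
        F (obsHistory Z k ω, z) ∂(Measure.pi fun _ : Fin L => ν) ∂μ := by
  have hY := measurable_obsHistory hZ k
  have hbm : Measurable (belief μ (obsFiltration Z hZ) Γ k) :=
    (measurable_belief (obsFiltration Z hZ) k).mono ((obsFiltration Z hZ).le k) le_rfl
  have hm : ∀ j, Measurable fun q : Ω × (Fin L → X) =>
      ENNReal.ofReal (bayesNum r f₀ f₁ (belief μ (obsFiltration Z hZ) Γ k q.1) q.2 j) *
        F (obsHistory Z k q.1, q.2) := fun j =>
    ((measurable_bayesNum hf₀ hf₁ j).comp
      ((hbm.comp measurable_fst).prodMk measurable_snd)).ennreal_ofReal.mul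
      (hF.comp ((hY.comp measurable_fst).prodMk measurable_snd))
  rw [lintegral_eq_sum_state hM (k + 1),
    Finset.sum_congr rfl fun j _ => setLIntegral_state_next hf₀ hf₁ hr hZ hM k j hF,
    ← lintegral_finsetSum _ fun j _ => (hm j).lintegral_prod_right']
  refine lintegral_congr_ae ?_
  filter_upwards [belief_mem hM (obsFiltration Z hZ) k] with ω hω
  have hz : ∀ j, Measurable fun z =>
      ENNReal.ofReal (bayesNum r f₀ f₁ (belief μ (obsFiltration Z hZ) Γ k ω) z j) *
        F (obsHistory Z k ω, z) := fun j =>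
    ((measurable_bayesNum hf₀ hf₁ j).comp measurable_prodMk_left).ennreal_ofReal.mul
      (hF.comp measurable_prodMk_left)
  rw [← lintegral_finsetSum _ fun j _ => hz j]
  refine lintegral_congr fun z => ?_
  rw [ofReal_predDensity hf₀ hf₁ hr hω.1 z, Finset.sum_mul]

theorem setLIntegral_belief_next (k : ℕ) {S : Set Ω}
    (hS : MeasurableSet[obsFiltration Z hZ k] S)
    {G : (Fin (L + 1) → ℝ) × (Fin L → X) → ℝ≥0∞} (hG : Measurable G) :
    ∫⁻ ω in S, G (belief μ (obsFiltration Z hZ) Γ k ω, Z (k + 1) ω) ∂μ =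
      ∫⁻ ω in S, ∫⁻ z, ENNReal.ofReal
        (predDensity r f₀ f₁ (belief μ (obsFiltration Z hZ) Γ k ω) z) *
        G (belief μ (obsFiltration Z hZ) Γ k ω, z) ∂(Measure.pi fun _ : Fin L => ν) ∂μ := by
  have hSm := (obsFiltration Z hZ).le k _ hS
  obtain ⟨A, hA, rfl⟩ := obsFiltration_le_comap hZ k _ hS
  obtain ⟨h, hh, hbh⟩ := exists_belief_eq_comp (μ := μ) (Γ := Γ) hZ k
  have hF : Measurable ((Prod.fst ⁻¹' A).indicator fun q : (Fin k → Fin L → X) × (Fin L → X) =>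
      G (h q.1, q.2)) :=
    (hG.comp ((hh.comp measurable_fst).prodMk measurable_snd)).indicator (measurable_fst hA)
  have key := lintegral_next hf₀ hf₁ hr hZ hM k hF
  rw [← lintegral_indicator hSm, ← lintegral_indicator hSm]
  have hind : ∀ ω z, (Prod.fst ⁻¹' A).indicator
      (fun q : (Fin k → Fin L → X) × (Fin L → X) => G (h q.1, q.2)) (obsHistory Z k ω, z) =
      (obsHistory Z k ⁻¹' A).indicator
        (fun ω => G (belief μ (obsFiltration Z hZ) Γ k ω, z)) ω := by
    intro ω z
    rw [hbh]
    rfl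
  simp only [hind] at key
  refine Eq.trans (lintegral_congr fun ω => ?_) (key.trans (lintegral_congr fun ω => ?_))
  · by_cases hω : ω ∈ obsHistory Z k ⁻¹' A
    · simp only [Set.indicator_of_mem hω]
    · simp only [Set.indicator_of_notMem hω]
  · by_cases hω : ω ∈ obsHistory Z k ⁻¹' A
    · simp only [Set.indicator_of_mem hω]
    · simp only [Set.indicator_of_notMem hω, mul_zero, lintegral_zero]

/-- An observation almost surely avoids the zero set of its own density: testing the joint law on
that set gives zero. -/
theorem predDensity_pos (k : ℕ) :
    ∀ᵐ ω ∂μ, 0 < predDensity r f₀ f₁ (belief μ (obsFiltration Z hZ) Γ k ω) (Z (k + 1) ω) := by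
  set N : Set ((Fin (L + 1) → ℝ) × (Fin L → X)) := {q | predDensity r f₀ f₁ q.1 q.2 ≤ 0}
  have hN : MeasurableSet N := measurable_predDensity hf₀ hf₁ measurableSet_Iic
  have hbm : Measurable (belief μ (obsFiltration Z hZ) Γ k) :=
    (measurable_belief (obsFiltration Z hZ) k).mono ((obsFiltration Z hZ).le k) le_rfl
  have key := setLIntegral_belief_next hf₀ hf₁ hr hZ hM k MeasurableSet.univ
    (G := N.indicator fun _ => 1) (measurable_const.indicator hN)
  have h0 : ∀ p z, ENNReal.ofReal (predDensity r f₀ f₁ p z) *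
      N.indicator (fun _ => (1 : ℝ≥0∞)) (p, z) = 0 := by
    intro p z
    by_cases h : (p, z) ∈ N
    · rw [ENNReal.ofReal_of_nonpos h, zero_mul]
    · rw [Set.indicator_of_notMem h, mul_zero]
  simp only [h0, lintegral_zero, Measure.restrict_univ] at key
  have hNm : Measurable fun ω => N.indicator (fun _ => (1 : ℝ≥0∞))
      (belief μ (obsFiltration Z hZ) Γ k ω, Z (k + 1) ω) :=
    (measurable_const.indicator hN).comp (hbm.prodMk (hZ (k + 1)))
  rw [lintegral_eq_zero_iff hNm] at key
  filter_upwards [key] with ω hω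
  by_contra hneg
  have : (belief μ (obsFiltration Z hZ) Γ k ω, Z (k + 1) ω) ∈ N := not_lt.mp hneg
  simp [this] at hω

/-- The updated belief times the predictive density is the numerator. Thus integrating the update
over an observed event gives the joint mass of that event and the new state, which characterizes the
posterior. -/
theorem belief_succ (k : ℕ) :
    ∀ᵐ ω ∂μ, belief μ (obsFiltration Z hZ) Γ (k + 1) ω =
      beliefUpdate r f₀ f₁ (belief μ (obsFiltration Z hZ) Γ k ω) (Z (k + 1) ω) := by
  have hbm := measurable_belief (μ := μ) (Γ := Γ) (obsFiltration Z hZ) k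
  have hae : ∀ j, (fun ω => beliefUpdate r f₀ f₁ (belief μ (obsFiltration Z hZ) Γ k ω)
      (Z (k + 1) ω) j) =ᵐ[μ] μ⟦stateEvent Γ (k + 1) j | obsFiltration Z hZ (k + 1)⟧ := by
    intro j
    have hmeas := (measurable_pi_apply j).comp (measurable_beliefUpdate (r := r) hf₀ hf₁)
    refine ae_eq_condProb_of_setLIntegral_eq ((obsFiltration Z hZ).le (k + 1))
      (hM.measurableSet_stateEvent (k + 1) j) ?_ ?_ ?_
    · exact hmeas.comp ((hbm.mono ((obsFiltration Z hZ).mono (Nat.le_succ k)) le_rfl).prodMk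
        (measurable_obs_next hZ k))
    · filter_upwards [belief_mem hM (obsFiltration Z hZ) k] with ω hω
      exact div_nonneg (bayesNum_nonneg hf₀ hf₁ hr hω.1 _ j)
        (predDensity_nonneg hf₀ hf₁ hr hω.1 _)
    · intro S hS
      have hSm := (obsFiltration Z hZ).le (k + 1) _ hS
      obtain ⟨A, hA, rfl⟩ := obsFiltration_succ_le hZ k _ hS
      obtain ⟨h, hh, hbh⟩ := exists_belief_eq_comp (μ := μ) (Γ := Γ) hZ k
      have h1 : Measurable (A.indicator fun _ => (1 : ℝ≥0∞)) := measurable_const.indicator hA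
      have h2 : Measurable fun q : (Fin k → Fin L → X) × (Fin L → X) =>
          A.indicator (fun _ => (1 : ℝ≥0∞)) q *
            ENNReal.ofReal (beliefUpdate r f₀ f₁ (h q.1) q.2 j) :=
        h1.mul (hmeas.comp ((hh.comp measurable_fst).prodMk measurable_snd)).ennreal_ofReal
      have e1 := setLIntegral_state_next hf₀ hf₁ hr hZ hM k j h1
      have e2 := lintegral_next hf₀ hf₁ hr hZ hM k h2
      have e3 : ∫⁻ ω in stateEvent Γ (k + 1) j,
          A.indicator (fun _ => (1 : ℝ≥0∞)) (obsHistory Z k ω, Z (k + 1) ω) ∂μ =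
          μ ((fun ω => (obsHistory Z k ω, Z (k + 1) ω)) ⁻¹' A ∩ stateEvent Γ (k + 1) j) := by
        change ∫⁻ ω in stateEvent Γ (k + 1) j,
          ((fun ω => (obsHistory Z k ω, Z (k + 1) ω)) ⁻¹' A).indicator (fun _ => 1) ω ∂μ = _
        rw [lintegral_indicator hSm, Measure.restrict_restrict hSm, setLIntegral_one]
      rw [← e3, e1, ← lintegral_indicator hSm]
      calc _ = ∫⁻ ω, A.indicator (fun _ => (1 : ℝ≥0∞)) (obsHistory Z k ω, Z (k + 1) ω) *
            ENNReal.ofReal (beliefUpdate r f₀ f₁ (h (obsHistory Z k ω)) (Z (k + 1) ω) j) ∂μ := by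
            refine lintegral_congr fun ω => ?_
            by_cases hω : (obsHistory Z k ω, Z (k + 1) ω) ∈ A
            · rw [Set.indicator_of_mem hω, Set.indicator_of_mem (by exact hω), hbh, one_mul]
              rfl
            · rw [Set.indicator_of_notMem hω, Set.indicator_of_notMem (by exact hω), zero_mul]
        _ = _ := by
            rw [e2]
            refine lintegral_congr_ae ?_
            filter_upwards [belief_mem hM (obsFiltration Z hZ) k] with ω hω
            refine lintegral_congr fun z => ?_
            rw [show h (obsHistory Z k ω) = belief μ (obsFiltration Z hZ) Γ k ω by rw [hbh]; rfl]
            set p := belief μ (obsFiltration Z hZ) Γ k ω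
            have hb := bayesNum_nonneg hf₀ hf₁ hr hω.1 z
            -- The identity survives a zero denominator: a vanishing sum of nonnegative numerators
            -- forces each of them to vanish.
            have : ENNReal.ofReal (predDensity r f₀ f₁ p z) *
                ENNReal.ofReal (beliefUpdate r f₀ f₁ p z j) =
                ENNReal.ofReal (bayesNum r f₀ f₁ p z j) := by
              rw [← ENNReal.ofReal_mul (predDensity_nonneg hf₀ hf₁ hr hω.1 z)]
              congr 1
              unfold beliefUpdate
              by_cases h0 : predDensity r f₀ f₁ p z = 0
              · rw [h0, zero_mul]
                exact ((Finset.sum_eq_zero_iff_of_nonneg fun j _ => hb j).mp h0 j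
                  (Finset.mem_univ j)).symm
              · field_simp
            rw [mul_left_comm, this, mul_comm]
  filter_upwards [ae_all_iff.mpr hae] with ω hω
  exact funext fun j => (hω j).symm

theorem condExp_next_obs (k : ℕ) {B : Set (Fin L → X)} (hB : MeasurableSet B) :
    μ⟦Z (k + 1) ⁻¹' B | obsFiltration Z hZ k⟧ =ᵐ[μ] fun ω =>
      ∫ z in B, predDensity r f₀ f₁ (belief μ (obsFiltration Z hZ) Γ k ω) z
        ∂(Measure.pi fun _ : Fin L => ν) := by
  have hbm := measurable_belief (μ := μ) (Γ := Γ) (obsFiltration Z hZ) k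
  have hm : Measurable fun p => ∫ z in B, predDensity r f₀ f₁ p z
      ∂(Measure.pi fun _ : Fin L => ν) :=
    (StronglyMeasurable.integral_prod_right' (ν := (Measure.pi fun _ : Fin L => ν).restrict B)
      (measurable_predDensity hf₀ hf₁).stronglyMeasurable).measurable
  refine (ae_eq_condProb_of_setLIntegral_eq ((obsFiltration Z hZ).le k) (hZ (k + 1) hB)
    (hm.comp hbm) ?_ fun S hS => ?_).symm
  · filter_upwards [belief_mem hM (obsFiltration Z hZ) k] with ω hω
    exact integral_nonneg fun z => predDensity_nonneg hf₀ hf₁ hr hω.1 z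
  · have key := setLIntegral_belief_next hf₀ hf₁ hr hZ hM k hS
      (G := fun q => B.indicator (fun _ => 1) q.2)
      ((measurable_const.indicator hB).comp measurable_snd)
    have e1 : ∫⁻ ω in S, B.indicator (fun _ => (1 : ℝ≥0∞)) (Z (k + 1) ω) ∂μ =
        μ (S ∩ Z (k + 1) ⁻¹' B) := by
      change ∫⁻ ω in S, (Z (k + 1) ⁻¹' B).indicator (fun _ => 1) ω ∂μ = _
      rw [lintegral_indicator (hZ _ hB), Measure.restrict_restrict (hZ _ hB), setLIntegral_one,
        Set.inter_comm]
    rw [← e1, key]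
    refine lintegral_congr_ae (ae_restrict_of_ae ?_)
    filter_upwards [belief_mem hM (obsFiltration Z hZ) k] with ω hω
    rw [Function.comp_apply, ofReal_integral_eq_lintegral_ofReal
      (integrable_predDensity hf₀ hf₁ _).integrableOn
      (ae_of_all _ fun z => predDensity_nonneg hf₀ hf₁ hr hω.1 z), ← lintegral_indicator hB]
    refine lintegral_congr fun z => ?_
    by_cases hz : z ∈ B <;> simp [hz]

/-- This integrated form of the conditional expectation of `J` at the next belief is the one used
for telescoping in the verification argument. -/
theorem setLIntegral_next_cost {J : (Fin (L + 1) → ℝ) → ℝ} (hJ : IsBelowStopping J) (k : ℕ)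
    {S : Set Ω} (hS : MeasurableSet[obsFiltration Z hZ k] S) :
    ∫⁻ ω in S, ENNReal.ofReal (J (belief μ (obsFiltration Z hZ) Γ (k + 1) ω)) ∂μ =
      ∫⁻ ω in S, ENNReal.ofReal
        (expNext ν r f₀ f₁ J (belief μ (obsFiltration Z hZ) Γ k ω)) ∂μ := by
  have key := setLIntegral_belief_next hf₀ hf₁ hr hZ hM k hS
    (G := fun q => ENNReal.ofReal (J (beliefUpdate r f₀ f₁ q.1 q.2)))
    (hJ.measurable.comp (measurable_beliefUpdate hf₀ hf₁)).ennreal_ofReal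
  calc _ = ∫⁻ ω in S, ENNReal.ofReal (J (beliefUpdate r f₀ f₁
          (belief μ (obsFiltration Z hZ) Γ k ω) (Z (k + 1) ω))) ∂μ := by
        refine lintegral_congr_ae (ae_restrict_of_ae ?_)
        filter_upwards [belief_succ hf₀ hf₁ hr hZ hM k] with ω hω
        rw [hω]
    _ = _ := by
        rw [key]
        refine lintegral_congr_ae (ae_restrict_of_ae ?_)
        filter_upwards [belief_mem hM (obsFiltration Z hZ) k] with ω hω
        rw [ofReal_expNext hf₀ hf₁ hr hJ hω]
        exact lintegral_congr fun z => mul_comm _ _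

theorem condExp_next_cost {J : (Fin (L + 1) → ℝ) → ℝ} (hJ : IsBelowStopping J) (k : ℕ) :
    μ[fun ω => J (belief μ (obsFiltration Z hZ) Γ (k + 1) ω) | obsFiltration Z hZ k] =ᵐ[μ]
      fun ω => expNext ν r f₀ f₁ J (belief μ (obsFiltration Z hZ) Γ k ω) := by
  have hbm := fun k => measurable_belief (μ := μ) (Γ := Γ) (obsFiltration Z hZ) k
  have h0 : ∀ᵐ ω ∂μ, 0 ≤ J (belief μ (obsFiltration Z hZ) Γ (k + 1) ω) := by
    filter_upwards [belief_mem hM (obsFiltration Z hZ) (k + 1)] with ω hω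
    exact hJ.nonneg _ hω
  refine (ae_eq_condExp_of_setLIntegral_eq ((obsFiltration Z hZ).le k) ?_ h0
    ((measurable_expNext hf₀ hf₁ hJ.measurable).comp (hbm k)) ?_ fun S hS => ?_).symm
  · refine (integrable_const (1 : ℝ)).mono'
      (hJ.measurable.comp ((hbm (k + 1)).mono ((obsFiltration Z hZ).le _)
        le_rfl)).aestronglyMeasurable ?_
    filter_upwards [h0, belief_mem hM (obsFiltration Z hZ) (k + 1)] with ω h1 h2
    rw [Real.norm_of_nonneg h1]
    exact hJ.le_one h2
  · filter_upwards [belief_mem hM (obsFiltration Z hZ) k] with ω hω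
    exact expNext_nonneg hf₀ hf₁ hr hJ hω
  · exact (setLIntegral_next_cost hf₀ hf₁ hr hZ hM hJ k hS).symm

omit hf₀ hf₁ hr [SigmaFinite ν] [IsProbabilityMeasure μ] in
-- The first sensor is almost surely the earliest to change, so its waiting means that all are
-- waiting.
theorem stateEvent_zero_ae_eq [NeZero L] (k : ℕ) :
    stateEvent Γ k 0 =ᵐ[μ] {ω | (k : ℕ∞) < Γ 0 ω} := by
  filter_upwards [ae_monotone_changePoints hM.law_Γ] with ω hω
  refine propext ⟨fun h => (h 0).2 (by simp), fun h i => ⟨fun hi => absurd hi (by simp), fun _ =>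
    lt_of_lt_of_le h (hω (Fin.zero_le i))⟩⟩

omit hf₀ hf₁ hr [SigmaFinite ν] [IsProbabilityMeasure μ] in
theorem condProb_lt_changePoint [NeZero L] (ℱ : Filtration ℕ mΩ) (k : ℕ) :
    μ⟦{ω | (k : ℕ∞) < Γ 0 ω} | ℱ k⟧ =ᵐ[μ] fun ω => belief μ ℱ Γ k ω 0 :=
  condExp_congr_ae (indicator_ae_eq_of_ae_eq_set (stateEvent_zero_ae_eq hM k)).symm

omit hf₀ hf₁ hr [SigmaFinite ν] in
theorem condProb_changePoint_le [NeZero L] (ℱ : Filtration ℕ mΩ) (k : ℕ) :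
    μ⟦{ω | Γ 0 ω ≤ (k : ℕ∞)} | ℱ k⟧ =ᵐ[μ] fun ω => 1 - belief μ ℱ Γ k ω 0 := by
  have hm : MeasurableSet {ω | (k : ℕ∞) < Γ 0 ω} :=
    hM.measurable_Γ 0 (MeasurableSet.of_discrete (s := Set.Ioi (k : ℕ∞)))
  have heq : {ω | Γ 0 ω ≤ (k : ℕ∞)}.indicator (fun _ => (1 : ℝ)) =
      (fun _ => 1) - {ω | (k : ℕ∞) < Γ 0 ω}.indicator fun _ => 1 := by
    funext ω
    by_cases h : Γ 0 ω ≤ (k : ℕ∞)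
    · simp [h, not_lt.mpr h]
    · simp [h, not_le.mp h]
  rw [heq]
  refine (condExp_sub (integrable_const 1) ((integrable_const 1).indicator hm) _).trans ?_
  filter_upwards [condProb_lt_changePoint hM ℱ k] with ω hω
  rw [Pi.sub_apply, hω, condExp_const (ℱ.le k)]

/-- By induction the conditional expectation involves the information only through the next belief,
and sufficiency turns it into the one-step operator. -/
theorem infoCostToGo_eq [NeZero L] {c : ℝ} (hc : 0 < c) (n k : ℕ) :
    infoCostToGo μ (obsFiltration Z hZ) (Γ 0) c n k =ᵐ[μ]
      fun ω => stageCost ν r f₀ f₁ c n (belief μ (obsFiltration Z hZ) Γ k ω) := by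
  induction n generalizing k with
  | zero => exact condProb_lt_changePoint hM _ k
  | succ n ih =>
    have h1 := (condExp_congr_ae (m := obsFiltration Z hZ k) (ih (k + 1))).trans
      (condExp_next_cost hf₀ hf₁ hr hZ hM (isBelowStopping_stageCost hf₀ hf₁ hr hc n) k)
    filter_upwards [h1, condProb_lt_changePoint hM (obsFiltration Z hZ) k,
      condProb_changePoint_le hM (obsFiltration Z hZ) k] with ω e1 e2 e3
    simp only [infoCostToGo, stageCost]
    rw [e1, e2, e3]

end Sufficiency

/-- The truncated difference counts the times `k` with `b ≤ k < a`. The convention `⊤ - ⊤ = 0`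
agrees with the empty count. -/
theorem coe_sub_eq_tsum (a b : ℕ∞) :
    ((a - b : ℕ∞) : ℝ≥0∞) = ∑' k : ℕ, {k : ℕ | b ≤ k ∧ (k : ℕ∞) < a}.indicator 1 k := by
  rw [← tsum_subtype, show (∑' x : {k : ℕ | b ≤ k ∧ (k : ℕ∞) < a}, (1 : ℕ → ℝ≥0∞) x) =
    ∑' _ : {k : ℕ | b ≤ k ∧ (k : ℕ∞) < a}, (1 : ℝ≥0∞) from rfl, ENNReal.tsum_set_one]
  congr 1
  induction b using ENat.recTopCoe with
  | top => simp
  | coe y =>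
    induction a using ENat.recTopCoe with
    | top =>
      have : {k : ℕ | (y : ℕ∞) ≤ k ∧ (k : ℕ∞) < ⊤} = Set.Ici y := by ext k; simp
      rw [this, (Set.Ici_infinite y).encard_eq]
      simp
    | coe x =>
      have : {k : ℕ | (y : ℕ∞) ≤ k ∧ (k : ℕ∞) < x} = (Finset.Ico y x : Finset ℕ) := by
        ext k; simp
      rw [this, Set.encard_coe_eq_coe_finsetCard, Nat.card_Ico, ENat.natCast_sub]

/-! ### Stopping times, additive costs and the first crossing -/

section StoppingTime

variable {Ω : Type*} {mΩ : MeasurableSpace Ω} {ℱ : Filtration ℕ mΩ} {τ : Ω → ℕ∞}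

theorem measurableSet_lt_stopping (hτ : IsStoppingTime ℱ τ) (k : ℕ) :
    MeasurableSet[ℱ k] {ω | (k : ℕ∞) < τ ω} := hτ.measurableSet_gt k

theorem measurableSet_stopping_eq (hτ : IsStoppingTime ℱ τ) (k : ℕ) :
    MeasurableSet[ℱ k] {ω | τ ω = (k : ℕ∞)} := hτ.measurableSet_eq k

theorem setOf_le_stopping (τ : Ω → ℕ∞) (k : ℕ) :
    {ω | (k : ℕ∞) ≤ τ ω} = {ω | τ ω = (k : ℕ∞)} ∪ {ω | (k : ℕ∞) < τ ω} := by
  ext ω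
  rw [Set.mem_ofPred_eq, le_iff_eq_or_lt, eq_comm]
  rfl

theorem setOf_lt_stopping (τ : Ω → ℕ∞) (k : ℕ) :
    {ω | (k : ℕ∞) < τ ω} = {ω | ((k + 1 : ℕ) : ℕ∞) ≤ τ ω} := by
  ext ω
  rw [Set.mem_ofPred_eq, Set.mem_ofPred_eq, Nat.cast_add, Nat.cast_one,
    ENat.add_one_le_iff (ENat.natCast_ne_top k)]

theorem lintegral_additiveCost {L : ℕ} {μ : Measure Ω} {c : ℝ} {π : ℕ → Ω → Fin (L + 1) → ℝ}
    (hπ : ∀ k, Measurable (π k)) (hτ : IsStoppingTime ℱ τ) :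
    ∫⁻ ω, additiveCost c π τ ω ∂μ =
      (∑' k : ℕ, ∫⁻ ω in {ω | (k : ℕ∞) < τ ω}, ENNReal.ofReal (c * (1 - π k ω 0)) ∂μ) +
        ∑' k : ℕ, ∫⁻ ω in {ω | τ ω = (k : ℕ∞)}, ENNReal.ofReal (π k ω 0) ∂μ := by
  have h1 : ∀ k : ℕ, MeasurableSet {ω | (k : ℕ∞) < τ ω} := fun k =>
    ℱ.le k _ (measurableSet_lt_stopping hτ k)
  have h2 : ∀ k : ℕ, MeasurableSet {ω | τ ω = (k : ℕ∞)} := fun k =>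
    ℱ.le k _ (measurableSet_stopping_eq hτ k)
  have hπ0 : ∀ k, Measurable fun ω => π k ω 0 := fun k => (measurable_pi_apply 0).comp (hπ k)
  have m1 : ∀ k : ℕ, Measurable fun ω =>
      if (k : ℕ∞) < τ ω then ENNReal.ofReal (c * (1 - π k ω 0)) else 0 := fun k =>
    Measurable.ite (h1 k) ((measurable_const.sub (hπ0 k)).const_mul c).ennreal_ofReal
      measurable_const
  have m2 : ∀ k : ℕ, Measurable fun ω =>
      if τ ω = (k : ℕ∞) then ENNReal.ofReal (π k ω 0) else 0 := fun k =>
    Measurable.ite (h2 k) (hπ0 k).ennreal_ofReal measurable_const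
  unfold additiveCost
  rw [lintegral_add_left (Measurable.tsum m1), lintegral_tsum fun k => (m1 k).aemeasurable,
    lintegral_tsum fun k => (m2 k).aemeasurable]
  congr 1
  · exact tsum_congr fun k => by
      rw [← lintegral_indicator (h1 k)]
      exact lintegral_congr fun ω => by by_cases h : (k : ℕ∞) < τ ω <;> simp [h]
  · exact tsum_congr fun k => by
      rw [← lintegral_indicator (h2 k)]
      exact lintegral_congr fun ω => by by_cases h : τ ω = (k : ℕ∞) <;> simp [h]

theorem crossingTime_le_iff {L : ℕ} {c : ℝ} {A : (Fin (L + 1) → ℝ) → ℝ}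
    {π : ℕ → Ω → Fin (L + 1) → ℝ} {ω : Ω} {n : ℕ} :
    crossingTime c A π ω ≤ n ↔ ∃ k ≤ n, π k ω 0 * (1 + c) - c < A (π k ω) := by
  -- A strict bound on an infimum is an existence statement, unlike a weak one, hence the passage
  -- through `n + 1`.
  rw [← ENat.lt_add_one_iff (ENat.natCast_ne_top n), crossingTime, iInf_lt_iff]
  refine exists_congr fun k => ?_
  rw [iInf_lt_iff, ENat.lt_add_one_iff (ENat.natCast_ne_top n), Nat.cast_le]
  exact ⟨fun ⟨h1, h2⟩ => ⟨h2, h1⟩, fun ⟨h1, h2⟩ => ⟨h2, h1⟩⟩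

theorem crossing_of_eq {L : ℕ} {c : ℝ} {A : (Fin (L + 1) → ℝ) → ℝ}
    {π : ℕ → Ω → Fin (L + 1) → ℝ} {ω : Ω} {n : ℕ} (h : crossingTime c A π ω = n) :
    π n ω 0 * (1 + c) - c < A (π n ω) := by
  obtain ⟨k, hk, hlt⟩ := crossingTime_le_iff.mp h.le
  have h1 : crossingTime c A π ω ≤ k := crossingTime_le_iff.mpr ⟨k, le_rfl, hlt⟩
  rw [h, Nat.cast_le] at h1
  rwa [le_antisymm h1 hk]

theorem not_crossing_of_lt {L : ℕ} {c : ℝ} {A : (Fin (L + 1) → ℝ) → ℝ}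
    {π : ℕ → Ω → Fin (L + 1) → ℝ} {ω : Ω} {n : ℕ} (h : (n : ℕ∞) < crossingTime c A π ω) :
    A (π n ω) ≤ π n ω 0 * (1 + c) - c :=
  not_lt.mp fun hlt => absurd (crossingTime_le_iff.mpr ⟨n, le_rfl, hlt⟩) (not_le.mpr h)

theorem isStoppingTime_crossingTime {L : ℕ} {c : ℝ} {A : (Fin (L + 1) → ℝ) → ℝ}
    (hA : Measurable A) {π : ℕ → Ω → Fin (L + 1) → ℝ} (hπ : ∀ k, Measurable[ℱ k] (π k)) :
    IsStoppingTime ℱ (crossingTime c A π) := by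
  intro n
  have : {ω | crossingTime c A π ω ≤ (n : ℕ∞)} =
      ⋃ k ≤ n, π k ⁻¹' {p | p 0 * (1 + c) - c < A p} := by
    ext ω
    simp [crossingTime_le_iff]
  change MeasurableSet[ℱ n] {ω | crossingTime c A π ω ≤ (n : ℕ∞)}
  rw [this]
  refine MeasurableSet.iUnion fun k => MeasurableSet.iUnion fun hk => ?_
  refine (hπ k).mono (ℱ.mono hk) le_rfl (measurableSet_lt ?_ hA)
  exact ((measurable_pi_apply 0).mul_const _).sub_const _

end StoppingTime

/-! ### Verification of the crossing rule -/

section Optimality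

variable {L : ℕ} [NeZero L] {X : Type*} [MeasurableSpace X] {ν : Measure X} [SigmaFinite ν]
  {f₀ f₁ : X → ℝ} {r : Fin L → ℝ} {c : ℝ} {Ω : Type*} {mΩ : MeasurableSpace Ω} {μ : Measure Ω}
  {Γ : Fin L → Ω → ℕ∞} {Z : ℕ → Ω → Fin L → X}
  [IsProbabilityMeasure μ] (hf₀ : IsProbDensity ν f₀) (hf₁ : IsProbDensity ν f₁)
  (hr : ∀ i, r i ∈ Set.Icc (0 : ℝ) 1) (hc : 0 < c)
  (hZ : ∀ k, Measurable (Z k)) (hM : IsChangeModel μ ν r f₀ f₁ Γ Z)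

include hM

omit [SigmaFinite ν] in
theorem setLIntegral_belief_zero (ℱ : Filtration ℕ mΩ) (k : ℕ) {S : Set Ω}
    (hS : MeasurableSet[ℱ k] S) :
    ∫⁻ ω in S, ENNReal.ofReal (belief μ ℱ Γ k ω 0) ∂μ = μ (S ∩ {ω | (k : ℕ∞) < Γ 0 ω}) := by
  rw [setLIntegral_belief hM ℱ k 0 hS]
  exact measure_congr ((ae_eq_refl S).inter (stateEvent_zero_ae_eq hM k))

omit [SigmaFinite ν] in
theorem setLIntegral_one_sub_belief_zero (ℱ : Filtration ℕ mΩ) (k : ℕ) {S : Set Ω}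
    (hS : MeasurableSet[ℱ k] S) :
    ∫⁻ ω in S, ENNReal.ofReal (1 - belief μ ℱ Γ k ω 0) ∂μ =
      μ (S ∩ {ω | Γ 0 ω ≤ (k : ℕ∞)}) := by
  have hm : MeasurableSet {ω | Γ 0 ω ≤ (k : ℕ∞)} :=
    hM.measurable_Γ 0 (MeasurableSet.of_discrete (s := Set.Iic (k : ℕ∞)))
  rw [← setLIntegral_condProb (ℱ.le k) hm hS]
  refine lintegral_congr_ae (ae_restrict_of_ae ?_)
  filter_upwards [condProb_changePoint_le hM ℱ k] with ω hω
  rw [hω]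

omit [SigmaFinite ν] in
-- A false alarm forces `τ` to be finite and splits over its values; the delay is a sum over `k < τ`
-- of the indicators of an earlier change. Since these conditions on `τ` are known at time `k`, the
-- hidden indicators may be replaced by posteriors.
theorem detectionRisk_eq_tsum {ℱ : Filtration ℕ mΩ} (hc : 0 < c) {τ : Ω → ℕ∞}
    (hτ : IsStoppingTime ℱ τ) :
    detectionRisk μ c (Γ 0) τ =
      (∑' k : ℕ, ∫⁻ ω in {ω | (k : ℕ∞) < τ ω},
        ENNReal.ofReal (c * (1 - belief μ ℱ Γ k ω 0)) ∂μ) +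
        ∑' k : ℕ, ∫⁻ ω in {ω | τ ω = (k : ℕ∞)}, ENNReal.ofReal (belief μ ℱ Γ k ω 0) ∂μ := by
  have hΓlt : ∀ k : ℕ, MeasurableSet {ω | (k : ℕ∞) < Γ 0 ω} := fun k =>
    hM.measurable_Γ 0 (MeasurableSet.of_discrete (s := Set.Ioi (k : ℕ∞)))
  have hΓle : ∀ k : ℕ, MeasurableSet {ω | Γ 0 ω ≤ (k : ℕ∞)} := fun k =>
    hM.measurable_Γ 0 (MeasurableSet.of_discrete (s := Set.Iic (k : ℕ∞)))
  have hτlt : ∀ k : ℕ, MeasurableSet {ω | (k : ℕ∞) < τ ω} := fun k =>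
    ℱ.le k _ (measurableSet_lt_stopping hτ k)
  have hτeq : ∀ k : ℕ, MeasurableSet {ω | τ ω = (k : ℕ∞)} := fun k =>
    ℱ.le k _ (measurableSet_stopping_eq hτ k)
  have hfa : probFalseAlarm μ (Γ 0) τ =
      ∑' k : ℕ, μ ({ω | τ ω = (k : ℕ∞)} ∩ {ω | (k : ℕ∞) < Γ 0 ω}) := by
    rw [← measure_iUnion _ fun k => (hτeq k).inter (hΓlt k)]
    · unfold probFalseAlarm
      congr 1
      ext ω
      simp only [Set.mem_ofPred_eq, Set.mem_iUnion, Set.mem_inter_iff]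
      constructor
      · intro h
        obtain ⟨k, hk⟩ := ENat.ne_top_iff_exists.mp h.ne_top
        exact ⟨k, hk.symm, hk ▸ h⟩
      · rintro ⟨k, h1, h2⟩
        rwa [h1]
    · intro j k hjk
      refine Set.disjoint_left.mpr fun ω h1 h2 => hjk ?_
      exact Nat.cast_injective (h1.1.symm.trans h2.1 : (j : ℕ∞) = k)
  have hdelay : expDelay μ (Γ 0) τ =
      ∑' k : ℕ, μ ({ω | (k : ℕ∞) < τ ω} ∩ {ω | Γ 0 ω ≤ (k : ℕ∞)}) := by
    unfold expDelay
    simp_rw [coe_sub_eq_tsum]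
    have hm : ∀ k : ℕ, MeasurableSet ({ω | (k : ℕ∞) < τ ω} ∩ {ω | Γ 0 ω ≤ (k : ℕ∞)}) := fun k =>
      (hτlt k).inter (hΓle k)
    have hind : ∀ (k : ℕ) (ω : Ω), {k : ℕ | Γ 0 ω ≤ k ∧ (k : ℕ∞) < τ ω}.indicator
        (1 : ℕ → ℝ≥0∞) k =
        ({ω | (k : ℕ∞) < τ ω} ∩ {ω | Γ 0 ω ≤ (k : ℕ∞)}).indicator 1 ω := by
      intro k ω
      simp only [Set.indicator, Set.mem_inter_iff, Set.mem_ofPred_eq, and_comm, Pi.one_apply]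
    simp_rw [hind]
    rw [lintegral_tsum fun k => (measurable_one.indicator (hm k)).aemeasurable]
    exact tsum_congr fun k => lintegral_indicator_one (hm k)
  rw [detectionRisk, hfa, hdelay, ← ENNReal.tsum_mul_left, add_comm]
  congr 1
  · refine tsum_congr fun k => ?_
    rw [← setLIntegral_one_sub_belief_zero hM ℱ k (measurableSet_lt_stopping hτ k)]
    simp_rw [ENNReal.ofReal_mul hc.le]
    rw [lintegral_const_mul']
    exact ENNReal.ofReal_ne_top
  · exact tsum_congr fun k =>
      (setLIntegral_belief_zero hM ℱ k (measurableSet_stopping_eq hτ k)).symm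

include hr in
omit [SigmaFinite ν] in
theorem tendsto_measure_lt_changePoint (h0 : 0 < r 0) :
    Tendsto (fun n : ℕ => μ {ω | (n : ℕ∞) ≤ Γ 0 ω}) atTop (𝓝 0) := by
  have hL : 0 < L := Nat.pos_of_ne_zero (NeZero.ne L)
  have hzero : (0 : Fin L) = ⟨0, hL⟩ := rfl
  have heq : ∀ n : ℕ, μ {ω | (n : ℕ∞) ≤ Γ 0 ω} = ENNReal.ofReal ((1 - r 0) ^ n) := by
    intro n
    have := measure_initial_tail hr hM.measurable_Γ hM.law_Γ (fun _ => 0) hL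
      (x := 0) (K := n) (by simp [prevTime]) zero_le
    simpa [← hzero] using this
  simp_rw [heq]
  rw [← ENNReal.ofReal_zero]
  exact ENNReal.tendsto_ofReal (tendsto_pow_atTop_nhds_zero_of_lt_one
    (by linarith [(hr 0).2]) (by linarith))

include hr in
omit [SigmaFinite ν] in
theorem ae_changePoint_lt_top (h0 : 0 < r 0) : ∀ᵐ ω ∂μ, Γ 0 ω < ⊤ := by
  rw [ae_iff]
  refine le_antisymm (ge_of_tendsto' (tendsto_measure_lt_changePoint hr hM h0) fun n => ?_)
    zero_le
  refine measure_mono fun ω hω => ?_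
  have : Γ 0 ω = ⊤ := not_lt_top_iff.mp hω
  simp [this]

include hf₀ hf₁ hr hc

omit [NeZero L] in
-- The submartingale inequality in integrated form: the minimum in the fixed-point equation is at
-- most the cost of continuing.
theorem setLIntegral_costToGo_le (k : ℕ) {S : Set Ω}
    (hS : MeasurableSet[obsFiltration Z hZ k] S) :
    ∫⁻ ω in S, ENNReal.ofReal (costToGo ν r f₀ f₁ c (belief μ (obsFiltration Z hZ) Γ k ω)) ∂μ ≤
      ∫⁻ ω in S, ENNReal.ofReal (c * (1 - belief μ (obsFiltration Z hZ) Γ k ω 0)) ∂μ +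
      ∫⁻ ω in S, ENNReal.ofReal
        (costToGo ν r f₀ f₁ c (belief μ (obsFiltration Z hZ) Γ (k + 1) ω)) ∂μ := by
  have hJ := isBelowStopping_costToGo hf₀ hf₁ hr hc
  have hbm := (measurable_belief (μ := μ) (Γ := Γ) (obsFiltration Z hZ) k).mono
    ((obsFiltration Z hZ).le k) le_rfl
  have hm : Measurable fun ω =>
      ENNReal.ofReal (c * (1 - belief μ (obsFiltration Z hZ) Γ k ω 0)) :=
    ((measurable_const.sub ((measurable_pi_apply 0).comp hbm)).const_mul c).ennreal_ofReal
  rw [setLIntegral_next_cost hf₀ hf₁ hr hZ hM hJ k hS, ← lintegral_add_left hm]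
  refine lintegral_mono_ae (ae_restrict_of_ae ?_)
  filter_upwards [belief_mem hM (obsFiltration Z hZ) k] with ω hω
  rw [costToGo_eq hf₀ hf₁ hr hc hω, ← ENNReal.ofReal_add
    (mul_nonneg hc.le (by linarith [(mem_Icc_of_mem_stdSimplex hω 0).2]))
    (expNext_nonneg hf₀ hf₁ hr hJ hω)]
  exact ENNReal.ofReal_le_ofReal (min_le_right _ _)

omit [NeZero L] in
-- On the continuation region the minimum is the cost of continuing, so nothing is lost.
theorem setLIntegral_costToGo_eq (k : ℕ) {S : Set Ω}
    (hS : MeasurableSet[obsFiltration Z hZ k] S)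
    (hcont : ∀ ω ∈ S, contCost ν r f₀ f₁ c (belief μ (obsFiltration Z hZ) Γ k ω) ≤
      belief μ (obsFiltration Z hZ) Γ k ω 0 * (1 + c) - c) :
    ∫⁻ ω in S, ENNReal.ofReal (costToGo ν r f₀ f₁ c (belief μ (obsFiltration Z hZ) Γ k ω)) ∂μ =
      ∫⁻ ω in S, ENNReal.ofReal (c * (1 - belief μ (obsFiltration Z hZ) Γ k ω 0)) ∂μ +
      ∫⁻ ω in S, ENNReal.ofReal
        (costToGo ν r f₀ f₁ c (belief μ (obsFiltration Z hZ) Γ (k + 1) ω)) ∂μ := by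
  have hJ := isBelowStopping_costToGo hf₀ hf₁ hr hc
  have hbm := (measurable_belief (μ := μ) (Γ := Γ) (obsFiltration Z hZ) k).mono
    ((obsFiltration Z hZ).le k) le_rfl
  have hm : Measurable fun ω =>
      ENNReal.ofReal (c * (1 - belief μ (obsFiltration Z hZ) Γ k ω 0)) :=
    ((measurable_const.sub ((measurable_pi_apply 0).comp hbm)).const_mul c).ennreal_ofReal
  rw [setLIntegral_next_cost hf₀ hf₁ hr hZ hM hJ k hS, ← lintegral_add_left hm]
  refine setLIntegral_congr_fun_ae ((obsFiltration Z hZ).le k _ hS) ?_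
  filter_upwards [belief_mem hM (obsFiltration Z hZ) k] with ω hω hωS
  rw [costToGo_eq hf₀ hf₁ hr hc hω, ← ENNReal.ofReal_add
    (mul_nonneg hc.le (by linarith [(mem_Icc_of_mem_stdSimplex hω 0).2]))
    (expNext_nonneg hf₀ hf₁ hr hJ hω), min_eq_right]
  · rfl
  · have := hcont ω hωS
    nlinarith

omit hf₀ hf₁ hr hc [SigmaFinite ν] [NeZero L] [IsProbabilityMeasure μ] hM in
theorem setLIntegral_split_stopping {ℱ : Filtration ℕ mΩ} {τ : Ω → ℕ∞} (hτ : IsStoppingTime ℱ τ)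
    (n : ℕ) (F : Ω → ℝ≥0∞) :
    ∫⁻ ω in {ω | (n : ℕ∞) ≤ τ ω}, F ω ∂μ =
      ∫⁻ ω in {ω | τ ω = (n : ℕ∞)}, F ω ∂μ + ∫⁻ ω in {ω | (n : ℕ∞) < τ ω}, F ω ∂μ := by
  rw [setOf_le_stopping, lintegral_union (ℱ.le n _ (measurableSet_lt_stopping hτ n))]
  exact Set.disjoint_left.mpr fun ω h1 h2 => (h2 : (n : ℕ∞) < τ ω).ne' h1

omit [NeZero L] [SigmaFinite ν] hf₀ hf₁ hc in
theorem lintegral_costToGo_zero :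
    ∫⁻ ω, ENNReal.ofReal (costToGo ν r f₀ f₁ c (belief μ (obsFiltration Z hZ) Γ 0 ω)) ∂μ =
      ENNReal.ofReal (costToGo ν r f₀ f₁ c (initBelief r)) := by
  have : ∀ᵐ ω ∂μ, ENNReal.ofReal
      (costToGo ν r f₀ f₁ c (belief μ (obsFiltration Z hZ) Γ 0 ω)) =
      ENNReal.ofReal (costToGo ν r f₀ f₁ c (initBelief r)) := by
    filter_upwards [belief_zero hr hZ hM] with ω hω
    rw [hω]
  rw [lintegral_congr_ae this, lintegral_const, measure_univ, mul_one]

omit [NeZero L] in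
-- Telescoping: at each time the paths that stop pay the terminal cost, which dominates `J`, and the
-- others pay the running cost and keep `J` at the next belief as a remainder.
theorem costToGo_le_partial_cost {τ : Ω → ℕ∞} (hτ : IsStoppingTime (obsFiltration Z hZ) τ)
    (n : ℕ) :
    ENNReal.ofReal (costToGo ν r f₀ f₁ c (initBelief r)) ≤
      (∑ k ∈ Finset.range n, (∫⁻ ω in {ω | (k : ℕ∞) < τ ω},
        ENNReal.ofReal (c * (1 - belief μ (obsFiltration Z hZ) Γ k ω 0)) ∂μ +
        ∫⁻ ω in {ω | τ ω = (k : ℕ∞)},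
          ENNReal.ofReal (belief μ (obsFiltration Z hZ) Γ k ω 0) ∂μ)) +
      ∫⁻ ω in {ω | (n : ℕ∞) ≤ τ ω}, ENNReal.ofReal
        (costToGo ν r f₀ f₁ c (belief μ (obsFiltration Z hZ) Γ n ω)) ∂μ := by
  induction n with
  | zero => simp [lintegral_costToGo_zero hr hZ hM]
  | succ n ih =>
    refine ih.trans ?_
    rw [Finset.sum_range_succ, add_assoc, setLIntegral_split_stopping hτ n, ← setOf_lt_stopping,
      add_right_comm, add_comm (∫⁻ ω in {ω | τ ω = (n : ℕ∞)}, _ ∂μ)]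
    refine add_le_add_right (add_le_add (setLIntegral_costToGo_le hf₀ hf₁ hr hc hZ hM n
      (measurableSet_lt_stopping hτ n)) (lintegral_mono_ae (ae_restrict_of_ae ?_))) _
    filter_upwards [belief_mem hM (obsFiltration Z hZ) n] with ω hω
    exact ENNReal.ofReal_le_ofReal
      ((isBelowStopping_costToGo hf₀ hf₁ hr hc).le_apply_zero _ hω)

omit [NeZero L] in
theorem costToGo_eq_partial_cost (n : ℕ) :
    let τ := crossingTime c (contCost ν r f₀ f₁ c) (belief μ (obsFiltration Z hZ) Γ)
    ENNReal.ofReal (costToGo ν r f₀ f₁ c (initBelief r)) =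
      (∑ k ∈ Finset.range n, (∫⁻ ω in {ω | (k : ℕ∞) < τ ω},
        ENNReal.ofReal (c * (1 - belief μ (obsFiltration Z hZ) Γ k ω 0)) ∂μ +
        ∫⁻ ω in {ω | τ ω = (k : ℕ∞)},
          ENNReal.ofReal (belief μ (obsFiltration Z hZ) Γ k ω 0) ∂μ)) +
      ∫⁻ ω in {ω | (n : ℕ∞) ≤ τ ω}, ENNReal.ofReal
        (costToGo ν r f₀ f₁ c (belief μ (obsFiltration Z hZ) Γ n ω)) ∂μ := by
  intro τ
  have hτ : IsStoppingTime (obsFiltration Z hZ) τ :=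
    isStoppingTime_crossingTime (measurable_contCost hf₀ hf₁) (measurable_belief _)
  induction n with
  | zero => simp [lintegral_costToGo_zero hr hZ hM]
  | succ n ih =>
    rw [ih, Finset.sum_range_succ, add_assoc, setLIntegral_split_stopping hτ n,
      ← setOf_lt_stopping, add_right_comm, add_comm (∫⁻ ω in {ω | τ ω = (n : ℕ∞)}, _ ∂μ),
      setLIntegral_costToGo_eq hf₀ hf₁ hr hc hZ hM n (measurableSet_lt_stopping hτ n)
        fun ω hω => not_crossing_of_lt hω]
    congr 2
    refine setLIntegral_congr_fun_ae ((obsFiltration Z hZ).le n _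
      (measurableSet_stopping_eq hτ n)) ?_
    filter_upwards [belief_mem hM (obsFiltration Z hZ) n] with ω hω hωn
    rw [costToGo_eq hf₀ hf₁ hr hc hω, min_eq_left]
    -- The crossing inequality says that `p 0` is below the cost of continuing, so stopping attains
    -- the minimum.
    have := crossing_of_eq hωn
    nlinarith

/-- The remainder is bounded by the mean posterior of "no change" at time `n`, that is, by the
probability that the change comes later. It vanishes in the limit, including for rules that may
never stop. -/
theorem costToGo_le_detectionRisk (h0 : 0 < r 0) {τ : Ω → ℕ∞}
    (hτ : IsStoppingTime (obsFiltration Z hZ) τ) :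
    ENNReal.ofReal (costToGo ν r f₀ f₁ c (initBelief r)) ≤ detectionRisk μ c (Γ 0) τ := by
  have hlim : Tendsto (fun n : ℕ => detectionRisk μ c (Γ 0) τ + μ {ω | (n : ℕ∞) ≤ Γ 0 ω}) atTop
      (𝓝 (detectionRisk μ c (Γ 0) τ)) := by
    simpa using (tendsto_const_nhds (x := detectionRisk μ c (Γ 0) τ)).add
      (tendsto_measure_lt_changePoint hr hM h0)
  refine ge_of_tendsto' hlim fun n => ?_
  refine (costToGo_le_partial_cost hf₀ hf₁ hr hc hZ hM hτ n).trans (add_le_add ?_ ?_)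
  · rw [detectionRisk_eq_tsum hM hc hτ, ← ENNReal.tsum_add]
    exact ENNReal.sum_le_tsum _
  · calc _ ≤ ∫⁻ ω in {ω | (n : ℕ∞) ≤ τ ω},
          ENNReal.ofReal (belief μ (obsFiltration Z hZ) Γ n ω 0) ∂μ := by
          refine lintegral_mono_ae (ae_restrict_of_ae ?_)
          filter_upwards [belief_mem hM (obsFiltration Z hZ) n] with ω hω
          exact ENNReal.ofReal_le_ofReal
            ((isBelowStopping_costToGo hf₀ hf₁ hr hc).le_apply_zero _ hω)
      _ ≤ ∫⁻ ω in Set.univ, ENNReal.ofReal (belief μ (obsFiltration Z hZ) Γ n ω 0) ∂μ :=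
          lintegral_mono_set (Set.subset_univ _)
      _ = μ (Set.univ ∩ {ω | (n : ℕ∞) < Γ 0 ω}) :=
          setLIntegral_belief_zero hM _ n MeasurableSet.univ
      _ ≤ _ := measure_mono fun ω hω => (show (n : ℕ∞) < Γ 0 ω from hω.2).le

theorem crossingTime_optimal (h0 : 0 < r 0) :
    let τ := crossingTime c (contCost ν r f₀ f₁ c) (belief μ (obsFiltration Z hZ) Γ)
    IsStoppingTime (obsFiltration Z hZ) τ ∧ (∀ᵐ ω ∂μ, τ ω < ⊤) ∧
      detectionRisk μ c (Γ 0) τ = ENNReal.ofReal (costToGo ν r f₀ f₁ c (initBelief r)) := by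
  intro τ
  have hτ : IsStoppingTime (obsFiltration Z hZ) τ :=
    isStoppingTime_crossingTime (measurable_contCost hf₀ hf₁) (measurable_belief _)
  have hle : detectionRisk μ c (Γ 0) τ ≤
      ENNReal.ofReal (costToGo ν r f₀ f₁ c (initBelief r)) := by
    -- For the crossing rule the partial costs equal the optimal value minus a nonnegative
    -- remainder, which is simply dropped.
    rw [detectionRisk_eq_tsum hM hc hτ, ← ENNReal.tsum_add]
    refine ENNReal.tsum_le_of_sum_range_le fun n => ?_
    rw [costToGo_eq_partial_cost hf₀ hf₁ hr hc hZ hM n]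
    exact le_self_add
  refine ⟨hτ, ?_, le_antisymm hle (costToGo_le_detectionRisk hf₀ hf₁ hr hc hZ hM h0 hτ)⟩
  -- As `c > 0`, a finite risk forces a finite mean delay. The delay is then almost surely finite,
  -- and since the change itself occurs almost surely, `τ` cannot be infinite.
  have hdelay : expDelay μ (Γ 0) τ ≠ ∞ := by
    intro h
    have : detectionRisk μ c (Γ 0) τ = ∞ := by
      rw [detectionRisk, h, ENNReal.mul_top (by simpa using hc), add_top]
    rw [this, top_le_iff] at hle
    exact ENNReal.ofReal_ne_top hle
  have hτm : Measurable τ := by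
    refine measurable_to_countable' fun a => ?_
    induction a using ENat.recTopCoe with
    | top =>
      have : τ ⁻¹' {⊤} = (⋃ k : ℕ, {ω | τ ω = (k : ℕ∞)})ᶜ := by
        ext ω
        rw [← not_iff_not]
        simpa [eq_comm] using ENat.ne_top_iff_exists (n := τ ω)
      rw [this]
      exact (MeasurableSet.iUnion fun k =>
        (obsFiltration Z hZ).le k _ (measurableSet_stopping_eq hτ k)).compl
    | coe k => exact (obsFiltration Z hZ).le k _ (measurableSet_stopping_eq hτ k)
  have hm : Measurable fun ω => ((τ ω - Γ 0 ω : ℕ∞) : ℝ≥0∞) :=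
    (Measurable.of_discrete (f := fun q : ℕ∞ × ℕ∞ => ((q.1 - q.2 : ℕ∞) : ℝ≥0∞))).comp
      (hτm.prodMk (hM.measurable_Γ 0))
  filter_upwards [ae_lt_top hm hdelay, ae_changePoint_lt_top hr hM h0] with ω h1 h2
  rw [lt_top_iff_ne_top]
  intro htop
  obtain ⟨y, hy⟩ := ENat.ne_top_iff_exists.mp h2.ne
  rw [htop, ← hy] at h1
  simp at h1

end Optimality

end ChangeDetection

/-! ### Assembly of the three parts of the theorem -/

theorem theorem1 {L : ℕ} [NeZero L] {X : Type*} [MeasurableSpace X] (ν : Measure X) [SigmaFinite ν]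
    (f₀ f₁ : X → ℝ) (hf₀ : IsProbDensity ν f₀)
    (hf₁ : IsProbDensity ν f₁)
    (r : Fin L → ℝ) (hr : ∀ i, r i ∈ Set.Icc (0 : ℝ) 1) (c : ℝ) (hc : 0 < c) :
    -- the infinite-horizon cost-to-go and its structure
    ((∀ p ∈ stdSimplex ℝ (Fin (L + 1)),
        (∀ k : ℕ, Tendsto (fun T => finCostToGo ν r f₀ f₁ c T k p) atTop
          (𝓝 (costToGo ν r f₀ f₁ c p))) ∧
        (∀ k : ℕ, Tendsto (fun T => expNext ν r f₀ f₁
            (finCostToGo ν r f₀ f₁ c T (k + 1)) p) atTop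
          (𝓝 (contCost ν r f₀ f₁ c p))) ∧
        Integrable (fun z => costToGo ν r f₀ f₁ c
            (beliefUpdate r f₀ f₁ p z) * predDensity r f₀ f₁ p z)
          (Measure.pi fun _ : Fin L => ν) ∧
        costToGo ν r f₀ f₁ c p =
          min (p 0) (c * (1 - p 0) + contCost ν r f₀ f₁ c p) ∧
        0 ≤ contCost ν r f₀ f₁ c p ∧
        contCost ν r f₀ f₁ c p ≤ 1 ∧
        (p 0 = 0 → contCost ν r f₀ f₁ c p = 0)) ∧
      ConcaveOn ℝ (stdSimplex ℝ (Fin (L + 1))) (contCost ν r f₀ f₁ c)) ∧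
    -- the change detection problem as a partially observable Markov decision process
    ∀ (Ω : Type*) [MeasurableSpace Ω] (μ : Measure Ω) [IsProbabilityMeasure μ]
      (Γ : Fin L → Ω → ℕ∞) (Z : ℕ → Ω → Fin L → X) (hZ : ∀ k, Measurable (Z k)),
      IsChangeModel μ ν r f₀ f₁ Γ Z →
      let ℱ := obsFiltration Z hZ
      let π := belief μ ℱ Γ
      let τopt := crossingTime c (contCost ν r f₀ f₁ c) π
      -- the hidden state is Markov, and the observations depend on the current state only
      (∀ k, ∀ᵐ ω ∂μ, ∃! j, ω ∈ stateEvent Γ k j) ∧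
      (∀ (k : ℕ) (j : Fin (L + 1)) (B : Set (Fin L → X)), MeasurableSet B →
        μ⟦stateEvent Γ (k + 1) j ∩ Z (k + 1) ⁻¹' B |
            fullHistory Γ Z k⟧ =ᵐ[μ]
          fun ω => (∑ m, (stateEvent Γ k m).indicator
              (fun _ => transW r j m) ω) *
            ∫ z in B, obsDensity f₀ f₁ j z ∂(Measure.pi fun _ : Fin L => ν)) ∧
      -- the Bayes risk is an expected additive cost in terms of the belief
      (∀ τ : Ω → ℕ∞, IsStoppingTime ℱ τ →
        detectionRisk μ c (Γ 0) τ = ∫⁻ ω, additiveCost c π τ ω ∂μ) ∧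
      -- the belief is a sufficient statistic
      (∀ k, ∀ᵐ ω ∂μ, π k ω ∈ stdSimplex ℝ (Fin (L + 1))) ∧
      (∀ᵐ ω ∂μ, π 0 ω = initBelief r) ∧
      (∀ k, ∀ᵐ ω ∂μ, 0 < predDensity r f₀ f₁ (π k ω) (Z (k + 1) ω) ∧
        π (k + 1) ω = beliefUpdate r f₀ f₁ (π k ω) (Z (k + 1) ω)) ∧
      (∀ (k : ℕ) (B : Set (Fin L → X)), MeasurableSet B →
        μ⟦Z (k + 1) ⁻¹' B | ℱ k⟧ =ᵐ[μ] fun ω =>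
          ∫ z in B, predDensity r f₀ f₁ (π k ω) z
            ∂(Measure.pi fun _ : Fin L => ν)) ∧
      (∀ T k : ℕ, k ≤ T → infoCostToGo μ ℱ (Γ 0) c (T - k) k =ᵐ[μ]
        fun ω => finCostToGo ν r f₀ f₁ c T k (π k ω)) ∧
      -- the optimal stopping rule compares an affine function of the belief with `A_J`
      (0 < r 0 →
        IsStoppingTime ℱ τopt ∧ (∀ᵐ ω ∂μ, τopt ω < ⊤) ∧
        detectionRisk μ c (Γ 0) τopt =
          ENNReal.ofReal (costToGo ν r f₀ f₁ c (initBelief r)) ∧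
        ∀ τ : Ω → ℕ∞, IsStoppingTime ℱ τ →
          detectionRisk μ c (Γ 0) τopt ≤ detectionRisk μ c (Γ 0) τ) := by
  refine ⟨costToGo_structure hf₀ hf₁ hr hc, ?_⟩
  intro Ω _ μ _ Γ Z hZ hM ℱ π τopt
  refine ⟨ae_existsUnique_state hM.law_Γ,
    fun k j B hB => condExp_next_fullHistory hf₀ hf₁ hr hZ hM k j hB, fun τ hτ => ?_,
    belief_mem hM ℱ, belief_zero hr hZ hM,
    fun k => (predDensity_pos hf₀ hf₁ hr hZ hM k).and (belief_succ hf₀ hf₁ hr hZ hM k),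
    fun k B hB => condExp_next_obs hf₀ hf₁ hr hZ hM k hB,
    fun T k _ => infoCostToGo_eq hf₀ hf₁ hr hZ hM hc (T - k) k, fun h0 => ?_⟩
  · rw [detectionRisk_eq_tsum hM hc hτ, lintegral_additiveCost
      (fun k => (measurable_belief ℱ k).mono (ℱ.le k) le_rfl) hτ]
  · obtain ⟨h1, h2, h3⟩ := crossingTime_optimal hf₀ hf₁ hr hc hZ hM h0
    exact ⟨h1, h2, h3, fun τ hτ =>
      h3.trans_le (costToGo_le_detectionRisk hf₀ hf₁ hr hc hZ hM h0 hτ)⟩
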